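/- Let $c>1$ be an integer coprime to $6$, let $\mathscr S$ be the set of primes dividing $c$, and let $\mathbb Z_{\mathscr S}\subset\mathbb Q$ be the ring of rational numbers that are integral at all primes in $\mathscr S$. Put $G_{\mathscr S}=\mathrm{GL}_2^+(\mathbb Z_{\mathscr S})$, $T=\begin{pmatrix}1&1\\0&1\end{pmatrix}$, $S=\begin{pmatrix}0&-1\\1&0\end{pmatrix}$. *Distributions.* Let $V=\mathbb Q^2$ (row vectors), $V_\ell=\mathbb Q_\ell^2$, and let $V_{\mathbb A}^{\mathscr S}$ be the restricted product of the $V_\ell$, $\ell\notin\mathscr S$, with respect to $\mathbb Z_\ell^2$. Let $\mathcal S(V_{\mathbb A}^{\mathscr S})$ be the restricted tensor product over $\ell\notin\mathscr S$ of the groups of locally constant compactly supported functions $V_\ell\to\mathbb Z$ (almost all factors of a simple tensor being $[\mathbb Z_\ell^2]$), viewed as functions on $V_{\mathbb A}^{\mathscr S}$, with the right action $(f|g)(v)=f(vg^{-1})$ of $\mathrm{GL}_2(\mathbb Q)$, and let $\mathcal D'(V_{\mathbb A}^{\mathscr S},A)$ be the group of homomorphisms to $A$ from the group of those $f$ with $f(0)=0$.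 For a right $G_{\mathscr S}$-module $A$, $G_{\mathscr S}$ acts on it by $(\gamma*\mu)(f)=\mu(f|\gamma)|\gamma^{-1}$; the action on $\mathbb Z$ is trivial, and on the ring $\mathcal O_{\mathcal H}$ of holomorphic functions on the upper half plane $\mathcal H$, and on its unit group $\mathcal O_{\mathcal H}^\times$, it is $(h|\gamma)(\tau)=h(\gamma\tau)$. Via restriction of $f\otimes\bigotimes_{\ell\in\mathscr S}[\mathbb Z_\ell^2]$ to $V$, we regard $f$ also as a function on $V$. It is invariant under $n\mathbb Z^2$ for some positive integer $n$ prime to $c$, and we say that a distribution $\mu$ is given by $\sigma:\mathbb Z_{\mathscr S}^2/\mathbb Z^2\to A$ if $\mu(f)=\sum_{v\in V/\mathbb Z^2}f(nv)\sigma(v)$ for all such $f$ and $n$; thus $\mu([v+\mathbb Z^2])=\sigma(v)$, and $\mu$ is invariant under positive scalars in $\mathbb Z_{\mathscr S}^\times$. For such $\mu$ put $\mu_c(f)=c^2\mu(f)-\mu(f|cI)$, where $cI$ denotes the scalar matrix, so that $[v+\mathbb Z^2]\,|\,cI=[cv+\mathbb Z^2]$ (for multiplicative values, $\mu_c(f)=\mu(f)^{c^2}/\mu(f|cI)$).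 Let $\mathbb B_r(x)=B_r(\langle x\rangle)$ be the periodified Bernoulli polynomials, where $\langle x\rangle$ is the fractional part of $x$, except that $\mathbb B_1(x)=0$ for $x\in\mathbb Z$. Let $\delta_0(x)=1$ if $x\in\mathbb Z$ and $0$ otherwise, $B_1(x)=\mathbb B_1(x)-\tfrac12\delta_0(x)$ as a function on $\mathbb Q/\mathbb Z$, and $\mathrm{Clog}(x)=\log(1-e^{2\pi ix})$ (principal branch) for $x\notin\mathbb Z$. For $\sigma_1,\sigma_2$ among these, $\sigma_1\otimes\sigma_2$ is given by $(a,b)\mapsto\sigma_1(a)\sigma_2(b)$; $\pi_c$ is given by $(a,b)\mapsto B_1(bc)\bigl(cB_1(a)-B_1(ac)\bigr)$; $\Psi=\pi_c+\tfrac12(\delta_0\otimes\mathbb B_1)_c$; and $u$ is the (multiplicative) distribution given by $$(a,b)\mapsto\prod_{y\in\mathbb Q_{>0}\cap(a+\mathbb Z)}\bigl(1-e^{2\pi i(y\tau+b)}\bigr)\prod_{y\in\mathbb Q_{<0}\cap(a+\mathbb Z)}\bigl(1-e^{-2\pi i(y\tau+b)}\bigr).$$ *The Dedekind–Rademacher class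 and cocycle.* The Kato–Siegel distribution $\mu_{KS}\in H^0(G_{\mathscr S},\mathcal D'(V_{\mathbb A}^{\mathscr S},\mathcal O_{\mathcal H}^\times))$ is the unique $G_{\mathscr S}$-invariant distribution with $$\mu_{KS}([(a,b)+\mathbb Z^2])(\tau)=(-1)^{(c-1)/2}\,\Theta(a\tau+b,\tau)^{c^2}\,\Theta(c(a\tau+b),\tau)^{-1}\qquad\bigl((a,b)\in\mathbb Z_{\mathscr S}^2\setminus\mathbb Z^2\bigr),$$ where $\Theta(u,\tau)=q^{1/12}(t^{1/2}-t^{-1/2})\prod_{n>0}(1-q^nt)(1-q^nt^{-1})$, $q=e^{2\pi i\tau}$, $t=e^{2\pi iu}$. Let $\mu_{DR}=\partial_{\mathscr S}(\mu_{KS})\in H^1(G_{\mathscr S},\mathcal D'(V_{\mathbb A}^{\mathscr S},\mathbb Z))$, where $\partial_{\mathscr S}$ is the connecting map for $0\to\mathbb Z\to\mathcal O_{\mathcal H}\to\mathcal O_{\mathcal H}^\times\to1$, $h\mapsto e^{2\pi ih}$. Let $$\tilde E(f)(\tau)=\frac\tau2(\mathbb B_2\otimes\mathbb B_0)_c(f)+\pi_c(f)+\frac1{2\pi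 i}(\delta_0\otimes\mathrm{Clog})_c(f)+\frac1{2\pi i}\int_{i\infty}^\tau d\log u_c(f).$$ **Theorem.** There is a unique Kato–Siegel distribution $\mu_{KS}$ as above, $\tilde E$ belongs to $\mathcal D'(V_{\mathbb A}^{\mathscr S},\mathcal O_{\mathcal H})$, and the homogeneous coboundary $(\gamma_0,\gamma_1)\mapsto\gamma_1*\tilde E-\gamma_0*\tilde E$ of the $0$-cochain $\gamma\mapsto\gamma*\tilde E$ takes values in $\mathcal D'(V_{\mathbb A}^{\mathscr S},\mathbb Z)$. The resulting homogeneous cocycle $\boldsymbol{DR}_{\mathscr S}=d^0\tilde E\in Z^1(G_{\mathscr S},\mathcal D'(V_{\mathbb A}^{\mathscr S},\mathbb Z))$ represents $\mu_{DR}$, and it is the unique element of $Z^1(G_{\mathscr S},\mathcal D'(V_{\mathbb A}^{\mathscr S},\mathbb Z))$ with the following three properties (for all test functions $f$ with $f(0)=0$): 1. $\boldsymbol{DR}_{\mathscr S}(\mathrm{Id},\gamma)=0$ for all diagonal $\gamma\in G_{\mathscr S}$ with positive diagonal entries; 2. $\boldsymbol{DR}_{\mathscr S}(\mathrm{Id},T)(f)=-\tfrac12(\mathbb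 B_2\otimes\mathbb B_0)_c(f|T)+\Psi(f|T-f)$; 3. $\boldsymbol{DR}_{\mathscr S}(\mathrm{Id},S)(f)=(\mathbb B_1\otimes\mathbb B_1)_c(f)+\Psi(f|S-f)$. -/

import Mathlib

open Filter UpperHalfPlane
open scoped RestrictedProduct Manifold MatrixGroups

noncomputable section

namespace DedekindRademacher

/-! ### The prime-to-`S` finite adeles of the plane `V = ℚ²` -/

/-- The primes that do not belong to `S`. -/
abbrev Off (S : Set Nat.Primes) : Type := {p : Nat.Primes // p ∉ S}

instance factPrimes (p : Nat.Primes) : Fact (p : ℕ).Prime := ⟨p.2⟩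

/-- The rational plane `V = ℚ²` (row vectors). -/
abbrev V : Type := Fin 2 → ℚ

/-- The coset `x + ℤ_p²` in `ℚ_p²`. -/
def localCoset (p : ℕ) [Fact p.Prime] (x : Fin 2 → ℚ_[p]) : Set (Fin 2 → ℚ_[p]) :=
  {w | ∀ i, ‖w i - x i‖ ≤ 1}

/-- `V_𝔸^S`, the restricted product of the `V_p = ℚ_p²`, `p ∉ S`, with respect to `ℤ_p²`. -/
abbrev VA (S : Set Nat.Primes) : Type :=
  Πʳ p : Off S, [Fin 2 → ℚ_[((p : Nat.Primes) : ℕ)], localCoset ((p : Nat.Primes) : ℕ) 0]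

/-- A rational number is a `p`-adic integer for almost all `p`. -/
lemma eventually_integral (S : Set Nat.Primes) (q : ℚ) :
    ∀ᶠ p : Off S in cofinite, ‖(q : ℚ_[((p : Nat.Primes) : ℕ)])‖ ≤ 1 := by
  have hfin : {p : Off S | ((p : Nat.Primes) : ℕ) ∣ q.den}.Finite := by
    refine Set.Finite.of_finite_image (f := fun p : Off S => ((p : Nat.Primes) : ℕ)) ?_ ?_
    · refine (Finset.finite_toSet q.den.divisors).subset ?_
      rintro _ ⟨p, hp, rfl⟩
      exact Finset.mem_coe.mpr (Nat.mem_divisors.mpr ⟨hp, q.den_nz⟩)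
    · intro a _ b _ h
      exact Subtype.ext (Subtype.ext h)
  rw [Filter.eventually_cofinite]
  refine hfin.subset ?_
  intro p hp
  by_contra h
  exact hp (Padic.norm_rat_le_one h)

/-- The diagonal embedding `V → V_𝔸^S`. -/
def diag (S : Set Nat.Primes) (v : V) : VA S :=
  ⟨fun _ i => (v i : ℚ_[_]), by
    filter_upwards [eventually_integral S (v 0), eventually_integral S (v 1)] with p h0 h1 i
    fin_cases i
    · simpa using h0
    · simpa using h1⟩

/-- The image in `M_2(ℚ_p)` of a rational matrix. -/
def locMat (p : ℕ) [Fact p.Prime] (g : GL (Fin 2) ℚ) : Matrix (Fin 2) (Fin 2) ℚ_[p] :=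
  (g : Matrix (Fin 2) (Fin 2) ℚ).map (Rat.castHom ℚ_[p])

lemma locMat_mul (p : ℕ) [Fact p.Prime] (g h : GL (Fin 2) ℚ) :
    locMat p (g * h) = locMat p g * locMat p h := by
  ext i j
  simp [locMat, Matrix.mul_apply]

lemma locMat_one (p : ℕ) [Fact p.Prime] : locMat p 1 = 1 := by
  simp [locMat]

/-- For almost all `p` the matrix `g` is `p`-integral. -/
lemma eventually_locMat (S : Set Nat.Primes) (g : GL (Fin 2) ℚ) :
    ∀ᶠ p : Off S in cofinite, ∀ i j, ‖locMat ((p : Nat.Primes) : ℕ) g i j‖ ≤ 1 := by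
  have h : ∀ i j, ∀ᶠ p : Off S in cofinite, ‖locMat ((p : Nat.Primes) : ℕ) g i j‖ ≤ 1 := by
    intro i j
    simpa [locMat] using eventually_integral S (g i j)
  exact Filter.eventually_all.mpr fun i => Filter.eventually_all.mpr fun j => h i j

lemma vecMul_mem (p : ℕ) [Fact p.Prime] (A : Matrix (Fin 2) (Fin 2) ℚ_[p])
    (hA : ∀ i j, ‖A i j‖ ≤ 1) (w : Fin 2 → ℚ_[p]) (hw : w ∈ localCoset p 0) :
    Matrix.vecMul w A ∈ localCoset p 0 := by
  intro j
  have h0 := hw 0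
  have h1 := hw 1
  simp only [Pi.zero_apply, sub_zero] at h0 h1
  simp only [Matrix.vecMul, dotProduct, Fin.sum_univ_two, Pi.zero_apply, sub_zero]
  refine (Padic.nonarchimedean _ _).trans (max_le ?_ ?_)
  · rw [norm_mul]; exact mul_le_one₀ h0 (norm_nonneg _) (hA 0 j)
  · rw [norm_mul]; exact mul_le_one₀ h1 (norm_nonneg _) (hA 1 j)

/-- Right multiplication of row vectors in `V_𝔸^S` by `g ∈ GL_2(ℚ)`, embedded diagonally. -/
def rightMul (S : Set Nat.Primes) (g : GL (Fin 2) ℚ) (v : VA S) : VA S :=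
  ⟨fun p => Matrix.vecMul (v p) (locMat ((p : Nat.Primes) : ℕ) g), by
    filter_upwards [v.2, eventually_locMat S g] with p h1 h2
    exact vecMul_mem _ _ h2 _ h1⟩

lemma rightMul_one (S : Set Nat.Primes) (v : VA S) : rightMul S 1 v = v := by
  apply RestrictedProduct.ext
  intro p
  change Matrix.vecMul (v p) _ = v p
  rw [locMat_one, Matrix.vecMul_one]

lemma rightMul_mul (S : Set Nat.Primes) (g h : GL (Fin 2) ℚ) (v : VA S) :
    rightMul S (g * h) v = rightMul S h (rightMul S g v) := by
  apply RestrictedProduct.ext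
  intro p
  change Matrix.vecMul (v p) (locMat ((p : Nat.Primes) : ℕ) (g * h)) =
    Matrix.vecMul (Matrix.vecMul (v p) (locMat ((p : Nat.Primes) : ℕ) g))
      (locMat ((p : Nat.Primes) : ℕ) h)
  rw [locMat_mul, Matrix.vecMul_vecMul]

lemma rightMul_zero (S : Set Nat.Primes) (g : GL (Fin 2) ℚ) :
    rightMul S g (diag S 0) = diag S 0 := by
  apply RestrictedProduct.ext
  intro p
  change Matrix.vecMul (fun _ => ((0 : ℚ) : ℚ_[((p : Nat.Primes) : ℕ)])) (locMat _ g) =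
    fun _ => ((0 : ℚ) : ℚ_[((p : Nat.Primes) : ℕ)])
  funext j
  simp [Matrix.vecMul, dotProduct]

/-! ### Test functions -/

/-- `𝒮(V_p)`: locally constant, compactly supported functions `ℚ_p² → ℤ`. -/
def localTest (p : ℕ) [Fact p.Prime] : Set ((Fin 2 → ℚ_[p]) → ℤ) :=
  {f | IsLocallyConstant f ∧ HasCompactSupport f}

/-- The characteristic function of the coset `x + ℤ_p²`. -/
def localChar (p : ℕ) [Fact p.Prime] (x : Fin 2 → ℚ_[p]) : (Fin 2 → ℚ_[p]) → ℤ :=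
  (localCoset p x).indicator 1

/-- The function `⊗ f_p` on `V_𝔸^S`. -/
def pureTensor (S : Set Nat.Primes)
    (f : ∀ p : Off S, (Fin 2 → ℚ_[((p : Nat.Primes) : ℕ)]) → ℤ) : VA S → ℤ :=
  fun v => ∏ᶠ p : Off S, f p (v p)

/-- The simple tensors `⊗ f_p` with all `f_p` test functions and almost all `f_p = [ℤ_p²]`. -/
def simpleTensors (S : Set Nat.Primes) : Set (VA S → ℤ) :=
  {F | ∃ f : ∀ p : Off S, (Fin 2 → ℚ_[((p : Nat.Primes) : ℕ)]) → ℤ,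
    (∀ p : Off S, f p ∈ localTest ((p : Nat.Primes) : ℕ)) ∧
    (∀ᶠ p : Off S in cofinite, f p = localChar ((p : Nat.Primes) : ℕ) 0) ∧ F = pureTensor S f}

/-- `𝒮(V_𝔸^S)`, the restricted tensor product of the `𝒮(V_p)`, `p ∉ S`, realised as the group of
functions on `V_𝔸^S` spanned by the simple tensors. -/
def TestA (S : Set Nat.Primes) : AddSubgroup (VA S → ℤ) :=
  AddSubgroup.closure (simpleTensors S)

/-- The test functions supported away from `0`. -/
def Test' (S : Set Nat.Primes) : AddSubgroup (VA S → ℤ) where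
  carrier := {f | f ∈ TestA S ∧ f (diag S 0) = 0}
  add_mem' := by
    rintro f g ⟨hf, hf0⟩ ⟨hg, hg0⟩
    exact ⟨add_mem hf hg, by simp [hf0, hg0]⟩
  zero_mem' := ⟨zero_mem _, rfl⟩
  neg_mem' := by
    rintro f ⟨hf, hf0⟩
    exact ⟨neg_mem hf, by simp [hf0]⟩

lemma localChar_mem (p : ℕ) [Fact p.Prime] (x : Fin 2 → ℚ_[p]) :
    localChar p x ∈ localTest p := by
  have hset : localCoset p x = Metric.closedBall x 1 := by
    ext w
    rw [Metric.mem_closedBall, dist_pi_le_iff zero_le_one]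
    simp only [localCoset, dist_eq_norm, Set.mem_ofPred_eq]
  have hopen : IsOpen (localCoset p x) := by
    have : localCoset p x = ⋂ i : Fin 2, (fun w : Fin 2 → ℚ_[p] => w i) ⁻¹'
        Metric.closedBall (x i) 1 := by
      ext w
      simp [localCoset, dist_eq_norm]
    rw [this]
    exact isOpen_iInter_of_finite fun i =>
      (IsUltrametricDist.isOpen_closedBall (x i) one_ne_zero).preimage (continuous_apply i)
  have hclopen : IsClopen (localCoset p x) := ⟨hset ▸ Metric.isClosed_closedBall, hopen⟩
  refine ⟨?_, ?_⟩
  · exact (LocallyConstant.charFn ℤ hclopen).isLocallyConstant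
  · refine HasCompactSupport.intro (K := localCoset p x) ?_ ?_
    · rw [hset]; exact isCompact_closedBall x 1
    · intro w hw
      exact Set.indicator_of_notMem hw _

lemma localTest_comp (p : ℕ) [Fact p.Prime] (g : GL (Fin 2) ℚ)
    {f : (Fin 2 → ℚ_[p]) → ℤ} (hf : f ∈ localTest p) :
    (fun w => f (Matrix.vecMul w (locMat p g))) ∈ localTest p := by
  have hcont : ∀ A : Matrix (Fin 2) (Fin 2) ℚ_[p],
      Continuous fun w : Fin 2 → ℚ_[p] => Matrix.vecMul w A := fun A =>
    Continuous.matrix_vecMul continuous_id continuous_const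
  refine ⟨hf.1.comp_continuous (hcont _), ?_⟩
  let e : (Fin 2 → ℚ_[p]) ≃ₜ (Fin 2 → ℚ_[p]) :=
    { toFun := fun w => Matrix.vecMul w (locMat p g)
      invFun := fun w => Matrix.vecMul w (locMat p g⁻¹)
      left_inv := fun w => by
        simp [Matrix.vecMul_vecMul, ← locMat_mul, locMat_one]
      right_inv := fun w => by
        simp [Matrix.vecMul_vecMul, ← locMat_mul, locMat_one]
      continuous_toFun := hcont _
      continuous_invFun := hcont _ }
  exact hf.2.comp_homeomorph e

lemma localChar_comp (p : ℕ) [Fact p.Prime] (g : GL (Fin 2) ℚ)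
    (h1 : ∀ i j, ‖locMat p g i j‖ ≤ 1) (h2 : ∀ i j, ‖locMat p g⁻¹ i j‖ ≤ 1) :
    (fun w => localChar p 0 (Matrix.vecMul w (locMat p g))) = localChar p 0 := by
  classical
  funext w
  have hiff : Matrix.vecMul w (locMat p g) ∈ localCoset p 0 ↔ w ∈ localCoset p 0 := by
    refine ⟨fun h => ?_, fun h => vecMul_mem p _ h1 _ h⟩
    have := vecMul_mem p _ h2 _ h
    rwa [Matrix.vecMul_vecMul, ← locMat_mul, mul_inv_cancel, locMat_one,
      Matrix.vecMul_one] at this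
  simp only [localChar, Set.indicator_apply, hiff]
  rfl

lemma testA_comp (S : Set Nat.Primes) (g : GL (Fin 2) ℚ) {F : VA S → ℤ} (hF : F ∈ TestA S) :
    (fun v => F (rightMul S g v)) ∈ TestA S := by
  induction hF using AddSubgroup.closure_induction with
  | mem F hF =>
    obtain ⟨f, hf, hf0, rfl⟩ := hF
    refine AddSubgroup.subset_closure
      ⟨fun p w => f p (Matrix.vecMul w (locMat ((p : Nat.Primes) : ℕ) g)),
        fun p => localTest_comp _ g (hf p), ?_, rfl⟩
    filter_upwards [hf0, eventually_locMat S g, eventually_locMat S g⁻¹] with p h0 h1 h2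
    rw [h0]
    exact localChar_comp _ g h1 h2
  | zero => exact zero_mem _
  | add F G _ _ hF hG => exact add_mem hF hG
  | neg F _ hF => exact neg_mem hF

/-- The right action of `GL_2(ℚ)` on test functions, `(f ∣ g)(v) = f(v g⁻¹)`. -/
def slash {S : Set Nat.Primes} (f : Test' S) (g : GL (Fin 2) ℚ) : Test' S :=
  ⟨fun v => f.1 (rightMul S g⁻¹ v), testA_comp S g⁻¹ f.2.1, by
    change f.1 (rightMul S g⁻¹ (diag S 0)) = 0
    rw [rightMul_zero]; exact f.2.2⟩

lemma slash_one {S : Set Nat.Primes} (f : Test' S) : slash f 1 = f := by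
  apply Subtype.ext
  funext v
  simp [slash, rightMul_one]

lemma slash_mul {S : Set Nat.Primes} (f : Test' S) (g h : GL (Fin 2) ℚ) :
    slash f (g * h) = slash (slash f g) h := by
  apply Subtype.ext
  funext v
  simp [slash, rightMul_mul]

lemma slash_add {S : Set Nat.Primes} (f f' : Test' S) (g : GL (Fin 2) ℚ) :
    slash (f + f') g = slash f g + slash f' g := rfl

/-- The function on `V = ℚ²` attached to an `S`-adelic test function `f`: the restriction to `V` of
`f ⊗ ⊗_{p ∈ S} [ℤ_p²]`. -/
def toV {S : Set Nat.Primes} (f : Test' S) : V → ℤ :=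
  {v : V | ∀ p ∈ S, ∀ i, ‖(v i : ℚ_[(p : ℕ)])‖ ≤ 1}.indicator fun v => f.1 (diag S v)

/-! ### The group `G_S = GL_2⁺(ℤ_S)` -/

/-- `ℤ_S`: the rational numbers that are integral at all primes in `S`. -/
def ZS (S : Set Nat.Primes) : Subring ℚ where
  carrier := {x | ∀ p ∈ S, ‖(x : ℚ_[(p : ℕ)])‖ ≤ 1}
  mul_mem' := by
    intro a b ha hb p hp
    rw [Rat.cast_mul, norm_mul]
    exact mul_le_one₀ (ha p hp) (norm_nonneg _) (hb p hp)
  one_mem' := by intro p _; simp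
  add_mem' := by
    intro a b ha hb p hp
    rw [Rat.cast_add]
    exact (Padic.nonarchimedean _ _).trans (max_le (ha p hp) (hb p hp))
  zero_mem' := by intro p _; simp
  neg_mem' := by
    intro a ha p hp
    rw [Rat.cast_neg, norm_neg]
    exact ha p hp

/-- `G_S = GL_2⁺(ℤ_S)`. -/
abbrev GS (S : Set Nat.Primes) : Type := Matrix.GLPos (Fin 2) (ZS S)

/-- The inclusion `G_S → GL_2(ℚ)`. -/
def toGLQ (S : Set Nat.Primes) : GS S →* GL (Fin 2) ℚ :=
  (Matrix.GeneralLinearGroup.map (ZS S).subtype).comp (Subgroup.subtype _)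

/-- The inclusion `G_S → GL_2(ℝ)`. -/
def toGLR (S : Set Nat.Primes) : GS S →* GL (Fin 2) ℝ :=
  (Matrix.GeneralLinearGroup.map (Rat.castHom ℝ)).comp (toGLQ S)

lemma toGLR_det_pos (S : Set Nat.Primes) (γ : GS S) : 0 < (toGLR S γ).det.val := by
  have h : (toGLR S γ).det.val = (((γ : GL (Fin 2) (ZS S)).det.val : ZS S) : ℚ) := by
    simp [toGLR, toGLQ, Matrix.det_fin_two]
  rw [h]
  exact_mod_cast γ.2

/-- The inclusion `SL_2(ℤ) → G_S`. -/
def ofSL (S : Set Nat.Primes) : SL(2, ℤ) →* GS S :=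
  Matrix.SpecialLinearGroup.toGLPos.comp
    (Matrix.SpecialLinearGroup.map (Int.castRingHom (ZS S)))

/-- `S = [[0, -1], [1, 0]]` as an element of `G_S`. -/
def matS (S : Set Nat.Primes) : GS S := ofSL S ModularGroup.S

/-- `T = [[1, 1], [0, 1]]` as an element of `G_S`. -/
def matT (S : Set Nat.Primes) : GS S := ofSL S ModularGroup.T

/-- `γ` is a diagonal matrix with positive diagonal entries. -/
def IsPosDiagonal {S : Set Nat.Primes} (γ : GS S) : Prop :=
  (toGLQ S γ) 0 1 = 0 ∧ (toGLQ S γ) 1 0 = 0 ∧ 0 < (toGLQ S γ) 0 0 ∧ 0 < (toGLQ S γ) 1 1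

/-! ### Holomorphic functions on the upper half plane -/

/-- The ring `𝒪_ℋ` of holomorphic functions on the upper half plane; its unit group `OHˣ` is
`𝒪_ℋ^×`. -/
def OH : Subring (ℍ → ℂ) where
  carrier := {h | MDifferentiable 𝓘(ℂ) 𝓘(ℂ) h}
  mul_mem' := fun ha hb => ha.mul hb
  one_mem' := mdifferentiable_const
  add_mem' := fun ha hb => ha.add hb
  zero_mem' := mdifferentiable_const
  neg_mem' := fun ha => ha.neg

/-- The left action `(γ, h) ↦ h ∘ γ⁻¹` of `G_S` on `𝒪_ℋ`, that is `h ∣ γ⁻¹` for the right action by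
Möbius transformations. -/
def moebius (S : Set Nat.Primes) : GS S →* (OH →+* OH) where
  toFun γ :=
    { toFun := fun h => ⟨fun τ => h.1 (toGLR S γ⁻¹ • τ),
        MDifferentiable.comp h.2 (UpperHalfPlane.mdifferentiable_smul (toGLR_det_pos S γ⁻¹))⟩
      map_one' := rfl
      map_mul' := fun _ _ => rfl
      map_zero' := rfl
      map_add' := fun _ _ => rfl }
  map_one' := by
    ext h τ
    simp
  map_mul' γ γ' := by
    ext h τ
    simp [mul_smul]

/-- The homomorphism `𝒪_ℋ → 𝒪_ℋ^×`, `h ↦ e^{2πih}`. -/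
def expOH : OH →+ Additive OHˣ where
  toFun h := Additive.ofMul
    { val := ⟨fun τ => Complex.exp (2 * Real.pi * Complex.I * h.1 τ), by
        have hd : Differentiable ℂ fun z : ℂ => Complex.exp (2 * Real.pi * Complex.I * z) := by
          fun_prop
        exact hd.mdifferentiable.comp h.2⟩
      inv := ⟨fun τ => Complex.exp (-(2 * Real.pi * Complex.I * h.1 τ)), by
        have hd : Differentiable ℂ fun z : ℂ => Complex.exp (-(2 * Real.pi * Complex.I * z)) := by
          fun_prop
        exact hd.mdifferentiable.comp h.2⟩
      val_inv := by
        ext τ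
        simp [← Complex.exp_add]
      inv_val := by
        ext τ
        simp [← Complex.exp_add] }
  map_zero' := by
    apply Additive.toMul.injective
    ext τ
    simp
  map_add' h h' := by
    apply Additive.toMul.injective
    ext τ
    simp [mul_add, Complex.exp_add]

/-! ### Distributions -/

/-- `𝒟'(V_𝔸^S, A) = Hom(𝒮((V_𝔸^S)'), A)`. -/
abbrev Dist (S : Set Nat.Primes) (A : Type) [AddCommGroup A] : Type := Test' S →+ A

/-- The left action `(γ * μ)(f) = μ(f ∣ γ) ∣ γ⁻¹` of `G_S` on distributions; the right `G_S`-module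
`A` is given by the left action `ρ γ a = a ∣ γ⁻¹`. -/
def distRep (S : Set Nat.Primes) {A : Type} [AddCommGroup A] (ρ : GS S →* AddMonoid.End A) :
    GS S →* AddMonoid.End (Dist S A) where
  toFun γ :=
    { toFun := fun μ =>
        { toFun := fun f => ρ γ (μ (slash f (toGLQ S γ)))
          map_zero' := by
            have : slash (0 : Test' S) (toGLQ S γ) = 0 := rfl
            simp [this]
          map_add' := fun f f' => by simp [slash_add] }
      map_zero' := by ext f; simp
      map_add' := fun μ μ' => by ext f; simp }
  map_one' := by
    ext μ f
    change ρ 1 (μ (slash f (toGLQ S 1))) = μ f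
    rw [map_one, map_one, slash_one]
    rfl
  map_mul' γ γ' := by
    ext μ f
    change ρ (γ * γ') (μ (slash f (toGLQ S (γ * γ')))) =
      ρ γ (ρ γ' (μ (slash (slash f (toGLQ S γ)) (toGLQ S γ'))))
    rw [map_mul, map_mul, slash_mul]
    rfl

/-- `𝒟'(V_𝔸^S, ℤ)`, with trivial action on `ℤ`. -/
def repZ (S : Set Nat.Primes) : GS S →* AddMonoid.End (Dist S ℤ) := distRep S 1

/-- `𝒟'(V_𝔸^S, 𝒪_ℋ)`. -/
def repO (S : Set Nat.Primes) : GS S →* AddMonoid.End (Dist S OH) :=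
  distRep S
    { toFun := fun γ => (moebius S γ).toAddMonoidHom
      map_one' := by rw [map_one]; rfl
      map_mul' := fun γ γ' => by rw [map_mul]; rfl }

/-- `𝒟'(V_𝔸^S, 𝒪_ℋ^×)`. -/
def repU (S : Set Nat.Primes) : GS S →* AddMonoid.End (Dist S (Additive OHˣ)) :=
  distRep S
    { toFun := fun γ => (Units.map (moebius S γ).toMonoidHom).toAdditive
      map_one' := by rw [map_one]; rfl
      map_mul' := fun γ γ' => by rw [map_mul]; rfl }

/-! ### Group cohomology by homogeneous cochains -/

section Cohomology

variable {G : Type} [Group G] {M : Type} [AddCommGroup M]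

/-- The differential `d^n`. -/
def hd (n : ℕ) : ((Fin (n + 1) → G) → M) →+ ((Fin (n + 2) → G) → M) where
  toFun f := fun g => ∑ i : Fin (n + 2), (-1 : ℤ) ^ (i : ℕ) • f (fun j => g (i.succAbove j))
  map_zero' := by ext g; simp
  map_add' f f' := by ext g; simp [Finset.sum_add_distrib]

/-- `M^G = H⁰(G, M)`. -/
def invariants (ρ : G →* AddMonoid.End M) : AddSubgroup M where
  carrier := {m | ∀ γ, ρ γ m = m}
  add_mem' := by intro a b ha hb γ; rw [map_add, ha γ, hb γ]
  zero_mem' := by intro γ; exact map_zero _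
  neg_mem' := by intro a ha γ; rw [map_neg, ha γ]

/-- The homogeneous cochains `C^n(G, M)`: functions `f : G^{n+1} → M` with
`γ * f(γ⁻¹ g) = f(g)`. -/
def cochains (ρ : G →* AddMonoid.End M) (n : ℕ) : AddSubgroup ((Fin (n + 1) → G) → M) where
  carrier := {f | ∀ γ g, ρ γ (f (fun j => γ⁻¹ * g j)) = f g}
  add_mem' := by
    intro a b ha hb γ g
    rw [Pi.add_apply, map_add, ha γ g, hb γ g, Pi.add_apply]
  zero_mem' := by intro γ g; exact map_zero _
  neg_mem' := by intro a ha γ g; rw [Pi.neg_apply, map_neg, ha γ g, Pi.neg_apply]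

/-- `Z^n(G, M)`. -/
def cocycles (ρ : G →* AddMonoid.End M) (n : ℕ) : AddSubgroup ((Fin (n + 1) → G) → M) :=
  cochains ρ n ⊓ (hd n).ker

/-- `B^1(G, M)`. -/
def coboundaries1 (ρ : G →* AddMonoid.End M) : AddSubgroup ((Fin 2 → G) → M) :=
  (cochains ρ 0).map (hd 0)

/-- `H^1(G, M) = Z^1(G, M) / B^1(G, M)`. -/
abbrev H1 (ρ : G →* AddMonoid.End M) : Type :=
  cocycles ρ 1 ⧸ (coboundaries1 ρ).addSubgroupOf (cocycles ρ 1)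

end Cohomology

/-- The connecting map `∂_S : H⁰(G_S, 𝒟'(V_𝔸^S, 𝒪_ℋ^×)) → H¹(G_S, 𝒟'(V_𝔸^S, ℤ))` of the short exact
sequence `0 → ℤ → 𝒪_ℋ → 𝒪_ℋ^× → 1` (the second map is `h ↦ e^{2πih}`), as a relation: `∂_S μ = x`
if there are a `0`-cochain `e` lifting `μ` and a `1`-cocycle `z` of class `x` with `d⁰e = z`. -/
def IsConnecting (S : Set Nat.Primes) (μ : Dist S (Additive OHˣ)) (x : H1 (repZ S)) : Prop :=
  ∃ e ∈ cochains (repO S) 0, (∀ g f, expOH (e g f) = μ f) ∧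
    ∃ z : cocycles (repZ S) 1,
      (∀ g f, hd 0 e g f = (((z : (Fin 2 → GS S) → Dist S ℤ) g f : ℤ) : OH)) ∧
      QuotientAddGroup.mk z = x

/-! ### Scalar-invariant distributions with prescribed values on the cosets of `ℤ²` -/

/-- The least positive integer `n` such that `F` is `nℤ²`-invariant. -/
def period (F : V → ℤ) : ℕ :=
  sInf {n : ℕ | 0 < n ∧ ∀ (v : V) (w : Fin 2 → ℤ), F (v + fun i => (n : ℚ) * w i) = F v}

/-- The representatives in `[0,1)²` of `V/ℤ²`. -/
abbrev Box : Type := {v : V // ∀ i, 0 ≤ v i ∧ v i < 1}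

/-- The value at `f` of the distribution which is invariant under positive scalars and whose value
at the coset `[v + ℤ²]` is `σ v`: if `f` is `nℤ²`-invariant, then
`f(n · ) = ∑_{v ∈ V/ℤ²} f(nv) [v + ℤ²]`. -/
def cosetDist {S : Set Nat.Primes} {A : Type} [AddCommGroup A] (σ : V → A) (f : Test' S) : A :=
  ∑ᶠ v : Box, toV f ((period (toV f) : ℚ) • v.1) • σ v.1

/-- The same for multiplicative values. -/
def cosetDistMul {S : Set Nat.Primes} (σ : V → ℂ) (f : Test' S) : ℂ :=
  ∏ᶠ v : Box, σ v.1 ^ toV f ((period (toV f) : ℚ) • v.1)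

/-- The scalar matrix `D(c)`. -/
def scalarD (c : ℕ) [NeZero c] : GL (Fin 2) ℚ :=
  Matrix.GeneralLinearGroup.scalar (Fin 2)
    (Units.mk0 (c : ℚ) (Nat.cast_ne_zero.mpr (NeZero.ne c)))

/-- The `c`-smoothing `μ_c = (c²[Id] - [D(c)]) * μ` (scalars act trivially on `A`). -/
def smooth (c : ℕ) [NeZero c] {S : Set Nat.Primes} {A : Type} [AddCommGroup A]
    (μ : Test' S → A) (f : Test' S) : A :=
  ((c : ℤ) ^ 2) • μ f - μ (slash f (scalarD c))

/-- The periodified Bernoulli function `𝔹_r`. -/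
def perB (r : ℕ) (x : ℚ) : ℚ :=
  if r = 1 ∧ Int.fract x = 0 then 0 else (Polynomial.bernoulli r).eval (Int.fract x)

/-- The rank one Dirac distribution on cosets: `δ₀([x + ℤ]) = 1` if `x ∈ ℤ` and `0` otherwise. -/
def dirac (x : ℚ) : ℚ := if Int.fract x = 0 then 1 else 0

/-- `B_1 = 𝔹_1 - δ₀/2`. -/
def B1 (x : ℚ) : ℚ := perB 1 x - dirac x / 2

/-- `e(z) = e^{2πiz}`. -/
def e (z : ℂ) : ℂ := Complex.exp (2 * Real.pi * Complex.I * z)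

/-- `Clog([x + ℤ]) = log(1 - e(x))` for `x ∉ ℤ`; the principal logarithm agrees with the power
series of `log(1 - z)` on the closed unit disc minus the point `1`. -/
def clog (x : ℚ) : ℂ := Complex.log (1 - e x)

/-- `(𝔹_2 ⊗ 𝔹_0)_c`. -/
def B2B0 (c : ℕ) [NeZero c] {S : Set Nat.Primes} : Test' S → ℚ :=
  smooth c (cosetDist fun v => perB 2 (v 0) * perB 0 (v 1))

/-- `(𝔹_1 ⊗ 𝔹_1)_c`. -/
def B1B1 (c : ℕ) [NeZero c] {S : Set Nat.Primes} : Test' S → ℚ :=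
  smooth c (cosetDist fun v => perB 1 (v 0) * perB 1 (v 1))

/-- `π_c`, with `π_c([(a,b) + ℤ²]) = B_1(bc) (c B_1(a) - B_1(ac))`. -/
def piC (c : ℕ) {S : Set Nat.Primes} : Test' S → ℚ :=
  cosetDist fun v => B1 (v 1 * c) * (c * B1 (v 0) - B1 (v 0 * c))

/-- `Ψ = π_c + ½ (δ₀ ⊗ 𝔹_1)_c`. -/
def Psi (c : ℕ) [NeZero c] {S : Set Nat.Primes} (f : Test' S) : ℚ :=
  piC c f + 1 / 2 * smooth c (cosetDist fun v => dirac (v 0) * perB 1 (v 1)) f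

/-- `(δ₀ ⊗ Clog)_c`. -/
def diracClog (c : ℕ) [NeZero c] {S : Set Nat.Primes} : Test' S → ℂ :=
  smooth c (cosetDist fun v => (dirac (v 0) : ℂ) * clog (v 1))

/-- The value at `[v + ℤ²]` of the theta-unit distribution `u`. -/
def thetaUnit (τ : ℍ) (v : V) : ℂ :=
  (∏' y : {y : ℚ // 0 < y ∧ ∃ k : ℤ, y = v 0 + k}, (1 - e (y.1 * τ + v 1))) *
    ∏' y : {y : ℚ // y < 0 ∧ ∃ k : ℤ, y = v 0 + k}, (1 - e (-y.1 * τ - v 1))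

/-- The function `u_c(f)` on the upper half plane. -/
def uC (c : ℕ) [NeZero c] {S : Set Nat.Primes} (f : Test' S) (τ : ℍ) : ℂ :=
  cosetDistMul (thetaUnit τ) f ^ (c ^ 2) / cosetDistMul (thetaUnit τ) (slash f (scalarD c))

/-- `∫_{i∞}^τ dlog(u_c(f))`, along the vertical half line above `τ`. -/
def dlogIntegral (c : ℕ) [NeZero c] {S : Set Nat.Primes} (f : Test' S) (τ : ℍ) : ℂ :=
  -∫ t in Set.Ioi (0 : ℝ),
    logDeriv (fun z : ℂ => uC c f (ofComplex z)) (τ + t * Complex.I) * Complex.I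

/-- The function `Ẽ(f)` on the upper half plane. -/
def Etilde (c : ℕ) [NeZero c] {S : Set Nat.Primes} (f : Test' S) (τ : ℍ) : ℂ :=
  (τ : ℂ) / 2 * (B2B0 c f : ℂ) + (piC c f : ℂ) +
    1 / (2 * Real.pi * Complex.I) * diracClog c f +
    1 / (2 * Real.pi * Complex.I) * dlogIntegral c f τ

/-! ### The Kato–Siegel distribution -/

/-- The set of primes dividing `c`. -/
def primesOf (c : ℕ) : Set Nat.Primes := {p | (p : ℕ) ∣ c}

/-- `Θ(u, τ) = q^{1/12} (t^{1/2} - t^{-1/2}) ∏_{n>0} (1 - qⁿt)(1 - qⁿt⁻¹)` with `q = e(τ)` and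
`t = e(u)`. -/
def Theta (u : ℂ) (τ : ℍ) : ℂ :=
  e (τ / 12) * (e (u / 2) - e (-u / 2)) *
    ∏' n : ℕ, ((1 - e ((n + 1) * τ + u)) * (1 - e ((n + 1) * τ - u)))

/-- The Kato–Siegel unit `ϑ_c(aτ + b, τ)`, where
`ϑ_c(u, τ) = (-1)^{(c-1)/2} Θ(u,τ)^{c²} Θ(cu,τ)⁻¹`. -/
def katoSiegelUnit (c : ℕ) (v : V) (τ : ℍ) : ℂ :=
  (-1) ^ ((c - 1) / 2) * Theta (v 0 * τ + v 1) τ ^ (c ^ 2) / Theta (c * (v 0 * τ + v 1)) τ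

/-- The characteristic function of the coset `v + ∏_{p ∉ S} ℤ_p²`. -/
def cosetChar (S : Set Nat.Primes) (v : V) : VA S → ℤ :=
  pureTensor S fun p => localChar ((p : Nat.Primes) : ℕ) fun i => (v i : ℚ_[((p : Nat.Primes) : ℕ)])

lemma cosetChar_mem (S : Set Nat.Primes) (v : V) : cosetChar S v ∈ TestA S := by
  classical
  refine AddSubgroup.subset_closure ⟨_, fun p => localChar_mem _ _, ?_, rfl⟩
  filter_upwards [eventually_integral S (v 0), eventually_integral S (v 1)] with p h0 h1
  have h : ∀ i, ‖(v i : ℚ_[((p : Nat.Primes) : ℕ)])‖ ≤ 1 := by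
    intro i
    fin_cases i
    · exact h0
    · exact h1
  have hset : localCoset ((p : Nat.Primes) : ℕ) (fun i => (v i : ℚ_[((p : Nat.Primes) : ℕ)])) =
      localCoset ((p : Nat.Primes) : ℕ) 0 := by
    ext w
    refine forall_congr' fun i => ?_
    simp only [Pi.zero_apply, sub_zero]
    constructor
    · intro hw
      have := (Padic.nonarchimedean (w i - (v i : ℚ_[((p : Nat.Primes) : ℕ)])) (v i)).trans (max_le hw (h i))
      simpa using this
    · intro hw
      have := (Padic.nonarchimedean (w i) (-(v i : ℚ_[_]))).trans
        (max_le hw (by rw [norm_neg]; exact h i))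
      simpa [sub_eq_add_neg] using this
  simp only [localChar, hset]

lemma cosetChar_zero (S : Set Nat.Primes) (v : V) (hS : ∀ i, v i ∈ ZS S)
    (hv : ¬ ∃ w : Fin 2 → ℤ, v = fun i => (w i : ℚ)) : cosetChar S v (diag S 0) = 0 := by
  classical
  obtain ⟨i, hi⟩ : ∃ i, (v i).den ≠ 1 := by
    by_contra! h
    exact hv ⟨fun i => (v i).num, funext fun i => ((Rat.den_eq_one_iff _).mp (h i)).symm⟩
  obtain ⟨p, hpd⟩ : ∃ p : Nat.Primes, (p : ℕ) ∣ (v i).den := by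
    obtain ⟨p, hp, hpd⟩ := Nat.exists_prime_and_dvd hi
    exact ⟨⟨p, hp⟩, hpd⟩
  have hnorm : ¬ ‖(v i : ℚ_[(p : ℕ)])‖ ≤ 1 := by
    intro h
    rw [Padic.norm_rat_le_one_iff_padicValuation_le_one, Rat.padicValuation_le_one_iff] at h
    exact h hpd
  have hpS : p ∉ S := fun h => hnorm (hS i p h)
  obtain ⟨P, hPv⟩ : ∃ P : Off S, ¬ ‖(v i : ℚ_[((P : Nat.Primes) : ℕ)])‖ ≤ 1 :=
    ⟨⟨p, hpS⟩, hnorm⟩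
  have hz : localChar ((P : Nat.Primes) : ℕ)
      (fun i => (v i : ℚ_[((P : Nat.Primes) : ℕ)])) (diag S 0 P) = 0 := by
    refine Set.indicator_of_notMem (fun h => hPv ?_) _
    have h' : ‖((0 : ℚ) : ℚ_[((P : Nat.Primes) : ℕ)]) - (v i : ℚ_[((P : Nat.Primes) : ℕ)])‖ ≤ 1 :=
      h i
    simpa using h'
  have hne : ∀ᶠ q : Off S in cofinite, localChar ((q : Nat.Primes) : ℕ)
      (fun i => (v i : ℚ_[((q : Nat.Primes) : ℕ)])) (diag S 0 q) = 1 := by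
    filter_upwards [eventually_integral S (v 0), eventually_integral S (v 1)] with q h0 h1
    refine Set.indicator_of_mem (fun j => ?_) _
    change ‖((0 : ℚ) : ℚ_[((q : Nat.Primes) : ℕ)]) - (v j : ℚ_[((q : Nat.Primes) : ℕ)])‖ ≤ 1
    fin_cases j
    · simpa using h0
    · simpa using h1
  have hfin : (Function.mulSupport fun q : Off S => localChar ((q : Nat.Primes) : ℕ)
      (fun i => (v i : ℚ_[((q : Nat.Primes) : ℕ)])) (diag S 0 q)).Finite :=
    Filter.eventually_cofinite.mp hne
  change (finprod fun q : Off S => localChar ((q : Nat.Primes) : ℕ)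
      (fun i => (v i : ℚ_[((q : Nat.Primes) : ℕ)])) (diag S 0 q)) = 0
  exact finprod_eq_zero _ P hz hfin

/-- The test function `[v + ℤ²]` for `v ∈ ℤ_S²`, `v ∉ ℤ²`. -/
def cosetTest (S : Set Nat.Primes) (v : V) (hS : ∀ i, v i ∈ ZS S)
    (hv : ¬ ∃ w : Fin 2 → ℤ, v = fun i => (w i : ℚ)) : Test' S :=
  ⟨cosetChar S v, cosetChar_mem S v, cosetChar_zero S v hS hv⟩

/-- `μ` is the Kato–Siegel distribution `μ_KS`: the `G_S`-invariant distribution with values in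
`𝒪_ℋ^×` whose value at `[(a,b) + ℤ²]` is the Kato–Siegel unit `ϑ_c(aτ + b, τ)`. -/
def IsKatoSiegel (c : ℕ) (μ : Dist (primesOf c) (Additive OHˣ)) : Prop :=
  μ ∈ invariants (repU (primesOf c)) ∧
    ∀ v hS hv (τ : ℍ), ((μ (cosetTest (primesOf c) v hS hv)).toMul : OH).1 τ =
      katoSiegelUnit c v τ

end DedekindRademacher

end

open DedekindRademacher

noncomputable section

namespace DedekindRademacher

/-! ### Strong approximation -/

/-! Up to the factor 1/(2πi), Ẽ is a logarithm of the Kato–Siegel units, and the theorem comes from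
choosing this logarithm well. For a nontrivial coset (a,b) + ℤ² let `cosetLog` be πiτ𝔹_2(a) plus the
sum of the principal logarithms of the factors of the Siegel product. Every factor is 1 - x with |x|
≤ 1 and x ≠ 1, where the principal logarithm is continuous. Hence a multiplicative identity over a
connected parameter set lifts to logarithms, with an ambiguity that is constant and can be read off
at one point (`eq_of_exp_eq_const`).

Three properties of `cosetLog` carry the proof. The distribution relations hold exactly, with no
multiple of 2πi left over (`sum_cosetLog`); they make it a distribution with values in 𝒪_ℋ which is
invariant under positive diagonal matrices. Under T only the linear term changes (`cosetLog_T`).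
Under S the theta function is determined up to a factor by its quasi-periods
(`IsThetaLike.proportional`), which gives the inversion formula up to a constant independent of
(a,b); the distribution relation for N = 2 forces the value of that constant
(`logSiegel_inversion`), so that no transformation law of the eta function is needed.

Smoothing by c and adding π_c gives `distE`. Splitting `cosetLog` into its linear term, the constant
Clog term and a part decaying at i∞ identifies `distE` with Ẽ (`distE_eq_Etilde`), because the
integral of dlog from i∞ recovers exactly the decaying logarithm. The formulas for T and S then give
γ * Ẽ - Ẽ as the explicit rational distributions `distT` and `distS`. These are integral: `distS`
factors into smoothed values of B_1, integral for odd c, and `distT` needs in addition 12 ∣ c² - 1.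
Since S, T and the positive diagonal matrices generate G_S (`eq_top_of_generators`), and the γ that
move Ẽ by a ℤ-valued distribution form a subgroup, the coboundary of Ẽ is ℤ-valued.

Therefore e^{2πiẼ} is invariant. Its values on cosets are the Kato–Siegel units, the term π_c
accounting for the roots of unity (`exp_distE_cosetTest`); this is existence. Ẽ lifts μ_KS, and
another lift differs from it by a ℤ-valued cochain, so d⁰Ẽ represents the image under the connecting
map. Uniqueness of μ_KS holds because scaled cosets generate the test functions (`closure_gens`) and
the scaling is the action of scalar matrices in G_S. Uniqueness of the cocycle holds because a
1-cocycle is determined by its values on generators. -/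

/-- The completion `ℚ_p` at a prime `p ∉ S`. -/
abbrev Qp {S : Set Nat.Primes} (p : Off S) : Type := ℚ_[((p : Nat.Primes) : ℕ)]

lemma exists_int_of_norm_le_one (x : ℚ) (h : ∀ p : Nat.Primes, ‖(x : ℚ_[(p : ℕ)])‖ ≤ 1) :
    ∃ m : ℤ, x = m := by
  refine ⟨x.num, ((Rat.den_eq_one_iff _).mp ?_).symm⟩
  by_contra hx
  obtain ⟨p, hpd⟩ : ∃ p : Nat.Primes, (p : ℕ) ∣ x.den := by
    obtain ⟨p, hp, hpd⟩ := Nat.exists_prime_and_dvd hx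
    exact ⟨⟨p, hp⟩, hpd⟩
  have := h p
  rw [Padic.norm_rat_le_one_iff_padicValuation_le_one, Rat.padicValuation_le_one_iff] at this
  exact this hpd

lemma norm_natCast_eq_one_of_coprime {c n : ℕ} (hn : n.Coprime c) {p : Nat.Primes}
    (hp : p ∈ primesOf c) : ‖(n : ℚ_[(p : ℕ)])‖ = 1 :=
  Padic.norm_natCast_eq_one_iff.mpr (Nat.Coprime.coprime_dvd_left hp hn.symm)

lemma norm_natCast_le_one (p : Nat.Primes) (n : ℕ) : ‖(n : ℚ_[(p : ℕ)])‖ ≤ 1 := by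
  exact_mod_cast Padic.norm_int_le_one (p := (p : ℕ)) (n : ℤ)

lemma norm_add_le_one {p : Nat.Primes} {x y : ℚ_[(p : ℕ)]} {r : ℝ} (hx : ‖x‖ ≤ r) (hy : ‖y‖ ≤ r) :
    ‖x + y‖ ≤ r := (Padic.nonarchimedean _ _).trans (max_le hx hy)

lemma norm_sub_le_one {p : Nat.Primes} {x y : ℚ_[(p : ℕ)]} {r : ℝ} (hx : ‖x‖ ≤ r) (hy : ‖y‖ ≤ r) :
    ‖x - y‖ ≤ r := by
  rw [sub_eq_add_neg]
  exact norm_add_le_one hx (by rwa [norm_neg])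

lemma off_of_dvd {c n : ℕ} (hn : n.Coprime c) {p : Nat.Primes} (hp : (p : ℕ) ∣ n) :
    p ∉ primesOf c := fun h =>
  p.2.one_lt.ne' (Nat.dvd_one.mp (by rw [← hn.gcd_eq_one]; exact Nat.dvd_gcd hp h))

/-- Divisibility is a local condition, and at the primes dividing c it is automatic because n is a
unit there. -/
lemma intCast_dvd_of_norm_le {c n : ℕ} (hn0 : 0 < n) (hn : n.Coprime c) (m : ℤ)
    (h : ∀ p : Off (primesOf c), ‖(m : Qp p)‖ ≤ ‖(n : Qp p)‖) : (n : ℤ) ∣ m := by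
  have hn0' : (n : ℚ) ≠ 0 := by exact_mod_cast hn0.ne'
  obtain ⟨k, hk⟩ := exists_int_of_norm_le_one ((m : ℚ) / n) (by
    intro p
    rw [Rat.cast_div, norm_div]
    have hne : ‖((n : ℚ) : ℚ_[(p : ℕ)])‖ ≠ 0 := by
      rw [norm_ne_zero_iff]; exact_mod_cast hn0.ne'
    rw [div_le_one (lt_of_le_of_ne (norm_nonneg _) hne.symm)]
    by_cases hp : p ∈ primesOf c
    · rw [Rat.cast_natCast, norm_natCast_eq_one_of_coprime hn hp, Rat.cast_intCast]
      exact Padic.norm_int_le_one _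
    · simpa using h ⟨p, hp⟩)
  refine ⟨k, ?_⟩
  rw [div_eq_iff hn0'] at hk
  rw [mul_comm]
  exact_mod_cast hk

/-- The Chinese remainder theorem in adelic form. The induction adjoins one prime factor of n at a
time and corrects one further digit at that prime. -/
lemma exists_nat_approx {c : ℕ} (n : ℕ) (hn0 : 0 < n) (hn : n.Coprime c)
    (x : ∀ p : Off (primesOf c), Qp p) (hx : ∀ p, ‖x p‖ ≤ 1) :
    ∃ t < n, ∀ p, ‖x p - t‖ ≤ ‖(n : Qp p)‖ := by
  induction n using induction_on_primes with
  | zero => omega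
  | one => exact ⟨0, one_pos, fun p => by simpa using hx p⟩
  | prime_mul q a hq ih =>
    have ha0 : 0 < a := Nat.pos_of_ne_zero (by rintro rfl; simp at hn0)
    obtain ⟨t, ht, hta⟩ := ih ha0 (Nat.Coprime.coprime_mul_left hn)
    obtain ⟨Q, hQ⟩ : ∃ Q : Off (primesOf c), ((Q : Nat.Primes) : ℕ) = q :=
      ⟨⟨⟨q, hq⟩, off_of_dvd hn (dvd_mul_right q a)⟩, rfl⟩
    subst hQ
    have hane : ∀ p : Off (primesOf c), (a : Qp p) ≠ 0 := fun p => by exact_mod_cast ha0.ne'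
    have hy : ∀ p : Off (primesOf c), ‖(x p - t) / (a : Qp p)‖ ≤ 1 := fun p => by
      rw [norm_div]
      exact div_le_one_of_le₀ (hta p) (norm_nonneg _)
    -- The next digit at Q. At every other prime Q is a unit, so the choice of s is harmless there.
    obtain ⟨s, hs, hsm⟩ := PadicInt.exists_mem_range (p := ((Q : Nat.Primes) : ℕ))
      ⟨(x Q - t) / (a : Qp Q), hy Q⟩
    refine ⟨t + a * s, ?_, fun p => ?_⟩
    · have hs' := Nat.succ_le_of_lt hs
      calc t + a * s < a + a * s := by omega
        _ = a * (s + 1) := by ring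
        _ ≤ a * _ := Nat.mul_le_mul_left _ hs'
        _ = _ * a := mul_comm _ _
    · have heq : x p - ((t + a * s : ℕ) : Qp p) = ((x p - t) / (a : Qp p) - s) * a := by
        have := hane p
        push_cast
        field_simp
        ring
      rw [heq, norm_mul, Nat.cast_mul, norm_mul]
      refine mul_le_mul_of_nonneg_right ?_ (norm_nonneg _)
      by_cases hpq : p = Q
      · subst hpq
        rw [PadicInt.maximalIdeal_eq_span_p, Ideal.mem_span_singleton] at hsm
        obtain ⟨w, hw⟩ := hsm
        have h2 := congrArg (fun z : ℤ_[((p : Nat.Primes) : ℕ)] => (z : Qp p)) hw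
        simp only [PadicInt.coe_natCast, PadicInt.coe_mul] at h2
        have h3 : (x p - t) / (a : Qp p) - s = (((p : Nat.Primes) : ℕ) : Qp p) * (w : Qp p) := h2
        rw [h3, norm_mul]
        exact mul_le_of_le_one_right (norm_nonneg _) w.2
      · have : ‖(((Q : Nat.Primes) : ℕ) : Qp p)‖ = 1 := by
          refine Padic.norm_natCast_eq_one_iff.mpr ((Nat.coprime_primes (p : Nat.Primes).2 hq).mpr ?_)
          intro h
          exact hpq (Subtype.ext (Subtype.ext h))
        rw [this]
        exact norm_sub_le_one (hy p) (norm_natCast_le_one _ _)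

lemma eq_of_nat_approx {c n : ℕ} (hn0 : 0 < n) (hn : n.Coprime c)
    (x : ∀ p : Off (primesOf c), Qp p) {s t : ℕ} (hs : s < n) (ht : t < n)
    (hxs : ∀ p, ‖x p - s‖ ≤ ‖(n : Qp p)‖) (hxt : ∀ p, ‖x p - t‖ ≤ ‖(n : Qp p)‖) : s = t := by
  have h := intCast_dvd_of_norm_le hn0 hn ((s : ℤ) - t) (fun p => by
    have := norm_sub_le_one (hxt p) (hxs p)
    rw [sub_sub_sub_cancel_left] at this
    simpa using this)
  have := Int.eq_zero_of_abs_lt_dvd h (by rw [abs_lt]; constructor <;> omega)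
  omega

/-! ### Levels of test functions -/

lemma cosetChar_apply (S : Set Nat.Primes) (v : V) (w : VA S) [Decidable (∀ (p : Off S) (i), ‖w p i - (v i : Qp p)‖ ≤ 1)] :
    cosetChar S v w = if ∀ (p : Off S) (i), ‖w p i - (v i : Qp p)‖ ≤ 1 then 1 else 0 := by
  classical
  change (finprod fun q : Off S => localChar ((q : Nat.Primes) : ℕ)
      (fun i => (v i : Qp q)) (w q)) = _
  split_ifs with h
  · exact finprod_eq_one_of_forall_eq_one fun q => Set.indicator_of_mem
      (show w q ∈ localCoset _ _ from fun i => h q i) _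
  · push Not at h
    obtain ⟨P, i, hi⟩ := h
    refine finprod_eq_zero _ P (Set.indicator_of_notMem (fun h' => ?_) _) ?_
    · exact absurd (h' i) (not_le.mpr hi)
    -- One vanishing factor makes the product vanish only if the multiplicative support is finite,
    -- since `finprod` is 1 otherwise.
    · have hne : ∀ᶠ q : Off S in cofinite, localChar ((q : Nat.Primes) : ℕ)
          (fun i => (v i : Qp q)) (w q) = 1 := by
        filter_upwards [eventually_integral S (v 0), eventually_integral S (v 1), w.2] with q h0 h1 hw
        refine Set.indicator_of_mem (fun j => ?_) _
        have hwj : ‖w q j‖ ≤ 1 := by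
          have h3 := hw j
          rw [Pi.zero_apply, sub_zero] at h3
          exact h3
        refine norm_sub_le_one (p := (q : Nat.Primes)) hwj ?_
        fin_cases j
        · exact h0
        · exact h1
      exact Filter.eventually_cofinite.mp hne

/-- `F` is invariant under `n ℤ̂²` and supported on `n⁻¹ ℤ̂²`. -/
def HasLevel {S : Set Nat.Primes} (n : ℕ) (F : VA S → ℤ) : Prop :=
  (∀ v w : VA S, (∀ p i, ‖w p i - v p i‖ ≤ ‖(n : Qp p)‖) → F w = F v) ∧
    ∀ v : VA S, F v ≠ 0 → ∀ p i, ‖(n : Qp p) * v p i‖ ≤ 1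

lemma HasLevel.mul_right {S : Set Nat.Primes} {n : ℕ} {F : VA S → ℤ} (h : HasLevel n F) (m : ℕ) :
    HasLevel (n * m) F := by
  refine ⟨fun v w hvw => h.1 v w fun p i => (hvw p i).trans ?_, fun v hv p i => ?_⟩
  · rw [Nat.cast_mul, norm_mul]
    exact mul_le_of_le_one_right (norm_nonneg _) (norm_natCast_le_one _ _)
  · rw [Nat.cast_mul, mul_comm (n : Qp p), mul_assoc, norm_mul]
    exact mul_le_one₀ (norm_natCast_le_one _ _) (norm_nonneg _) (h.2 v hv p i)

lemma HasLevel.add {S : Set Nat.Primes} {n : ℕ} {F G : VA S → ℤ} (hF : HasLevel n F)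
    (hG : HasLevel n G) : HasLevel n (F + G) := by
  refine ⟨fun v w hvw => by rw [Pi.add_apply, Pi.add_apply, hF.1 v w hvw, hG.1 v w hvw],
    fun v hv => ?_⟩
  by_cases h : F v = 0
  · exact hG.2 v fun h' => hv (by rw [Pi.add_apply, h, h', add_zero])
  · exact hF.2 v h

lemma HasLevel.neg {S : Set Nat.Primes} {n : ℕ} {F : VA S → ℤ} (hF : HasLevel n F) :
    HasLevel n (-F) :=
  ⟨fun v w hvw => by rw [Pi.neg_apply, Pi.neg_apply, hF.1 v w hvw],
    fun v hv => hF.2 v fun h => hv (by rw [Pi.neg_apply, h, neg_zero])⟩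

/-- A continuous function of compact support is uniformly continuous, and for integer values a
variation below 1 means none. The support is bounded, so a single power of p serves both purposes.
-/
lemma exists_local_level (p : ℕ) [Fact p.Prime] {f : (Fin 2 → ℚ_[p]) → ℤ} (hf : f ∈ localTest p) :
    ∃ k : ℕ, (∀ v w, (∀ i, ‖w i - v i‖ ≤ ‖((p ^ k : ℕ) : ℚ_[p])‖) → f w = f v) ∧
      ∀ v, f v ≠ 0 → ∀ i, ‖((p ^ k : ℕ) : ℚ_[p]) * v i‖ ≤ 1 := by
  have hp : (1 : ℝ) < p := by exact_mod_cast (Fact.out : p.Prime).one_lt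
  have hpn : ∀ k : ℕ, ‖((p ^ k : ℕ) : ℚ_[p])‖ = ((p : ℝ) ^ k)⁻¹ := fun k => by
    rw [Nat.cast_pow, norm_pow, Padic.norm_p, inv_pow]
  have huc := HasCompactSupport.uniformContinuous_of_continuous hf.2 hf.1.continuous
  obtain ⟨δ, hδ, hδf⟩ := Metric.uniformContinuous_iff.mp huc 1 one_pos
  obtain ⟨k1, hk1⟩ := pow_unbounded_of_one_lt δ⁻¹ hp
  obtain ⟨R, hR⟩ := hf.2.isCompact.isBounded.exists_norm_le
  obtain ⟨k2, hk2⟩ := pow_unbounded_of_one_lt R hp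
  refine ⟨max k1 k2, fun v w hvw => ?_, fun v hv i => ?_⟩
  · have hd : dist w v < δ := by
      refine lt_of_le_of_lt ((dist_pi_le_iff (norm_nonneg _)).mpr
        fun i => by rw [dist_eq_norm]; exact hvw i) ?_
      rw [hpn]
      refine lt_of_le_of_lt (inv_anti₀ (by positivity)
        (pow_le_pow_right₀ hp.le (le_max_left k1 k2))) ?_
      exact inv_lt_of_inv_lt₀ hδ hk1
    have := hδf hd
    rw [Int.dist_eq] at this
    have h2 : |f w - f v| < 1 := by exact_mod_cast this
    rw [Int.abs_lt_one_iff] at h2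
    omega
  · have h1 : ‖v i‖ ≤ R := (norm_le_pi_norm v i).trans (hR v (subset_tsupport f hv))
    have h2 : (p : ℝ) ^ k2 ≤ (p : ℝ) ^ (max k1 k2) := pow_le_pow_right₀ hp.le (le_max_right _ _)
    rw [norm_mul, hpn, inv_mul_le_one₀ (by positivity)]
    linarith

/-- A simple tensor needs a nontrivial level only at the finitely many primes where its factor is
not the characteristic function of ℤ_p². Those primes do not divide c, so the product of the local
levels is prime to c. -/
lemma exists_level {c : ℕ} {F : VA (primesOf c) → ℤ} (hF : F ∈ TestA (primesOf c)) :
    ∃ n : ℕ, 0 < n ∧ n.Coprime c ∧ HasLevel n F := by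
  classical
  induction hF using AddSubgroup.closure_induction with
  | mem F hF =>
    obtain ⟨f, hf, hf0, rfl⟩ := hF
    choose k hk1 hk2 using fun p : Off (primesOf c) =>
      exists_local_level ((p : Nat.Primes) : ℕ) (hf p)
    let B : Finset (Off (primesOf c)) := (Filter.eventually_cofinite.mp hf0).toFinset
    have hB : ∀ p, p ∉ B → f p = localChar ((p : Nat.Primes) : ℕ) 0 := fun p hp => by
      by_contra h
      exact hp ((Set.Finite.mem_toFinset _).mpr h)
    let n : ℕ := ∏ p ∈ B, ((p : Nat.Primes) : ℕ) ^ k p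
    have hnorm : ∀ p ∈ B, ‖(n : Qp p)‖ ≤ ‖((((p : Nat.Primes) : ℕ) ^ k p : ℕ) : Qp p)‖ := by
      intro p hp
      obtain ⟨m, hm⟩ := Finset.dvd_prod_of_mem (fun p : Off (primesOf c) =>
        ((p : Nat.Primes) : ℕ) ^ k p) hp
      change ‖((∏ p ∈ B, ((p : Nat.Primes) : ℕ) ^ k p : ℕ) : Qp p)‖ ≤ _
      rw [hm, Nat.cast_mul, norm_mul]
      exact mul_le_of_le_one_right (norm_nonneg _) (norm_natCast_le_one _ _)
    have hlc : ∀ p ∉ B, ∀ v w : Fin 2 → Qp p, (∀ i, ‖w i - v i‖ ≤ 1) → f p v ≠ 0 → f p w = f p v := by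
      intro p hp v w hvw hv
      rw [hB p hp] at hv ⊢
      have hv' : v ∈ localCoset ((p : Nat.Primes) : ℕ) 0 := by
        by_contra h
        exact hv (Set.indicator_of_notMem h _)
      have hw' : w ∈ localCoset ((p : Nat.Primes) : ℕ) 0 := fun i => by
        have h1 : ‖v i‖ ≤ 1 := by simpa using hv' i
        have := norm_add_le_one (p := (p : Nat.Primes)) (hvw i) h1
        simpa using this
      rw [localChar, Set.indicator_of_mem hv', Set.indicator_of_mem hw']
      rfl
    refine ⟨n, Finset.prod_pos fun p _ => pow_pos (p : Nat.Primes).2.pos _,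
      Nat.Coprime.prod_left fun p _ => Nat.Coprime.pow_left _
        ((Nat.Prime.coprime_iff_not_dvd (p : Nat.Primes).2).mpr p.2), fun v w hvw => ?_,
        fun v hv p i => ?_⟩
    · refine finprod_congr fun p => ?_
      by_cases hp : p ∈ B
      · exact hk1 p _ _ fun i => (hvw p i).trans (hnorm p hp)
      · have hle : ∀ i, ‖w p i - v p i‖ ≤ 1 := fun i => (hvw p i).trans (norm_natCast_le_one _ _)
        by_cases hv0 : f p (v p) = 0
        · by_cases hw0 : f p (w p) = 0
          · rw [hv0, hw0]
          · exact (hlc p hp _ _ (fun i => by rw [norm_sub_rev]; exact hle i) hw0).symm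
        · exact hlc p hp _ _ hle hv0
    · have hfin : (Function.mulSupport fun q : Off (primesOf c) => f q (v q)).Finite := by
        refine Filter.eventually_cofinite.mp ?_
        filter_upwards [hf0, v.2] with q hq hvq
        rw [hq]
        exact Set.indicator_of_mem hvq _
      have hne : f p (v p) ≠ 0 := fun h => hv (finprod_eq_zero _ p h hfin)
      by_cases hp : p ∈ B
      · refine le_trans ?_ (hk2 p (v p) hne i)
        rw [norm_mul, norm_mul]
        exact mul_le_mul_of_nonneg_right (hnorm p hp) (norm_nonneg _)
      · rw [hB p hp] at hne
        have hv' : v p ∈ localCoset ((p : Nat.Primes) : ℕ) 0 := by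
          by_contra h
          exact hne (Set.indicator_of_notMem h _)
        rw [norm_mul]
        exact mul_le_one₀ (norm_natCast_le_one _ _) (norm_nonneg _) (by simpa using hv' i)
  | zero => exact ⟨1, one_pos, Nat.coprime_one_left c, fun _ _ _ => rfl, fun v hv => absurd rfl hv⟩
  | add F G _ _ hF hG =>
    obtain ⟨n, hn0, hn, hF⟩ := hF
    obtain ⟨m, hm0, hm, hG⟩ := hG
    refine ⟨n * m, Nat.mul_pos hn0 hm0, hn.mul_left hm, (hF.mul_right m).add ?_⟩
    rw [mul_comm]
    exact hG.mul_right n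
  | neg F _ hF =>
    obtain ⟨n, hn0, hn, hF⟩ := hF
    exact ⟨n, hn0, hn, hF.neg⟩


/-! ### The coset distributions -/

lemma toV_apply_of_mem {S : Set Nat.Primes} (f : Test' S) {v : V} (hv : ∀ i, v i ∈ ZS S) :
    toV f v = f.1 (diag S v) :=
  Set.indicator_of_mem (s := {v : V | ∀ p ∈ S, ∀ i, ‖(v i : ℚ_[(p : ℕ)])‖ ≤ 1})
    (fun p hp i => hv i p hp) _

lemma toV_apply_of_notMem {S : Set Nat.Primes} (f : Test' S) {v : V} (hv : ¬ ∀ i, v i ∈ ZS S) :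
    toV f v = 0 :=
  Set.indicator_of_notMem (s := {v : V | ∀ p ∈ S, ∀ i, ‖(v i : ℚ_[(p : ℕ)])‖ ≤ 1})
    (fun h => hv fun i p hp => h p hp i) _

lemma toV_add {S : Set Nat.Primes} (f g : Test' S) (v : V) : toV (f + g) v = toV f v + toV g v := by
  by_cases hv : ∀ i, v i ∈ ZS S
  · rw [toV_apply_of_mem _ hv, toV_apply_of_mem _ hv, toV_apply_of_mem _ hv]; rfl
  · rw [toV_apply_of_notMem _ hv, toV_apply_of_notMem _ hv, toV_apply_of_notMem _ hv]; rfl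

lemma toV_zero_right {S : Set Nat.Primes} (f : Test' S) : toV f 0 = 0 := by
  rw [toV_apply_of_mem f (v := 0) fun i => (ZS S).zero_mem]
  exact f.2.2

lemma intCast_mem_ZS (S : Set Nat.Primes) (m : ℤ) : (m : ℚ) ∈ ZS S := intCast_mem _ m

lemma inv_natCast_mem_ZS {c n : ℕ} (hn : n.Coprime c) : ((n : ℚ)⁻¹) ∈ ZS (primesOf c) := by
  intro p hp
  rw [Rat.cast_inv, norm_inv, Rat.cast_natCast, norm_natCast_eq_one_of_coprime hn hp, inv_one]

lemma div_natCast_mem_ZS {c n : ℕ} (hn : n.Coprime c) {x : ℚ} (hx : x ∈ ZS (primesOf c)) :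
    x / n ∈ ZS (primesOf c) := by
  rw [div_eq_mul_inv]
  exact (ZS _).mul_mem hx (inv_natCast_mem_ZS hn)

/-- `F` is invariant under `nℤ²`. -/
def IsPeriod (F : V → ℤ) (n : ℕ) : Prop :=
  ∀ (v : V) (w : Fin 2 → ℤ), F (v + fun i => (n : ℚ) * w i) = F v

lemma HasLevel.isPeriod {c n : ℕ} {f : Test' (primesOf c)}
    (h : HasLevel n f.1) : IsPeriod (toV f) n := by
  intro v w
  have hmem : ∀ i, (v + fun i => (n : ℚ) * w i) i ∈ ZS (primesOf c) ↔ v i ∈ ZS (primesOf c) := by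
    intro i
    have hw : (n : ℚ) * w i ∈ ZS (primesOf c) :=
      (ZS _).mul_mem (natCast_mem _ n) (intCast_mem_ZS _ _)
    exact ⟨fun h => by simpa using (ZS _).sub_mem h hw, fun h => (ZS _).add_mem h hw⟩
  by_cases hv : ∀ i, v i ∈ ZS (primesOf c)
  · rw [toV_apply_of_mem _ hv, toV_apply_of_mem _ fun i => (hmem i).mpr (hv i)]
    refine h.1 _ _ fun p i => ?_
    change ‖(((v i + (n : ℚ) * w i : ℚ)) : Qp p) - (v i : Qp p)‖ ≤ _
    push_cast
    rw [add_sub_cancel_left, norm_mul]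
    exact mul_le_of_le_one_right (norm_nonneg _) (Padic.norm_int_le_one _)
  · rw [toV_apply_of_notMem _ hv, toV_apply_of_notMem _ fun h => hv fun i => (hmem i).mp (h i)]

lemma HasLevel.exists_int {c n : ℕ} {f : Test' (primesOf c)} (h : HasLevel n f.1) {v : V} (hv : toV f v ≠ 0) : ∃ m : Fin 2 → ℤ, ∀ i, (n : ℚ) * v i = m i := by
  have hmem : ∀ i, v i ∈ ZS (primesOf c) := by
    by_contra h'
    exact hv (toV_apply_of_notMem _ h')
  rw [toV_apply_of_mem _ hmem] at hv
  have := h.2 _ hv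
  refine Classical.axiomOfChoice fun i => exists_int_of_norm_le_one _ fun p => ?_
  by_cases hp : p ∈ primesOf c
  · exact (ZS _).mul_mem (natCast_mem _ n) (hmem i) p hp
  · have h2 := this ⟨p, hp⟩ i
    rw [Rat.cast_mul, Rat.cast_natCast]
    exact h2

lemma IsPeriod.period_pos {F : V → ℤ} {n : ℕ} (hn : 0 < n) (h : IsPeriod F n) :
    0 < period F ∧ IsPeriod F (period F) :=
  Nat.sInf_mem (s := {n : ℕ | 0 < n ∧ ∀ (v : V) (w : Fin 2 → ℤ),
    F (v + fun i => (n : ℚ) * w i) = F v}) ⟨n, hn, h⟩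

lemma IsPeriod.period_dvd {F : V → ℤ} {n : ℕ} (hn : 0 < n) (h : IsPeriod F n) : period F ∣ n := by
  obtain ⟨hp0, hp⟩ := h.period_pos hn
  by_contra hnd
  have hr : 0 < n % period F := Nat.pos_of_ne_zero fun h0 => hnd (Nat.dvd_of_mod_eq_zero h0)
  have hle : period F ≤ n % period F := by
    refine Nat.sInf_le ⟨hr, fun v w => ?_⟩
    obtain ⟨q, hq⟩ : ∃ q, q = n / period F := ⟨_, rfl⟩
    -- A translation by the remainder followed by a multiple of the least period is a translation by
    -- n, so the remainder is a smaller period.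
    rw [← hp _ fun i => q * w i, ← h v w]
    congr 1
    rw [add_assoc]
    congr 1
    ext i
    have h3 : ((n : ℕ) : ℚ) = ((period F * q + n % period F : ℕ) : ℚ) := by
      rw [hq, Nat.div_add_mod]
    rw [Pi.add_apply, h3]
    push_cast
    ring
  exact absurd (Nat.mod_lt n hp0) (not_lt.mpr hle)

/-- The representative in `[0,1)²` of the class of `v` in `V/ℤ²`. -/
def boxFract (v : V) : Box := ⟨fun k => Int.fract (v k), fun _ => ⟨Int.fract_nonneg _, Int.fract_lt_one _⟩⟩

lemma natCast_div_fract {D i : ℕ} (hi : i < D) : Int.fract ((i : ℚ) / D) = (i : ℚ) / D := by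
  have hD : (0 : ℚ) < D := by exact_mod_cast (Nat.zero_le i).trans_lt hi
  rw [Int.fract_eq_self]
  exact ⟨by positivity, by rw [div_lt_one hD]; exact_mod_cast hi⟩

/-- The pairs of natural numbers `< D`. -/
abbrev grid (D : ℕ) : Finset (Fin 2 → ℕ) := Fintype.piFinset fun _ => Finset.range D

lemma mem_grid {D : ℕ} {i : Fin 2 → ℕ} : i ∈ grid D ↔ ∀ k, i k < D := by
  simp [grid]

lemma finite_support_box {A : Type} [Zero A] (g : V → A) {D : ℕ} (hD : 0 < D)
    (hg : ∀ v : Box, g v.1 ≠ 0 → ∃ m : Fin 2 → ℤ, ∀ k, (D : ℚ) * v.1 k = m k) :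
    (Function.support fun v : Box => g v.1) ⊆
      ((grid D).image fun i => boxFract fun k => (i k : ℚ) / D : Finset Box) := by
  intro v hv
  obtain ⟨m, hm⟩ := hg v hv
  have hDq : (0 : ℚ) < D := by exact_mod_cast hD
  rw [Finset.coe_image]
  have hm0 : ∀ k, 0 ≤ m k := fun k => by
    have h1 : (0 : ℚ) ≤ m k := by rw [← hm]; exact mul_nonneg hDq.le (v.2 k).1
    exact_mod_cast h1
  have hmD : ∀ k, m k < D := fun k => by
    have h1 : (m k : ℚ) < D := by
      rw [← hm]
      exact mul_lt_of_lt_one_right hDq (v.2 k).2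
    exact_mod_cast h1
  have hk : ∀ k, ((m k).toNat : ℚ) / D = v.1 k := fun k => by
    have h1 : ((m k).toNat : ℚ) = m k := by
      exact_mod_cast congrArg (Int.cast (R := ℚ)) (Int.toNat_of_nonneg (hm0 k))
    rw [h1, ← hm k]
    field_simp
  refine ⟨fun k => (m k).toNat, ?_, ?_⟩
  · exact mem_grid.mpr fun k => by have := hm0 k; have := hmD k; omega
  · refine Subtype.ext (funext fun k => ?_)
    change Int.fract (((m k).toNat : ℚ) / D) = _
    rw [hk k]
    exact Int.fract_eq_self.mpr (v.2 k)

/-- A `finsum` over the infinite type `Box` has meaning only for finite support. A common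
denominator D of the support turns it into a sum over a D × D grid. -/
lemma finsum_box {A : Type} [AddCommMonoid A] (g : V → A) {D : ℕ} (hD : 0 < D)
    (hg : ∀ v : Box, g v.1 ≠ 0 → ∃ m : Fin 2 → ℤ, ∀ k, (D : ℚ) * v.1 k = m k) :
    ∑ᶠ v : Box, g v.1 = ∑ i ∈ grid D, g fun k => (i k : ℚ) / D := by
  have hDq : (0 : ℚ) < D := by exact_mod_cast hD
  rw [finsum_eq_sum_of_support_subset _ (finite_support_box g hD hg), Finset.sum_image]
  · refine Finset.sum_congr rfl fun i hi => ?_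
    congr 1
    funext k
    exact natCast_div_fract (mem_grid.mp hi k)
  · intro i hi j hj hij
    funext k
    have h := congrFun (congrArg Subtype.val hij) k
    simp only [boxFract] at h
    rw [natCast_div_fract (mem_grid.mp hi k), natCast_div_fract (mem_grid.mp hj k),
      div_left_inj' hDq.ne'] at h
    exact_mod_cast h

/-- Euclidean division by D in each coordinate. It separates the residues, on which a test function
depends, from the quotients, over which the distribution relation sums. -/
lemma sum_grid_mul {A : Type} [AddCommMonoid A] (N : ℕ) {D : ℕ} (hD : 0 < D)
    (g : (Fin 2 → ℕ) → A) :
    ∑ j ∈ grid (D * N), g j = ∑ i ∈ grid D, ∑ s ∈ grid N, g fun k => i k + D * s k := by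
  rw [← Finset.sum_product']
  refine Finset.sum_nbij' (fun j => (fun k => j k % D, fun k => j k / D))
    (fun x k => x.1 k + D * x.2 k) ?_ ?_ ?_ ?_ ?_
  · intro j hj
    rw [mem_grid] at hj
    rw [Finset.mem_product, mem_grid, mem_grid]
    exact ⟨fun k => Nat.mod_lt _ hD, fun k => Nat.div_lt_of_lt_mul (hj k)⟩
  · rintro ⟨i, s⟩ hx
    rw [Finset.mem_product, mem_grid, mem_grid] at hx
    rw [mem_grid]
    intro k
    have h1 := hx.1 k
    have h2 : s k + 1 ≤ N := hx.2 k
    calc i k + D * s k < D + D * s k := by simpa using h1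
      _ = D * (s k + 1) := by ring
      _ ≤ D * N := Nat.mul_le_mul_left _ h2
  · intro j _
    funext k
    exact Nat.mod_add_div _ _
  · rintro ⟨i, s⟩ hx
    rw [Finset.mem_product, mem_grid, mem_grid] at hx
    refine Prod.ext (funext fun k => ?_) (funext fun k => ?_)
    · simp [Nat.add_mul_mod_self_left, Nat.mod_eq_of_lt (hx.1 k)]
    · simp [Nat.add_mul_div_left _ _ hD, Nat.div_eq_of_lt (hx.1 k)]
  · intro j _
    congr 1
    funext k
    exact (Nat.mod_add_div _ _).symm

/-- The vector `v` has integral coordinates. -/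
def IsInt (v : V) : Prop := ∃ w : Fin 2 → ℤ, v = fun i => (w i : ℚ)

/-- The distribution relation, off the trivial coset, for multiplication by integers prime to
`c`. -/
def IsDistRel (c : ℕ) {A : Type} [AddCommGroup A] (σ : V → A) : Prop :=
  ∀ N : ℕ, 0 < N → N.Coprime c → ∀ v : V, (∀ i, v i ∈ ZS (primesOf c)) → ¬ IsInt v →
    ∑ s ∈ grid N, σ (fun k => (v k + s k) / N) = σ v

lemma HasLevel.support_period {c n : ℕ} {f : Test' (primesOf c)}
    (hf : HasLevel n f.1) (v : V) (hv : toV f ((period (toV f) : ℚ) • v) ≠ 0) :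
    ∃ m : Fin 2 → ℤ, ∀ k, ((period (toV f) * n : ℕ) : ℚ) * v k = m k := by
  obtain ⟨m, hm⟩ := hf.exists_int hv
  refine ⟨m, fun k => ?_⟩
  rw [← hm k, Pi.smul_apply, smul_eq_mul]
  push_cast
  ring

/-- No distribution relation is assumed here, so the least period of f remains in the formula. This
form suffices for linearity in σ. -/
lemma cosetDist_eq_sum_period {c n : ℕ} {A : Type} [AddCommGroup A] (σ : V → A)
    {f : Test' (primesOf c)} (hn0 : 0 < n) (hf : HasLevel n f.1) :
    cosetDist σ f = ∑ i ∈ grid (period (toV f) * n), toV f (fun k => (i k : ℚ) / n) •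
      σ (fun k => (i k : ℚ) / (period (toV f) * n : ℕ)) := by
  obtain ⟨hp0, hp⟩ := hf.isPeriod.period_pos hn0
  rw [cosetDist, finsum_box (fun v => toV f ((period (toV f) : ℚ) • v) • σ v)
    (Nat.mul_pos hp0 hn0) fun v hv => hf.support_period v.1 fun h => hv (by
      simp only [h, zero_smul])]
  refine Finset.sum_congr rfl fun i _ => ?_
  congr 2
  funext k
  rw [Pi.smul_apply, smul_eq_mul]
  have : (period (toV f) : ℚ) ≠ 0 := by exact_mod_cast hp0.ne'
  push_cast
  field_simp

/-- The least period is replaced by an arbitrary level n, which it divides. Two test functions have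
a common level but in general different least periods, so additivity in f depends on this. -/
lemma cosetDist_eq_sum {c n : ℕ} {A : Type} [AddCommGroup A] {σ : V → A} (hσ : IsDistRel c σ)
    {f : Test' (primesOf c)} (hn0 : 0 < n) (hn : n.Coprime c) (hf : HasLevel n f.1) :
    cosetDist σ f = ∑ j ∈ grid (n * n), toV f (fun k => (j k : ℚ) / n) •
      σ (fun k => (j k : ℚ) / (n * n : ℕ)) := by
  obtain ⟨hp0, hp⟩ := hf.isPeriod.period_pos hn0
  obtain ⟨N, hN⟩ := hf.isPeriod.period_dvd hn0
  have hN0 : 0 < N := Nat.pos_of_ne_zero (by rintro rfl; omega)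
  have hNc : N.Coprime c := Nat.Coprime.coprime_dvd_left (Dvd.intro_left _ hN.symm) hn
  have hpc : (period (toV f)).Coprime c := Nat.Coprime.coprime_dvd_left (Dvd.intro _ hN.symm) hn
  have hnn : n * n = (period (toV f) * n) * N := by
    calc n * n = (period (toV f) * N) * n := by rw [← hN]
      _ = _ := by ring
  have hD0 : 0 < period (toV f) * n := Nat.mul_pos hp0 hn0
  have hnq : (n : ℚ) ≠ 0 := by exact_mod_cast hn0.ne'
  have hpq : (period (toV f) : ℚ) ≠ 0 := by exact_mod_cast hp0.ne'
  have hNq : (N : ℚ) ≠ 0 := by exact_mod_cast hN0.ne'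
  rw [cosetDist_eq_sum_period σ hn0 hf, hnn, sum_grid_mul N hD0]
  refine Finset.sum_congr rfl fun i hi => ?_
  have hper : ∀ s : Fin 2 → ℕ, toV f (fun k => ((i k + period (toV f) * n * s k : ℕ) : ℚ) / n) =
      toV f fun k => (i k : ℚ) / n := fun s => by
    rw [← hp (fun k => (i k : ℚ) / n) fun k => s k]
    congr 1
    funext k
    rw [Pi.add_apply]
    push_cast
    field_simp
  by_cases h0 : toV f (fun k => (i k : ℚ) / n) = 0
  · simp only [hper, h0, zero_smul, Finset.sum_const_zero]
  simp only [hper]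
  rw [← Finset.smul_sum]
  congr 1
  rw [← hσ N hN0 hNc]
  · refine Finset.sum_congr rfl fun s _ => ?_
    congr 1
    funext k
    push_cast
    field_simp
  · exact fun k => div_natCast_mem_ZS (hpc.mul_left hn) (natCast_mem _ _)
  -- The relation for σ is not available at the trivial coset. There f takes its value at 0, which
  -- is 0, so that coset has weight 0.
  · rintro ⟨w, hw⟩
    apply h0
    have : (fun k => (i k : ℚ) / n) = fun k => (0 : V) k + (period (toV f) : ℚ) * w k := by
      funext k
      rw [← congrFun hw k]
      push_cast
      simp only [Pi.zero_apply]
      field_simp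
      ring
    rw [this]
    exact (hp 0 w).trans (toV_zero_right f)

lemma cosetDist_add {c : ℕ} {A : Type} [AddCommGroup A] {σ : V → A} (hσ : IsDistRel c σ)
    (f g : Test' (primesOf c)) : cosetDist σ (f + g) = cosetDist σ f + cosetDist σ g := by
  obtain ⟨n, hn0, hn, hf⟩ := exists_level f.2.1
  obtain ⟨m, hm0, hm, hg⟩ := exists_level g.2.1
  have hnm := hn.mul_left hm
  have hnm0 := Nat.mul_pos hn0 hm0
  have hf' := hf.mul_right m
  have hg' := hg.mul_right n
  rw [mul_comm] at hg'
  rw [cosetDist_eq_sum hσ hnm0 hnm hf', cosetDist_eq_sum hσ hnm0 hnm hg',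
    cosetDist_eq_sum (f := f + g) hσ hnm0 hnm (hf'.add hg'), ← Finset.sum_add_distrib]
  refine Finset.sum_congr rfl fun j _ => ?_
  rw [toV_add, add_smul]

/-- The distribution given by `σ`. -/
def cosetHom {c : ℕ} {A : Type} [AddCommGroup A] (σ : V → A) (hσ : IsDistRel c σ) :
    Dist (primesOf c) A :=
  AddMonoidHom.mk' (cosetDist σ) (cosetDist_add hσ)

lemma map_cosetDist {c : ℕ} {A B : Type} [AddCommGroup A] [AddCommGroup B] (φ : A →+ B)
    (σ : V → A) (f : Test' (primesOf c)) : φ (cosetDist σ f) = cosetDist (fun v => φ (σ v)) f := by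
  obtain ⟨n, hn0, -, hf⟩ := exists_level f.2.1
  rw [cosetDist_eq_sum_period _ hn0 hf, cosetDist_eq_sum_period _ hn0 hf, map_sum]
  simp only [map_zsmul]

lemma cosetDist_fun_add {c : ℕ} {A : Type} [AddCommGroup A]
    (σ σ' : V → A) (f : Test' (primesOf c)) :
    cosetDist (fun v => σ v + σ' v) f = cosetDist σ f + cosetDist σ' f := by
  obtain ⟨n, hn0, -, hf⟩ := exists_level f.2.1
  rw [cosetDist_eq_sum_period _ hn0 hf, cosetDist_eq_sum_period _ hn0 hf,
    cosetDist_eq_sum_period _ hn0 hf, ← Finset.sum_add_distrib]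
  simp only [smul_add]

/-- Reduces the multiplicative distribution u to the additive distribution of its logarithms. The
finite support is shared by the sum and the product. -/
lemma cosetDistMul_exp {c : ℕ} (σ : V → ℂ) (f : Test' (primesOf c)) :
    cosetDistMul (fun v => Complex.exp (σ v)) f = Complex.exp (cosetDist σ f) := by
  obtain ⟨n, hn0, hn, hf⟩ := exists_level f.2.1
  obtain ⟨hp0, hp⟩ := hf.isPeriod.period_pos hn0
  have hsup := finite_support_box (fun v => toV f ((period (toV f) : ℚ) • v))
    (Nat.mul_pos hp0 hn0) fun v hv => hf.support_period v.1 hv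
  rw [cosetDist, cosetDistMul, finsum_eq_sum_of_support_subset _ (subset_trans ?_ hsup),
    finprod_eq_prod_of_mulSupport_subset _ (subset_trans ?_ hsup), Complex.exp_sum]
  · refine Finset.prod_congr rfl fun v _ => ?_
    rw [zsmul_eq_mul, Complex.exp_int_mul]
  · intro v hv h
    exact hv (by simp only [h, zpow_zero])
  · intro v hv h
    exact hv (by simp only [h, zero_smul])


/-! ### Generators of the group of test functions -/

lemma rightMul_apply (S : Set Nat.Primes) (g : GL (Fin 2) ℚ) (w : VA S) (p : Off S) (k : Fin 2) :
    rightMul S g w p k = w p 0 * ((g 0 k : ℚ) : Qp p) + w p 1 * ((g 1 k : ℚ) : Qp p) := by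
  change Matrix.vecMul (w p) (locMat _ g) k = _
  simp [Matrix.vecMul, dotProduct, locMat, Fin.sum_univ_two]

lemma rightMul_rightMul_inv (S : Set Nat.Primes) (g : GL (Fin 2) ℚ) (w : VA S) :
    rightMul S g (rightMul S g⁻¹ w) = w := by
  rw [← rightMul_mul, inv_mul_cancel, rightMul_one]

lemma rightMul_inv_of_diag (S : Set Nat.Primes) {g : GL (Fin 2) ℚ} (h01 : g 0 1 = 0)
    (h10 : g 1 0 = 0) (h0 : g 0 0 ≠ 0) (h1 : g 1 1 ≠ 0) (w : VA S) (p : Off S) (k : Fin 2) :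
    rightMul S g⁻¹ w p k = w p k / ((g k k : ℚ) : Qp p) := by
  have h := congrArg (fun u : VA S => u p k) (rightMul_rightMul_inv S g w)
  simp only [rightMul_apply S g] at h
  fin_cases k
  · have h0' : ((g 0 0 : ℚ) : Qp p) ≠ 0 := by exact_mod_cast h0
    simp only [Fin.zero_eta, h10, Rat.cast_zero, mul_zero, add_zero] at h ⊢
    rw [← h, mul_div_cancel_right₀ _ h0']
  · have h1' : ((g 1 1 : ℚ) : Qp p) ≠ 0 := by exact_mod_cast h1
    simp only [Fin.mk_one, h01, Rat.cast_zero, mul_zero, zero_add] at h ⊢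
    rw [← h, mul_div_cancel_right₀ _ h1']

lemma scalarD_apply (n : ℕ) [NeZero n] (i j : Fin 2) :
    (scalarD n) i j = if i = j then (n : ℚ) else 0 := by
  simp [scalarD, Matrix.natCast_apply]

lemma rightMul_scalarD_inv (S : Set Nat.Primes) (n : ℕ) [NeZero n] (w : VA S) (p : Off S)
    (k : Fin 2) : rightMul S (scalarD n)⁻¹ w p k = w p k / n := by
  have hn : (n : ℚ) ≠ 0 := by exact_mod_cast NeZero.ne n
  rw [rightMul_inv_of_diag S (by simp [scalarD_apply]) (by simp [scalarD_apply])
    (by simpa [scalarD_apply] using hn) (by simpa [scalarD_apply] using hn)]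
  simp [scalarD_apply]

lemma scalarD_mul_comm (n : ℕ) [NeZero n] (g : GL (Fin 2) ℚ) : scalarD n * g = g * scalarD n := by
  ext i j
  simp [scalarD, Nat.cast_comm]

lemma slash_scalarD_comm {S : Set Nat.Primes} (f : Test' S) (n : ℕ) [NeZero n] (g : GL (Fin 2) ℚ) :
    slash (slash f (scalarD n)) g = slash (slash f g) (scalarD n) := by
  rw [← slash_mul, ← slash_mul, scalarD_mul_comm]

open Classical in
lemma slash_cosetTest_scalarD_apply {S : Set Nat.Primes} (v : V) (hS : ∀ i, v i ∈ ZS S)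
    (hv : ¬ IsInt v) (n : ℕ) [NeZero n] (w : VA S) :
    (slash (cosetTest S v hS hv) (scalarD n)).1 w =
      if ∀ (p : Off S) (i), ‖w p i / (n : Qp p) - (v i : Qp p)‖ ≤ 1 then 1 else 0 := by
  change cosetChar S v (rightMul S (scalarD n)⁻¹ w) = _
  rw [cosetChar_apply]
  simp only [rightMul_scalarD_inv]

open Classical in
lemma toV_slash_cosetTest_scalarD {c : ℕ} (v : V) (hS : ∀ i, v i ∈ ZS (primesOf c))
    (hv : ¬ IsInt v) (n : ℕ) [NeZero n] (hn : n.Coprime c) (x : V) :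
    toV (slash (cosetTest (primesOf c) v hS hv) (scalarD n)) x =
      if IsInt (fun i => x i / n - v i) then 1 else 0 := by
  have hnq : (n : ℚ) ≠ 0 := by exact_mod_cast NeZero.ne n
  have hx : IsInt (fun i => x i / n - v i) → ∀ i, x i ∈ ZS (primesOf c) := by
    rintro ⟨w, hw⟩ i
    have h1 : x i = n * (w i + v i) := by
      have := congrFun hw i
      rw [← this]
      field_simp
      ring
    rw [h1]
    exact (ZS _).mul_mem (natCast_mem _ n) ((ZS _).add_mem (intCast_mem_ZS _ _) (hS i))
  by_cases hmem : ∀ i, x i ∈ ZS (primesOf c)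
  · rw [toV_apply_of_mem _ hmem, slash_cosetTest_scalarD_apply]
    refine if_congr ⟨fun h => ?_, ?_⟩ rfl rfl
    · obtain ⟨w, hw⟩ := Classical.axiomOfChoice fun i =>
        exists_int_of_norm_le_one (x i / n - v i) fun p => by
          by_cases hp : p ∈ primesOf c
          · exact (ZS _).sub_mem (div_natCast_mem_ZS hn (hmem i)) (hS i) p hp
          · push_cast
            exact h ⟨p, hp⟩ i
      exact ⟨w, funext hw⟩
    · rintro ⟨w, hw⟩ p i
      change ‖((x i : ℚ) : Qp p) / (n : Qp p) - (v i : Qp p)‖ ≤ 1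
      have := congrArg (Rat.cast (K := Qp p)) (congrFun hw i)
      push_cast at this
      rw [this]
      exact Padic.norm_int_le_one _
  · rw [toV_apply_of_notMem _ hmem, if_neg fun h => hmem (hx h)]

/-- With the exact least period, a distribution can be evaluated on scaled cosets straight from its
definition, without distribution relations. -/
lemma period_slash_cosetTest_scalarD {c : ℕ} (v : V) (hS : ∀ i, v i ∈ ZS (primesOf c))
    (hv : ¬ IsInt v) (n : ℕ) [NeZero n] (hn : n.Coprime c) :
    period (toV (slash (cosetTest (primesOf c) v hS hv) (scalarD n))) = n := by
  classical
  have hnq : (n : ℚ) ≠ 0 := by exact_mod_cast NeZero.ne n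
  have hn0 : 0 < n := NeZero.pos n
  have hper : IsPeriod (toV (slash (cosetTest (primesOf c) v hS hv) (scalarD n))) n := by
    intro x w
    rw [toV_slash_cosetTest_scalarD v hS hv n hn, toV_slash_cosetTest_scalarD v hS hv n hn]
    have hc : ∀ i, (x + fun i => (n : ℚ) * w i) i / n - v i = x i / n - v i + w i := fun i => by
      rw [Pi.add_apply]
      field_simp
      ring
    simp only [hc]
    refine if_congr ⟨?_, ?_⟩ rfl rfl
    · rintro ⟨m, hm⟩
      refine ⟨m - w, funext fun i => ?_⟩
      have := congrFun hm i
      rw [Pi.sub_apply, Int.cast_sub, ← this, add_sub_cancel_right]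
    · rintro ⟨m, hm⟩
      refine ⟨m + w, funext fun i => ?_⟩
      have := congrFun hm i
      rw [Pi.add_apply, Int.cast_add, ← this]
  obtain ⟨hp0, hp⟩ := hper.period_pos hn0
  refine Nat.dvd_antisymm (hper.period_dvd hn0) ?_
  -- Translating the point nv by its least period in both coordinates must stay inside nv + nℤ², so
  -- n divides that period.
  have h1 := hp (fun i => n * v i) fun _ => 1
  rw [toV_slash_cosetTest_scalarD v hS hv n hn, toV_slash_cosetTest_scalarD v hS hv n hn,
    if_pos (c := IsInt (fun i => n * v i / n - v i)) ⟨0, by funext i; simp [hnq]⟩] at h1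
  obtain ⟨m, hm⟩ : IsInt _ := by
    by_contra h
    rw [if_neg h] at h1
    exact zero_ne_one h1
  have h2 := congrFun hm 0
  simp only [Pi.add_apply, Int.cast_one, mul_one] at h2
  have h3 : (period (toV (slash (cosetTest (primesOf c) v hS hv) (scalarD n))) : ℚ) = n * m 0 := by
    rw [← h2]
    field_simp
    ring
  exact Int.natCast_dvd_natCast.mp ⟨m 0, by exact_mod_cast h3⟩

/-- `σ` is a function on `V/ℤ²`. -/
def IsCosetFun {A : Type} (σ : V → A) : Prop := ∀ (v : V) (w : Fin 2 → ℤ), σ (v + fun i => (w i : ℚ)) = σ v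

lemma IsCosetFun.fract {A : Type} {σ : V → A} (hσ : IsCosetFun σ) (v : V) :
    σ (boxFract v).1 = σ v := by
  rw [← hσ (boxFract v).1 fun i => ⌊v i⌋]
  congr 1
  funext i
  exact Int.fract_add_floor _

lemma cosetDist_gen {c : ℕ} {A : Type} [AddCommGroup A] {σ : V → A} (hσ : IsCosetFun σ)
    (v : V) (hS : ∀ i, v i ∈ ZS (primesOf c)) (hv : ¬ IsInt v) (n : ℕ) [NeZero n]
    (hn : n.Coprime c) :
    cosetDist σ (slash (cosetTest (primesOf c) v hS hv) (scalarD n)) = σ v := by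
  classical
  have hnq : (n : ℚ) ≠ 0 := by exact_mod_cast NeZero.ne n
  have hval : ∀ x : V, toV (slash (cosetTest (primesOf c) v hS hv) (scalarD n)) ((n : ℚ) • x) =
      if IsInt (fun i => x i - v i) then 1 else 0 := fun x => by
    rw [toV_slash_cosetTest_scalarD v hS hv n hn]
    have : ∀ i, ((n : ℚ) • x) i / n - v i = x i - v i := fun i => by
      rw [Pi.smul_apply, smul_eq_mul, mul_div_cancel_left₀ _ hnq]
    simp only [this]
  rw [cosetDist, period_slash_cosetTest_scalarD v hS hv n hn, finsum_eq_single _ (boxFract v)]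
  · rw [hval, if_pos, one_smul, hσ.fract]
    refine ⟨fun i => -⌊v i⌋, funext fun i => ?_⟩
    change Int.fract (v i) - v i = ((-⌊v i⌋ : ℤ) : ℚ)
    push_cast
    linarith [Int.floor_add_fract (v i)]
  · intro x hx
    rw [hval, if_neg, zero_smul]
    rintro ⟨w, hw⟩
    refine hx (Subtype.ext (funext fun i => ?_))
    have := congrFun hw i
    change x.1 i = Int.fract (v i)
    rw [← Int.fract_eq_self.mpr (x.2 i), sub_eq_iff_eq_add.mp this, Int.fract_intCast_add]

lemma slash_scalarD_one {S : Set Nat.Primes} (f : Test' S) : slash f (scalarD 1) = f := by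
  have : scalarD 1 = 1 := by
    ext i j
    simp [scalarD]
  rw [this, slash_one]

/-- The test functions `[nv + nℤ²]`. -/
def gens (c : ℕ) : Set (Test' (primesOf c)) :=
  {f | ∃ (v : V) (hS : ∀ i, v i ∈ ZS (primesOf c)) (hv : ¬ IsInt v) (n : ℕ) (_ : NeZero n),
    n.Coprime c ∧ f = slash (cosetTest (primesOf c) v hS hv) (scalarD n)}

/-- A function of level n is a combination of the cosets of nẐ² in n⁻¹Ẑ², with Ẑ taken away from c.
By strong approximation these are represented by j/n with j in an n² × n² grid, and the trivial
coset drops out because f(0) = 0. -/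
lemma closure_gens (c : ℕ) : AddSubgroup.closure (gens c) = ⊤ := by
  classical
  refine eq_top_iff.mpr fun f _ => ?_
  obtain ⟨n, hn0, hn, hf⟩ := exists_level f.2.1
  have : NeZero n := ⟨hn0.ne'⟩
  have hnq : (n : ℚ) ≠ 0 := by exact_mod_cast hn0.ne'
  have hnn0 : 0 < n * n := Nat.mul_pos hn0 hn0
  have hnn : (n * n).Coprime c := hn.mul_left hn
  -- The coset j/n + nẐ² is n times the coset of j/n², hence the denominator n².
  let vj : (Fin 2 → ℕ) → V := fun j i => (j i : ℚ) / (n * n : ℕ)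
  have hvS : ∀ j i, vj j i ∈ ZS (primesOf c) := fun j i => div_natCast_mem_ZS hnn (natCast_mem _ _)
  have hvI : ∀ j ∈ grid (n * n), IsInt (vj j) → j = 0 := by
    rintro j hj ⟨w, hw⟩
    funext k
    have h1 := congrFun hw k
    have h2 : Int.fract (vj j k) = vj j k := natCast_div_fract (mem_grid.mp hj k)
    rw [h1, Int.fract_intCast] at h2
    have h3 : vj j k = 0 := h1.trans h2.symm
    have h4 : ((n * n : ℕ) : ℚ) ≠ 0 := by exact_mod_cast hnn0.ne'
    exact_mod_cast (div_eq_zero_iff.mp h3).resolve_right h4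
  let g : (Fin 2 → ℕ) → Test' (primesOf c) := fun j =>
    if h : IsInt (vj j) then 0 else slash (cosetTest (primesOf c) (vj j) (hvS j) h) (scalarD n)
  have hg : ∀ j, g j ∈ AddSubgroup.closure (gens c) := by
    intro j
    by_cases h : IsInt (vj j)
    · simp only [g, dif_pos h]; exact zero_mem _
    · simp only [g, dif_neg h]
      exact AddSubgroup.subset_closure ⟨_, hvS j, h, n, inferInstance, hn, rfl⟩
  have hgv : ∀ j, ¬ IsInt (vj j) → ∀ w : VA (primesOf c), (g j).1 w =
      if ∀ (p : Off (primesOf c)) (i), ‖n * w p i - (j i : Qp p)‖ ≤ ‖((n * n : ℕ) : Qp p)‖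
        then 1 else 0 := by
    intro j hj w
    simp only [g, dif_neg hj]
    rw [slash_cosetTest_scalarD_apply]
    refine if_congr (forall_congr' fun p => forall_congr' fun i => ?_) rfl rfl
    have hnp : (n : Qp p) ≠ 0 := by exact_mod_cast hn0.ne'
    have h1 : w p i / (n : Qp p) - ((vj j i : ℚ) : Qp p) =
        (n * w p i - (j i : Qp p)) / ((n * n : ℕ) : Qp p) := by
      simp only [vj]
      push_cast
      field_simp
    rw [h1, norm_div, div_le_one]
    rw [norm_pos_iff]
    exact_mod_cast hnn0.ne'
  have hsum : f = ∑ j ∈ grid (n * n), f.1 (diag (primesOf c) fun k => (j k : ℚ) / n) • g j := by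
    refine Subtype.ext (funext fun w => ?_)
    rw [AddSubgroup.val_finsetSum, Finset.sum_apply]
    simp only [AddSubgroup.coe_zsmul, Pi.smul_apply, smul_eq_mul]
    have hz0 : f.1 (diag (primesOf c) fun k => (((0 : Fin 2 → ℕ) k : ℕ) : ℚ) / n) = 0 := by
      have : (fun k : Fin 2 => (((0 : Fin 2 → ℕ) k : ℕ) : ℚ) / n) = (0 : V) := by
        funext k; simp
      rw [this]
      exact f.2.2
    by_cases hw : ∀ (p : Off (primesOf c)) (i), ‖(n : Qp p) * w p i‖ ≤ 1
    · obtain ⟨t, ht⟩ := Classical.axiomOfChoice fun i : Fin 2 =>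
        exists_nat_approx (n * n) hnn0 hnn (fun p => (n : Qp p) * w p i) fun p => hw p i
      have htg : t ∈ grid (n * n) := mem_grid.mpr fun i => (ht i).1
      have hft : f.1 w = f.1 (diag (primesOf c) fun k => (t k : ℚ) / n) := by
        refine hf.1 _ _ fun p i => ?_
        change ‖w p i - (((t i : ℚ) / n : ℚ) : Qp p)‖ ≤ _
        have hnp : (n : Qp p) ≠ 0 := by exact_mod_cast hn0.ne'
        have h1 := (ht i).2 p
        have h2 : (n : Qp p) * w p i - (t i : Qp p) =
            n * (w p i - (((t i : ℚ) / n : ℚ) : Qp p)) := by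
          push_cast
          field_simp
        rw [h2, norm_mul, Nat.cast_mul, norm_mul] at h1
        exact le_of_mul_le_mul_left h1 (norm_pos_iff.mpr hnp)
      rw [Finset.sum_eq_single t]
      · by_cases hI : IsInt (vj t)
        · have := hvI t htg hI
          rw [hft, this, hz0, zero_mul]
        · rw [hgv t hI, if_pos fun p i => (ht i).2 p, mul_one, hft]
      · intro j hj hjt
        by_cases hI : IsInt (vj j)
        · rw [hvI j hj hI, hz0, zero_mul]
        · rw [hgv j hI, if_neg, mul_zero]
          intro h
          exact hjt (funext fun i => eq_of_nat_approx hnn0 hnn _ (mem_grid.mp hj i) (ht i).1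
            (fun p => h p i) (ht i).2)
      · exact fun h => absurd htg h
    · have hw0 : f.1 w = 0 := by
        by_contra h
        exact hw (hf.2 w h)
      rw [hw0, Finset.sum_eq_zero]
      intro j hj
      by_cases hI : IsInt (vj j)
      · rw [hvI j hj hI, hz0, zero_mul]
      · rw [hgv j hI, if_neg, mul_zero]
        intro h
        refine hw fun p i => ?_
        have h1 := norm_add_le_one (p := (p : Nat.Primes))
          ((h p i).trans (norm_natCast_le_one _ _)) (norm_natCast_le_one _ (j i))
        rwa [sub_add_cancel] at h1
  rw [hsum]
  exact sum_mem fun j _ => zsmul_mem (hg j) _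

lemma dist_ext {c : ℕ} {A : Type} [AddCommGroup A] {μ ν : Dist (primesOf c) A}
    (h : ∀ v hS hv n, ∀ _ : NeZero n, n.Coprime c →
      μ (slash (cosetTest (primesOf c) v hS hv) (scalarD n)) =
        ν (slash (cosetTest (primesOf c) v hS hv) (scalarD n))) : μ = ν := by
  refine AddMonoidHom.eq_of_eqOn_top (G := Test' (primesOf c)) ?_
  rw [← closure_gens c]
  refine AddMonoidHom.eqOn_closure ?_
  rintro _ ⟨v, hS, hv, n, _, hn, rfl⟩
  exact h v hS hv n _ hn

/-! ### The action on the generators -/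

/-- A matrix that is integral with integral inverse at all primes not dividing c preserves Ẑ², hence
permutes its cosets. This covers SL_2(ℤ) and the scalar c, but not scalars prime to c. -/
lemma slash_cosetTest {c : ℕ} {g : GL (Fin 2) ℚ}
    (h1 : ∀ (p : Off (primesOf c)) i j, ‖locMat ((p : Nat.Primes) : ℕ) g i j‖ ≤ 1)
    (h2 : ∀ (p : Off (primesOf c)) i j, ‖locMat ((p : Nat.Primes) : ℕ) g⁻¹ i j‖ ≤ 1)
    {v v' : V} (hvv : v' = Matrix.vecMul v (g : Matrix (Fin 2) (Fin 2) ℚ))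
    (hS : ∀ i, v i ∈ ZS (primesOf c)) (hv : ¬ IsInt v)
    (hS' : ∀ i, v' i ∈ ZS (primesOf c)) (hv' : ¬ IsInt v') :
    slash (cosetTest (primesOf c) v hS hv) g = cosetTest (primesOf c) v' hS' hv' := by
  classical
  refine Subtype.ext (funext fun w => ?_)
  change cosetChar (primesOf c) v (rightMul (primesOf c) g⁻¹ w) = cosetChar (primesOf c) v' w
  rw [cosetChar_apply, cosetChar_apply]
  refine if_congr (forall_congr' fun p => ?_) rfl rfl
  have key : ∀ u : Fin 2 → Qp p, (∀ i, ‖u i‖ ≤ 1) ↔ u ∈ localCoset ((p : Nat.Primes) : ℕ) 0 :=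
    fun u => by simp [localCoset]
  have hvec : Matrix.vecMul (fun i => rightMul (primesOf c) g⁻¹ w p i - (v i : Qp p))
      (locMat ((p : Nat.Primes) : ℕ) g) = fun i => w p i - (v' i : Qp p) := by
    have ha : (fun i => rightMul (primesOf c) g⁻¹ w p i - (v i : Qp p)) =
        Matrix.vecMul (w p) (locMat ((p : Nat.Primes) : ℕ) g⁻¹) - fun i => (v i : Qp p) := rfl
    rw [ha, Matrix.sub_vecMul, Matrix.vecMul_vecMul, ← locMat_mul, inv_mul_cancel, locMat_one,
      Matrix.vecMul_one]
    funext i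
    rw [Pi.sub_apply, hvv]
    congr 1
  have hvec' : Matrix.vecMul (fun i => w p i - (v' i : Qp p))
      (locMat ((p : Nat.Primes) : ℕ) g⁻¹) = fun i => rightMul (primesOf c) g⁻¹ w p i - (v i : Qp p) := by
    rw [← hvec, Matrix.vecMul_vecMul, ← locMat_mul, mul_inv_cancel, locMat_one, Matrix.vecMul_one]
  rw [key fun i => rightMul (primesOf c) g⁻¹ w p i - (v i : Qp p), key fun i => w p i - (v' i : Qp p)]
  refine ⟨fun h => ?_, fun h => ?_⟩
  · rw [← hvec]; exact vecMul_mem _ _ (h1 p) _ h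
  · rw [← hvec']; exact vecMul_mem _ _ (h2 p) _ h


/-! ### Splitting a coset under a diagonal matrix -/

open Classical in
lemma sum_nat_approx {c n : ℕ} (hn0 : 0 < n) (hn : n.Coprime c)
    (x : ∀ p : Off (primesOf c), Qp p) :
    (∑ t ∈ Finset.range n, if ∀ p, ‖x p - t‖ ≤ ‖(n : Qp p)‖ then (1 : ℤ) else 0) =
      if ∀ p, ‖x p‖ ≤ 1 then 1 else 0 := by
  by_cases h : ∀ p, ‖x p‖ ≤ 1
  · obtain ⟨t, ht, hxt⟩ := exists_nat_approx n hn0 hn x h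
    rw [if_pos h, Finset.sum_eq_single t, if_pos hxt]
    · intro s hs hst
      exact if_neg fun hxs => hst (eq_of_nat_approx hn0 hn x (Finset.mem_range.mp hs) ht hxs hxt)
    · exact fun h => absurd (Finset.mem_range.mpr ht) h
  · rw [if_neg h, Finset.sum_eq_zero]
    intro t _
    refine if_neg fun hxt => h fun p => ?_
    have := norm_add_le_one (p := (p : Nat.Primes))
      ((hxt p).trans (norm_natCast_le_one _ _)) (norm_natCast_le_one _ t)
    rwa [sub_add_cancel] at this

/-- The vectors `((v₀ + s)/j, (v₁ + t)/i)`, with `v` in the place of their images. -/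
def divVec (i j : ℕ) (v : V) (s t : ℕ) : V := ![(v 0 + s) / j, (v 1 + t) / i]

lemma divVec_mem {c i j : ℕ} (hi : i.Coprime c) (hj : j.Coprime c) {v : V}
    (hS : ∀ k, v k ∈ ZS (primesOf c)) (s t : ℕ) (k : Fin 2) :
    divVec i j v s t k ∈ ZS (primesOf c) := by
  fin_cases k
  · exact div_natCast_mem_ZS hj ((ZS _).add_mem (hS 0) (natCast_mem _ _))
  · exact div_natCast_mem_ZS hi ((ZS _).add_mem (hS 1) (natCast_mem _ _))

lemma divVec_not_isInt {i j : ℕ} [NeZero i] [NeZero j] {v : V} (hv : ¬ IsInt v) (s t : ℕ) :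
    ¬ IsInt (divVec i j v s t) := by
  have hi : (i : ℚ) ≠ 0 := by exact_mod_cast NeZero.ne i
  have hj : (j : ℚ) ≠ 0 := by exact_mod_cast NeZero.ne j
  rintro ⟨w, hw⟩
  refine hv ⟨![w 0 * j - s, w 1 * i - t], funext fun k => ?_⟩
  fin_cases k
  · have h : (v 0 + s) / j = w 0 := congrFun hw 0
    rw [div_eq_iff hj] at h
    simp [← h]
  · have h : (v 1 + t) / i = w 1 := congrFun hw 1
    rw [div_eq_iff hi] at h
    simp [← h]

/-- In the first coordinate i(v₀ + Ẑ) is the disjoint union over s < j of i(v₀ + s + jẐ) = ij((v₀ +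
s)/j + Ẑ), and symmetrically in the second. Pulling out the common scalar ij brings all pieces into
the form of generators. -/
lemma slash_cosetTest_diag {c i j : ℕ} [NeZero i] [NeZero j] (hi : i.Coprime c) (hj : j.Coprime c)
    {g : GL (Fin 2) ℚ} (h01 : g 0 1 = 0) (h10 : g 1 0 = 0) (h00 : g 0 0 = i) (h11 : g 1 1 = j)
    (v : V) (hS : ∀ k, v k ∈ ZS (primesOf c)) (hv : ¬ IsInt v) :
    slash (cosetTest (primesOf c) v hS hv) g =
      ∑ s ∈ Finset.range j, ∑ t ∈ Finset.range i,
        slash (cosetTest (primesOf c) (divVec i j v s t) (divVec_mem hi hj hS s t)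
          (divVec_not_isInt hv s t)) (scalarD (i * j)) := by
  classical
  have hiq : (i : ℚ) ≠ 0 := by exact_mod_cast NeZero.ne i
  have hjq : (j : ℚ) ≠ 0 := by exact_mod_cast NeZero.ne j
  refine Subtype.ext (funext fun w => ?_)
  rw [AddSubgroup.val_finsetSum, Finset.sum_apply]
  simp only [AddSubgroup.val_finsetSum, Finset.sum_apply]
  have hterm : ∀ s t : ℕ, (slash (cosetTest (primesOf c) (divVec i j v s t)
      (divVec_mem hi hj hS s t) (divVec_not_isInt hv s t)) (scalarD (i * j))).1 w =
      (if ∀ p : Off (primesOf c), ‖w p 0 / i - (v 0 : Qp p) - s‖ ≤ ‖(j : Qp p)‖ then (1 : ℤ) else 0) *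
      if ∀ p : Off (primesOf c), ‖w p 1 / j - (v 1 : Qp p) - t‖ ≤ ‖(i : Qp p)‖ then (1 : ℤ) else 0 := by
    intro s t
    rw [slash_cosetTest_scalarD_apply, ite_mul, one_mul, zero_mul, ← ite_and]
    refine if_congr (Iff.trans (forall_congr' fun p => ?_) forall_and) rfl rfl
    have hip : (i : Qp p) ≠ 0 := by exact_mod_cast NeZero.ne i
    have hjp : (j : Qp p) ≠ 0 := by exact_mod_cast NeZero.ne j
    rw [Fin.forall_fin_two]
    have e0 : w p 0 / ((i * j : ℕ) : Qp p) - (divVec i j v s t 0 : Qp p) =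
        (w p 0 / i - (v 0 : Qp p) - s) / j := by
      simp only [divVec, Matrix.cons_val_zero]
      push_cast
      field_simp
      ring
    have e1 : w p 1 / ((i * j : ℕ) : Qp p) - (divVec i j v s t 1 : Qp p) =
        (w p 1 / j - (v 1 : Qp p) - t) / i := by
      simp only [divVec, Matrix.cons_val_one]
      push_cast
      field_simp
      ring
    rw [e0, e1, norm_div, norm_div, div_le_one (norm_pos_iff.mpr hjp),
      div_le_one (norm_pos_iff.mpr hip)]
  simp only [hterm]
  rw [← Finset.sum_mul_sum, sum_nat_approx (NeZero.pos j) hj fun p => w p 0 / i - (v 0 : Qp p),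
    sum_nat_approx (NeZero.pos i) hi fun p => w p 1 / j - (v 1 : Qp p), ite_mul, one_mul, zero_mul,
    ← ite_and]
  change cosetChar (primesOf c) v (rightMul (primesOf c) g⁻¹ w) = _
  rw [cosetChar_apply]
  refine if_congr (Iff.trans (forall_congr' fun p => ?_) forall_and) rfl rfl
  rw [Fin.forall_fin_two]
  simp only [rightMul_inv_of_diag (primesOf c) h01 h10 (h00 ▸ hiq) (h11 ▸ hjq), h00, h11,
    Rat.cast_natCast]


/-! ### The exponential `e` and logarithms -/

lemma e_add (x y : ℂ) : e (x + y) = e x * e y := by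
  rw [e, e, e, ← Complex.exp_add]; ring_nf

lemma e_zero : e 0 = 1 := by simp [e]

lemma e_neg (x : ℂ) : e (-x) = (e x)⁻¹ := by
  rw [e, e, ← Complex.exp_neg]; ring_nf

lemma e_sub (x y : ℂ) : e (x - y) = e x / e y := by
  rw [sub_eq_add_neg, e_add, e_neg, div_eq_mul_inv]

lemma e_ne_zero (x : ℂ) : e x ≠ 0 := Complex.exp_ne_zero _

lemma e_intCast (n : ℤ) : e n = 1 := by
  rw [e, mul_comm]; exact Complex.exp_int_mul_two_pi_mul_I n

lemma e_one : e 1 = 1 := by simpa using e_intCast 1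

lemma e_half : e (1 / 2) = -1 := by
  rw [e, ← Complex.exp_pi_mul_I]; ring_nf

lemma e_natCast_mul (n : ℕ) (x : ℂ) : e (n * x) = e x ^ n := by
  rw [e, e, ← Complex.exp_nat_mul]; ring_nf

lemma e_add_intCast (x : ℂ) (n : ℤ) : e (x + n) = e x := by rw [e_add, e_intCast, mul_one]

lemma e_eq_one_iff {x : ℂ} : e x = 1 ↔ ∃ n : ℤ, x = n := by
  rw [e, Complex.exp_eq_one_iff]
  refine exists_congr fun n => ?_
  rw [mul_comm (n : ℂ), mul_right_inj' Complex.two_pi_I_ne_zero]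

lemma norm_e (x : ℂ) : ‖e x‖ = Real.exp (-(2 * Real.pi * x.im)) := by
  rw [e, Complex.norm_exp]
  congr 1
  simp [Complex.mul_re, Complex.mul_im]

lemma norm_e_lt_one {x : ℂ} (hx : 0 < x.im) : ‖e x‖ < 1 := by
  rw [norm_e, Real.exp_lt_one_iff]
  have := Real.pi_pos
  nlinarith [mul_pos this hx]

lemma norm_e_ofReal (x : ℝ) : ‖e x‖ = 1 := by simp [norm_e]

lemma differentiable_e : Differentiable ℂ e := by unfold e; fun_prop

lemma continuous_e : Continuous e := differentiable_e.continuous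

/-- Two logarithms of one number differ by an element of the discrete group 2πiℤ, so a continuous
choice on a connected set is constant. This lifts each multiplicative identity below to logarithms.
-/
lemma eq_of_exp_eq_const {X : Type*} [TopologicalSpace X] {s : Set X} (hs : IsPreconnected s)
    {f : X → ℂ} (hf : ContinuousOn f s) {k : ℂ} (hk : ∀ x ∈ s, Complex.exp (f x) = k) {x y : X}
    (hx : x ∈ s) (hy : y ∈ s) : f x = f y := by
  have hT : IsDiscrete (Set.range ((↑) : ℤ → ℝ)) := by
    rw [isDiscrete_iff_discreteTopology]
    exact Int.isClosedEmbedding_coe_real.isEmbedding.toHomeomorph.symm.isEmbedding.discreteTopology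
  have hint : ∀ z ∈ s, ∃ n : ℤ, f z = f x + n * (2 * Real.pi * Complex.I) := fun z hz =>
    Complex.exp_eq_exp_iff_exists_int.mp ((hk z hz).trans (hk x hx).symm)
  have hval : ∀ z ∈ s, ∀ n : ℤ, f z = f x + n * (2 * Real.pi * Complex.I) →
      ((f z - f x) / (2 * Real.pi * Complex.I)).re = n := fun z _ n hn => by
    rw [hn, add_sub_cancel_left, mul_div_cancel_right₀ _ Complex.two_pi_I_ne_zero, Complex.intCast_re]
  have hconst := hs.constant_of_mapsTo hT
    (f := fun z => ((f z - f x) / (2 * Real.pi * Complex.I)).re)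
    (Complex.continuous_re.comp_continuousOn ((hf.sub continuousOn_const).div_const _))
    (fun z hz => by
      obtain ⟨n, hn⟩ := hint z hz
      exact ⟨n, (hval z hz n hn).symm⟩) hy hx
  obtain ⟨n, hn⟩ := hint y hy
  simp only [sub_self, zero_div, Complex.zero_re] at hconst
  rw [hval y hy n hn] at hconst
  have hn0 : n = 0 := by exact_mod_cast hconst
  rw [hn, hn0]
  simp

lemma one_sub_mem_slitPlane {x : ℂ} (hx : ‖x‖ ≤ 1) (h1 : x ≠ 1) : 1 - x ∈ Complex.slitPlane := by
  rw [Complex.mem_slitPlane_iff]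
  by_contra! h
  have h2 : x.re = 1 := by
    have h3 : x.re ≤ 1 := (Complex.re_le_norm x).trans hx
    have h4 := h.1
    simp only [Complex.sub_re, Complex.one_re] at h4
    linarith
  have h5 : x.im = 0 := by
    have := h.2
    simpa using this
  exact h1 (Complex.ext h2 h5)

lemma norm_log_one_sub_le {x : ℂ} {r : ℝ} (hr : r < 1) (hx : ‖x‖ ≤ r) :
    ‖Complex.log (1 - x)‖ ≤ (1 - r)⁻¹ * ‖x‖ := by
  have h0 := norm_nonneg x
  have h1r : 0 < 1 - r := by linarith
  have h := Complex.norm_log_one_add_le (z := -x) (by rw [norm_neg]; linarith)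
  rw [norm_neg, ← sub_eq_add_neg] at h
  refine h.trans ?_
  have h2 : (1 - ‖x‖)⁻¹ ≤ (1 - r)⁻¹ := inv_anti₀ h1r (by linarith)
  have h3 : ‖x‖ ^ 2 * (1 - ‖x‖)⁻¹ ≤ r * ‖x‖ * (1 - r)⁻¹ := by
    rw [sq]
    exact mul_le_mul (mul_le_mul_of_nonneg_right hx h0) h2 (inv_nonneg.mpr (by linarith))
      (by nlinarith)
  have h4 : ‖x‖ = (1 - r) * ((1 - r)⁻¹ * ‖x‖) := by field_simp
  have h5 : 0 ≤ (1 - r)⁻¹ * ‖x‖ := by positivity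
  nlinarith

/-! ### The infinite products `∏ (1 - qⁿw)` and their logarithms -/

/-- `∑_{n ≥ 0} log (1 - qⁿw)`. -/
def logQ (q w : ℂ) : ℂ := ∑' n : ℕ, Complex.log (1 - q ^ n * w)

/-- `∏_{n ≥ 0} (1 - qⁿw)`. -/
def prodQ (q w : ℂ) : ℂ := ∏' n : ℕ, (1 - q ^ n * w)

section

variable {q w : ℂ}

lemma summable_pow_mul (hq : ‖q‖ < 1) (w : ℂ) : Summable fun n : ℕ => -(q ^ n * w) := by
  refine Summable.neg (Summable.mul_right _ ?_)
  exact summable_geometric_of_norm_lt_one hq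

lemma summable_logQ (hq : ‖q‖ < 1) (w : ℂ) : Summable fun n : ℕ => Complex.log (1 - q ^ n * w) := by
  simpa [sub_eq_add_neg] using Complex.summable_log_one_add_of_summable (summable_pow_mul hq w)

lemma multipliable_prodQ (hq : ‖q‖ < 1) (w : ℂ) : Multipliable fun n : ℕ => 1 - q ^ n * w := by
  simpa [sub_eq_add_neg] using multipliable_one_add_of_summable (summable_pow_mul hq w).norm

lemma prodQ_eq_mul (hq : ‖q‖ < 1) (w : ℂ) : prodQ q w = (1 - w) * prodQ q (q * w) := by
  have h : ∀ n : ℕ, 1 - q ^ (n + 1) * w = 1 - q ^ n * (q * w) := fun n => by ring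
  rw [prodQ, tprod_eq_zero_mul' (by simpa only [h] using multipliable_prodQ hq (q * w))]
  simp only [h, pow_zero, one_mul, prodQ]

lemma logQ_eq_add (hq : ‖q‖ < 1) (w : ℂ) : logQ q w = Complex.log (1 - w) + logQ q (q * w) := by
  have h : ∀ n : ℕ, 1 - q ^ (n + 1) * w = 1 - q ^ n * (q * w) := fun n => by ring
  rw [logQ, (summable_logQ hq w).tsum_eq_zero_add]
  simp only [h, pow_zero, one_mul, logQ]

lemma norm_pow_mul_lt_one (hq : ‖q‖ < 1) (hw : ‖w‖ ≤ 1) (n : ℕ) : ‖q ^ (n + 1) * w‖ < 1 := by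
  rw [norm_mul, norm_pow]
  have h1 : ‖q‖ ^ (n + 1) < 1 := pow_lt_one₀ (norm_nonneg _) hq (Nat.succ_ne_zero n)
  exact lt_of_le_of_lt (mul_le_of_le_one_right (by positivity) hw) h1

lemma one_sub_pow_mul_ne_zero (hq : ‖q‖ < 1) (hw : ‖w‖ ≤ 1) (hw1 : w ≠ 1) (n : ℕ) :
    1 - q ^ n * w ≠ 0 := by
  rw [sub_ne_zero]
  rcases n with - | n
  · simpa using hw1.symm
  · intro h
    have := norm_pow_mul_lt_one hq hw n
    rw [← h, norm_one] at this
    exact lt_irrefl _ this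

lemma exp_logQ (hq : ‖q‖ < 1) (hw : ‖w‖ ≤ 1) (hw1 : w ≠ 1) :
    Complex.exp (logQ q w) = prodQ q w :=
  Complex.cexp_tsum_eq_tprod (one_sub_pow_mul_ne_zero hq hw hw1) (summable_logQ hq w)

lemma differentiable_prodQ (hq : ‖q‖ < 1) : Differentiable ℂ (prodQ q) := by
  have h : HasProdLocallyUniformlyOn (fun (n : ℕ) (w : ℂ) => 1 + -(q ^ n * w))
      (fun w => ∏' n : ℕ, (1 + -(q ^ n * w))) Set.univ := by
    refine hasProdLocallyUniformlyOn_of_forall_compact isOpen_univ fun K _ hK => ?_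
    obtain ⟨R, hR⟩ := hK.isBounded.exists_norm_le
    refine Summable.hasProdUniformlyOn_nat_one_add (u := fun n => ‖q‖ ^ n * R) hK
      ((summable_geometric_of_lt_one (norm_nonneg _) hq).mul_right R) (.of_forall fun n x hx => ?_)
      fun n => by fun_prop
    rw [norm_neg, norm_mul, norm_pow]
    exact mul_le_mul_of_nonneg_left (hR x hx) (by positivity)
  have h2 : DifferentiableOn ℂ (fun w => ∏' n : ℕ, (1 + -(q ^ n * w))) Set.univ :=
    h.differentiableOn (.of_forall fun _ => by
      simpa [Finset.prod_fn] using DifferentiableOn.finsetProd (fun _ _ => by fun_prop)) isOpen_univ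
  rw [differentiableOn_univ] at h2
  simpa only [prodQ, sub_eq_add_neg] using! h2

/-- Only the term n = 0 can approach the singularity of the logarithm when |w| = 1, so it is split
off. The arguments of the remaining terms have absolute value at most |q|, and the M-test applies.
-/
lemma continuousOn_logQ (hq : ‖q‖ < 1) : ContinuousOn (logQ q) {w | ‖w‖ ≤ 1 ∧ w ≠ 1} := by
  have h1 : ContinuousOn (fun w => Complex.log (1 - w) + ∑' n : ℕ, Complex.log (1 - q ^ n * (q * w)))
      {w | ‖w‖ ≤ 1 ∧ w ≠ 1} := by
    refine ContinuousOn.add ?_ ?_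
    · exact ContinuousOn.clog (by fun_prop) fun w hw => one_sub_mem_slitPlane hw.1 hw.2
    · have hle : ∀ (n : ℕ) (w : ℂ), ‖w‖ ≤ 1 → ‖q ^ n * (q * w)‖ ≤ ‖q‖ ^ n * ‖q‖ := fun n w hw => by
        rw [norm_mul, norm_mul, norm_pow]
        exact mul_le_mul_of_nonneg_left (mul_le_of_le_one_right (norm_nonneg _) hw) (by positivity)
      have hle1 : ∀ n : ℕ, ‖q‖ ^ n * ‖q‖ ≤ ‖q‖ := fun n =>
        mul_le_of_le_one_left (norm_nonneg _) (pow_le_one₀ (norm_nonneg _) hq.le)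
      refine continuousOn_tsum (u := fun n => (1 - ‖q‖)⁻¹ * (‖q‖ ^ n * ‖q‖)) (fun n => ?_) ?_ ?_
      · refine ContinuousOn.clog (by fun_prop) fun w hw => one_sub_mem_slitPlane ?_ ?_
        · exact ((hle n w hw.1).trans (hle1 n)).trans hq.le
        · intro h
          have := (hle n w hw.1).trans (hle1 n)
          rw [h, norm_one] at this
          linarith
      · exact ((summable_geometric_of_lt_one (norm_nonneg _) hq).mul_right _).mul_left _
      · intro n w hw
        refine (norm_log_one_sub_le hq ((hle n w hw.1).trans (hle1 n))).trans ?_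
        exact mul_le_mul_of_nonneg_left (hle n w hw.1) (inv_nonneg.mpr (by linarith))
  exact h1.congr fun w _ => logQ_eq_add hq w

lemma prod_one_sub_e_mul (N : ℕ) (hN : 0 < N) (x : ℂ) :
    ∏ t ∈ Finset.range N, (1 - e (t / N) * x) = 1 - x ^ N := by
  have hζ : IsPrimitiveRoot (e (1 / N)) N := by
    have := Complex.isPrimitiveRoot_exp N hN.ne'
    convert! this using 1
    rw [e]; ring_nf
  have h := congrArg (Polynomial.eval 1) (X_pow_sub_C_eq_prod hζ hN (rfl : x ^ N = x ^ N))
  simp only [Polynomial.eval_sub, Polynomial.eval_pow, Polynomial.eval_X, one_pow,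
    Polynomial.eval_C, Polynomial.eval_prod] at h
  rw [h]
  refine Finset.prod_congr rfl fun t _ => ?_
  rw [← e_natCast_mul, mul_one_div]

/-- Both sides have the same exponential. Along the segment r ↦ rx all logarithms stay in the slit
plane, and at r = 0 both sides vanish, so no multiple of 2πi appears. -/
lemma sum_log_one_sub_e_mul (N : ℕ) (hN : 0 < N) {x : ℂ} (hx : ‖x‖ ≤ 1) (hx1 : x ^ N ≠ 1) :
    ∑ t ∈ Finset.range N, Complex.log (1 - e (t / N) * x) = Complex.log (1 - x ^ N) := by
  have hnorm : ∀ t : ℕ, ‖e ((t : ℂ) / N)‖ = 1 := fun t => by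
    have := norm_e_ofReal ((t : ℝ) / N)
    simpa using this
  have hζN : ∀ t : ℕ, e ((t : ℂ) / N) ^ N = 1 := fun t => by
    rw [← e_natCast_mul, mul_div_cancel₀ _ (by exact_mod_cast hN.ne')]
    exact_mod_cast e_intCast t
  let D : Set ℝ := Set.Icc 0 1
  have hr : ∀ r ∈ D, ‖(r : ℂ) * x‖ ≤ 1 := fun r hr => by
    rw [norm_mul, Complex.norm_real, Real.norm_of_nonneg hr.1]
    exact mul_le_one₀ hr.2 (norm_nonneg _) hx
  have hrN : ∀ r ∈ D, ((r : ℂ) * x) ^ N ≠ 1 := by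
    intro r hrD h
    have h1 : ‖(r : ℂ) * x‖ = 1 := by
      have h2 := congrArg norm h
      rw [norm_pow, norm_one] at h2
      exact (pow_eq_one_iff_of_nonneg (norm_nonneg _) hN.ne').mp h2
    rw [norm_mul, Complex.norm_real, Real.norm_of_nonneg hrD.1] at h1
    have h3 : r = 1 := by
      refine le_antisymm hrD.2 ?_
      rw [← h1]
      exact mul_le_of_le_one_right hrD.1 hx
    rw [h3, Complex.ofReal_one, one_mul] at h
    exact hx1 h
  have hslit : ∀ r ∈ D, ∀ t : ℕ, 1 - e (t / N) * (r * x) ∈ Complex.slitPlane := by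
    intro r hrD t
    refine one_sub_mem_slitPlane ?_ ?_
    · rw [norm_mul, hnorm, one_mul]; exact hr r hrD
    · intro h
      apply hrN r hrD
      calc ((r : ℂ) * x) ^ N = (e (t / N) * (r * x)) ^ N := by rw [mul_pow (e _), hζN, one_mul]
        _ = 1 := by rw [h, one_pow]
  have hslitN : ∀ r ∈ D, 1 - ((r : ℂ) * x) ^ N ∈ Complex.slitPlane := fun r hrD =>
    one_sub_mem_slitPlane (by rw [norm_pow]; exact pow_le_one₀ (norm_nonneg _) (hr r hrD))
      (hrN r hrD)
  have key := eq_of_exp_eq_const (s := D) isPreconnected_Icc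
    (f := fun r : ℝ => ∑ t ∈ Finset.range N, Complex.log (1 - e (t / N) * (r * x)) -
      Complex.log (1 - ((r : ℂ) * x) ^ N)) (k := 1) ?_ ?_
    (Set.right_mem_Icc.mpr zero_le_one) (Set.left_mem_Icc.mpr zero_le_one)
  · simpa [sub_eq_zero, hN.ne'] using key
  · refine ContinuousOn.sub (continuousOn_finsetSum _ fun t _ => ?_) ?_
    · exact ContinuousOn.clog (by fun_prop) fun r hrD => hslit r hrD t
    · exact ContinuousOn.clog (by fun_prop) hslitN
  · intro r hrD
    rw [Complex.exp_sub, Complex.exp_sum, Complex.exp_log (Complex.slitPlane_ne_zero (hslitN r hrD)),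
      Finset.prod_congr rfl fun t _ => Complex.exp_log (Complex.slitPlane_ne_zero (hslit r hrD t)),
      prod_one_sub_e_mul N hN, div_self (Complex.slitPlane_ne_zero (hslitN r hrD))]

lemma sum_logQ_e_mul (hq : ‖q‖ < 1) {N : ℕ} (hN : 0 < N) (hw : ‖w‖ ≤ 1) (hw1 : w ^ N ≠ 1) :
    ∑ t ∈ Finset.range N, logQ q (e (t / N) * w) = logQ (q ^ N) (w ^ N) := by
  simp only [logQ]
  rw [← Summable.tsum_finsetSum fun t _ => summable_logQ hq _]
  refine tsum_congr fun n => ?_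
  have h1 : ‖q ^ n * w‖ ≤ 1 := by
    rw [norm_mul, norm_pow]
    exact mul_le_one₀ (pow_le_one₀ (norm_nonneg _) hq.le) (norm_nonneg _) hw
  have h2 : (q ^ n * w) ^ N ≠ 1 := by
    rcases n with - | n
    · simpa using hw1
    · intro h
      have h3 := norm_pow_mul_lt_one hq hw n
      have h4 := congrArg norm h
      rw [norm_pow, norm_one] at h4
      exact absurd h4 (pow_lt_one₀ (norm_nonneg _) h3 hN.ne').ne
  have := sum_log_one_sub_e_mul N hN h1 h2
  rw [mul_pow, ← pow_mul, mul_comm n N, pow_mul] at this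
  rw [← this]
  refine Finset.sum_congr rfl fun t _ => ?_
  congr 2
  ring

/-- The exponents of q are sorted by their residue modulo N. -/
lemma sum_logQ_pow_mul (hq : ‖q‖ < 1) {N : ℕ} (hN : 0 < N) (w : ℂ) :
    ∑ s ∈ Finset.range N, logQ (q ^ N) (q ^ s * w) = logQ q w := by
  have : NeZero N := ⟨hN.ne'⟩
  have hqN : ‖q ^ N‖ < 1 := by rw [norm_pow]; exact pow_lt_one₀ (norm_nonneg _) hq hN.ne'
  have hs := (Nat.divModEquiv N).symm.summable_iff.mpr (summable_logQ hq w)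
  have hterm : ∀ x : ℕ × Fin N, Complex.log (1 - q ^ ((Nat.divModEquiv N).symm x) * w) =
      Complex.log (1 - (q ^ N) ^ x.1 * (q ^ (x.2 : ℕ) * w)) := fun x => by
    congr 2
    rw [← pow_mul, ← mul_assoc, ← pow_add]
    congr 2
    simp [Nat.divModEquiv, mul_comm]
  simp only [Function.comp_def, hterm] at hs
  simp only [logQ]
  rw [← (Nat.divModEquiv N).symm.tsum_eq fun n => Complex.log (1 - q ^ n * w)]
  simp only [hterm]
  rw [hs.tsum_prod, ← Summable.tsum_finsetSum fun s _ => summable_logQ hqN _]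
  refine tsum_congr fun n => ?_
  rw [tsum_fintype, Finset.sum_range]

end

/-! ### Uniqueness of theta functions -/

/-- The Fourier coefficients of `x ↦ f (z + x)`, normalised so as not to depend on `z`. -/
def stripCoeff (f : ℂ → ℂ) (n : ℤ) (z : ℂ) : ℂ := ∫ x in (0 : ℝ)..1, f (z + x) * e (-(n * (z + x)))

lemma e_neg_intCast_mul_add_one (n : ℤ) (z : ℂ) : e (-(n * (z + 1))) = e (-(n * z)) := by
  rw [show -((n : ℂ) * (z + 1)) = -(n * z) + ((-n : ℤ) : ℂ) by push_cast; ring, e_add_intCast]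

/-- With a primitive G of the 1-periodic integrand, the coefficient is G(z+1) - G(z), whose
derivative in z vanishes. This replaces a shift of contour. -/
lemma stripCoeff_eq {f : ℂ → ℂ} (hf : Differentiable ℂ f) (h1 : ∀ z, f (z + 1) = f z) (n : ℤ)
    (z w : ℂ) : stripCoeff f n z = stripCoeff f n w := by
  let g : ℂ → ℂ := fun z => f z * e (-(n * z))
  have hg : Differentiable ℂ g :=
    hf.mul (differentiable_e.comp (by fun_prop : Differentiable ℂ fun z : ℂ => -((n : ℂ) * z)))
  have hg1 : ∀ z, g (z + 1) = g z := fun z => by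
    simp only [g]; rw [h1, e_neg_intCast_mul_add_one]
  obtain ⟨G, hG⟩ := hg.isExactOn_univ
  have hint : ∀ z, stripCoeff f n z = G (z + 1) - G z := fun z => by
    have h := intervalIntegral.integral_eq_sub_of_hasDerivAt (a := 0) (b := 1)
      (f := fun x : ℝ => G (z + x)) (f' := fun x : ℝ => g (z + x)) (fun x _ => by
        have h2 := (hG (z + x) (Set.mem_univ _)).comp_const_add z (x : ℂ)
        exact h2.comp_ofReal) (by
        apply Continuous.intervalIntegrable
        exact hg.continuous.comp (by fun_prop))
    simpa [stripCoeff, g] using h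
  have hd : ∀ z, HasDerivAt (fun z => G (z + 1) - G z) 0 z := fun z => by
    have h := ((hG (z + 1) (Set.mem_univ _)).comp_add_const z 1).sub (hG z (Set.mem_univ _))
    rwa [hg1, sub_self] at h
  rw [hint, hint]
  exact is_const_of_deriv_eq_zero (fun z => (hd z).differentiableAt) (fun z => (hd z).deriv) z w

lemma eq_zero_of_stripCoeff {f : ℂ → ℂ} (hf : Continuous f) (h1 : ∀ z, f (z + 1) = f z) (z : ℂ)
    (h : ∀ n, stripCoeff f n z = 0) : f z = 0 := by
  have hT : Fact ((0 : ℝ) < 1) := ⟨one_pos⟩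
  have hper : Function.Periodic (fun x : ℝ => f (z + x)) 1 := fun x => by
    have := h1 (z + x)
    simpa [add_assoc] using this
  let F : C(AddCircle (1 : ℝ), ℂ) :=
    ⟨hper.lift, continuous_coinduced_dom.mpr (by
      change Continuous fun x : ℝ => f (z + x)
      exact hf.comp (by fun_prop))⟩
  have hcoef : ∀ n, fourierCoeff F n = 0 := fun n => by
    rw [fourierCoeff_eq_intervalIntegral F n 0]
    have h2 : ∀ x : ℝ, fourier (-n) (x : AddCircle (1 : ℝ)) • F (x : AddCircle (1 : ℝ)) =
        e (n * z) * (f (z + x) * e (-(n * (z + x)))) := fun x => by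
      have h3 : F (x : AddCircle (1 : ℝ)) = f (z + x) := rfl
      rw [h3, fourier_coe_apply, smul_eq_mul, mul_left_comm (e _), ← e_add, mul_comm]
      congr 1
      rw [e]
      congr 1
      push_cast
      ring
    simp only [h2, zero_add]
    rw [intervalIntegral.integral_const_mul]
    have h4 := h n
    rw [stripCoeff] at h4
    rw [h4, mul_zero, smul_zero]
  have hs : Summable (fourierCoeff F) := by
    rw [show fourierCoeff F = fun _ => 0 from funext hcoef]
    exact summable_zero
  have := has_pointwise_sum_fourier_series_of_summable hs ((0 : ℝ) : AddCircle (1 : ℝ))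
  simp only [hcoef, zero_smul] at this
  have h5 : F ((0 : ℝ) : AddCircle (1 : ℝ)) = f (z + (0 : ℝ)) := rfl
  rw [h5, Complex.ofReal_zero, add_zero] at this
  exact this.unique hasSum_zero

/-- The functions with the automorphy factors of a theta function of degree one. -/
structure IsThetaLike (τ : ℂ) (f : ℂ → ℂ) : Prop where
  differentiable : Differentiable ℂ f
  add_one : ∀ z, f (z + 1) = f z
  add_tau : ∀ z, f (z + τ) = -e (-z) * f z

/-- Computing the coefficient on the line through τ instead of 0 introduces the automorphy factor,
which raises the index by one. All coefficients are thus governed by the one of index 0. -/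
lemma IsThetaLike.stripCoeff_succ {τ : ℂ} {f : ℂ → ℂ} (hf : IsThetaLike τ f) (n : ℤ) :
    stripCoeff f n 0 = -e (-(n * τ)) * stripCoeff f (n + 1) 0 := by
  rw [stripCoeff_eq hf.1 hf.2 n 0 τ, stripCoeff, stripCoeff, ← intervalIntegral.integral_const_mul]
  refine intervalIntegral.integral_congr fun x _ => ?_
  rw [add_comm τ, hf.3, zero_add, show -((n : ℂ) * (x + τ)) = -(n * τ) + -(n * x) by ring, e_add,
    show -(((n + 1 : ℤ) : ℂ) * x) = -x + -(n * x) by push_cast; ring, e_add]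
  ring

lemma IsThetaLike.eq_zero {τ : ℂ} {f : ℂ → ℂ} (hf : IsThetaLike τ f) (h0 : stripCoeff f 0 0 = 0)
    (z : ℂ) : f z = 0 := by
  refine eq_zero_of_stripCoeff hf.1.continuous hf.2 z fun n => ?_
  rw [stripCoeff_eq hf.1 hf.2 n z 0]
  induction n using Int.induction_on with
  | zero => exact h0
  | succ n ih =>
    rw [hf.stripCoeff_succ] at ih
    exact (mul_eq_zero.mp ih).resolve_left (neg_ne_zero.mpr (e_ne_zero _))
  | pred n ih =>
    rw [hf.stripCoeff_succ, sub_add_cancel, ih, mul_zero]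

/-- A suitable combination of f and g has vanishing coefficient of index 0, hence vanishes
identically. Theta functions of degree one form a space of dimension at most one. -/
lemma IsThetaLike.proportional {τ : ℂ} {f g : ℂ → ℂ} (hf : IsThetaLike τ f) (hg : IsThetaLike τ g)
    {z₀ : ℂ} (h0 : f z₀ ≠ 0) : ∃ k : ℂ, ∀ z, g z = k * f z := by
  have hc : stripCoeff f 0 0 ≠ 0 := fun h => h0 (hf.eq_zero h z₀)
  let k := stripCoeff g 0 0 / stripCoeff f 0 0
  have hh : IsThetaLike τ fun z => g z - k * f z :=
    ⟨hg.1.sub (hf.1.const_mul k), fun z => by rw [hg.2, hf.2], fun z => by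
      rw [hg.3, hf.3]; ring⟩
  refine ⟨k, fun z => sub_eq_zero.mp (hh.eq_zero ?_ z)⟩
  have hint : ∀ f : ℂ → ℂ, Differentiable ℂ f → IntervalIntegrable
      (fun x : ℝ => f (0 + x) * e (-((0 : ℤ) * (0 + x)))) MeasureTheory.volume 0 1 := fun f hf => by
    apply Continuous.intervalIntegrable
    exact (hf.continuous.comp (by fun_prop)).mul (continuous_e.comp (by fun_prop))
  have h2 : stripCoeff (fun z => g z - k * f z) 0 0 = stripCoeff g 0 0 - k * stripCoeff f 0 0 := by
    rw [stripCoeff, stripCoeff, stripCoeff, ← intervalIntegral.integral_const_mul,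
      ← intervalIntegral.integral_sub (hint g hg.1) ((hint f hf.1).const_mul k)]
    refine intervalIntegral.integral_congr fun x _ => ?_
    ring
  rw [h2, div_mul_cancel₀ _ hc, sub_self]

/-! ### The theta function -/

/-- `∏_{n ≥ 0} (1 - qⁿt) ∏_{n > 0} (1 - qⁿt⁻¹)`. -/
def theta (τ z : ℂ) : ℂ := prodQ (e τ) (e z) * prodQ (e τ) (e (τ - z))

lemma theta_isThetaLike {τ : ℂ} (hτ : 0 < τ.im) : IsThetaLike τ (theta τ) := by
  have hq := norm_e_lt_one hτ
  refine ⟨?_, fun z => ?_, fun z => ?_⟩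
  · exact ((differentiable_prodQ hq).comp differentiable_e).mul
      ((differentiable_prodQ hq).comp (differentiable_e.comp (by fun_prop)))
  · rw [theta, theta, e_add, e_one, mul_one, show τ - (z + 1) = τ - z + ((-1 : ℤ) : ℂ) by
      push_cast; ring, e_add_intCast]
  · have h1 : prodQ (e τ) (e z) = (1 - e z) * prodQ (e τ) (e (z + τ)) := by
      rw [prodQ_eq_mul hq, add_comm z, e_add]
    have h2 : prodQ (e τ) (e (τ - (z + τ))) = (1 - e (-z)) * prodQ (e τ) (e (τ - z)) := by
      rw [show τ - (z + τ) = -z by ring, prodQ_eq_mul hq, ← e_add, ← sub_eq_add_neg τ]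
    have h3 : 1 - e (-z) = -e (-z) * (1 - e z) := by
      rw [e_neg]
      have := e_ne_zero z
      field_simp
      ring
    rw [theta, theta, h1, h2, h3]
    ring

lemma theta_ne_zero {τ z : ℂ} (h0 : 0 ≤ z.im) (h1 : z.im < τ.im) (hz : e z ≠ 1) : theta τ z ≠ 0 := by
  have hq := norm_e_lt_one (h0.trans_lt h1)
  have h2 : ‖e (τ - z)‖ < 1 := norm_e_lt_one (by simpa using h1)
  have h3 : ‖e z‖ ≤ 1 := by
    rw [norm_e, Real.exp_le_one_iff]
    have := Real.pi_pos
    nlinarith [mul_nonneg this.le h0]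
  rw [theta, ← exp_logQ hq h3 hz, ← exp_logQ hq h2.le (fun h => by rw [h, norm_one] at h2; linarith)]
  exact mul_ne_zero (Complex.exp_ne_zero _) (Complex.exp_ne_zero _)

/-- The Gaussian factor is chosen so that the left side acquires the automorphy factors of `theta
τ`: the substitution z ↦ -z/τ interchanges the two periods, and the term z/2 in the exponent
accounts for signs. The factor k is independent of z and is not computed. -/
lemma theta_inversion {τ : ℂ} (hτ : 0 < τ.im) : ∃ k : ℂ, ∀ z,
    e (-(z ^ 2 / (2 * τ)) + (1 / (2 * τ) + 1 / 2) * z) * theta (-1 / τ) (-z / τ) =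
      k * theta τ z := by
  have hτ0 : τ ≠ 0 := fun h => by simp [h] at hτ
  have hτ' : 0 < (-1 / τ).im := by
    rw [neg_div, one_div, Complex.neg_im, Complex.inv_im, neg_div, neg_neg]
    exact div_pos hτ (Complex.normSq_pos.mpr hτ0)
  have h' := theta_isThetaLike hτ'
  have hne : theta τ (τ / 2) ≠ 0 := by
    refine theta_ne_zero ?_ ?_ fun h => ?_
    · simp only [Complex.div_ofNat_im]; linarith
    · simp only [Complex.div_ofNat_im]; linarith
    · have h2 := norm_e_lt_one (x := τ / 2) (by simp only [Complex.div_ofNat_im]; linarith)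
      rw [h, norm_one] at h2
      exact lt_irrefl _ h2
  refine (theta_isThetaLike hτ).proportional (g := fun z =>
    e (-(z ^ 2 / (2 * τ)) + (1 / (2 * τ) + 1 / 2) * z) * theta (-1 / τ) (-z / τ))
    ⟨?_, fun z => ?_, fun z => ?_⟩ hne
  · exact (differentiable_e.comp (by fun_prop)).mul (h'.1.comp (by fun_prop))
  · rw [show -(z + 1) / τ = -z / τ + -1 / τ by ring, h'.3, ← mul_assoc]
    congr 1
    rw [← neg_one_mul (e _), ← e_half, ← e_add, ← e_add, ← e_add_intCast _ (-1)]
    congr 1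
    push_cast
    field_simp
    ring
  · rw [show -(z + τ) / τ = -z / τ - 1 by field_simp; ring, ← h'.2, sub_add_cancel, ← mul_assoc]
    congr 1
    rw [← neg_one_mul (e (-z)), ← e_half, ← e_add, ← e_add]
    congr 1
    field_simp
    ring

/-! ### Logarithms of Siegel functions -/

/-- The logarithm of the Siegel function with parameters `a ∈ [0,1)` and `b`. -/
def logSiegel (a b : ℝ) (τ : ℂ) : ℂ :=
  Real.pi * Complex.I * τ * (a ^ 2 - a + 1 / 6) + logQ (e τ) (e (a * τ + b)) +
    logQ (e τ) (e ((1 - a) * τ - b))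

/-- The parameters `(a, b)` with `0 ≤ a < 1` and `(a, b) ∉ ℤ²`. -/
def siegelDom : Set (ℝ × ℝ) := {x | 0 ≤ x.1 ∧ x.1 < 1 ∧ (x.1 = 0 → ∀ n : ℤ, x.2 ≠ n)}

lemma siegelDom_norm_le {a b : ℝ} (h : (a, b) ∈ siegelDom) {τ : ℂ} (hτ : 0 < τ.im) :
    ‖e (a * τ + b)‖ ≤ 1 := by
  rw [norm_e, Real.exp_le_one_iff]
  have h1 : (a * τ + b : ℂ).im = a * τ.im := by simp
  rw [h1]
  have := mul_nonneg Real.pi_pos.le (mul_nonneg h.1 hτ.le)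
  linarith

lemma siegelDom_ne_one {a b : ℝ} (h : (a, b) ∈ siegelDom) {τ : ℂ} (hτ : 0 < τ.im) :
    e (a * τ + b) ≠ 1 := by
  rw [Ne, e_eq_one_iff]
  rintro ⟨n, hn⟩
  have h1 := congrArg Complex.im hn
  simp only [Complex.add_im, Complex.im_ofReal_mul, Complex.ofReal_im,
    add_zero, Complex.intCast_im, mul_eq_zero, hτ.ne', or_false] at h1
  refine h.2.2 h1 n ?_
  rw [h1] at hn
  simp only [Complex.ofReal_zero, zero_mul, zero_add] at hn
  exact_mod_cast hn

lemma siegelDom_norm_lt {a b : ℝ} (h : (a, b) ∈ siegelDom) {τ : ℂ} (hτ : 0 < τ.im) :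
    ‖e ((1 - a) * τ - b)‖ < 1 := by
  refine norm_e_lt_one ?_
  have h1 : ((1 - a) * τ - b : ℂ).im = (1 - a) * τ.im := by simp
  rw [h1]
  exact mul_pos (by linarith [h.2.1]) hτ

lemma ne_one_of_norm_lt {w : ℂ} (h : ‖w‖ < 1) : w ≠ 1 := fun h' => by
  rw [h', norm_one] at h; exact lt_irrefl _ h

lemma exp_logSiegel {a b : ℝ} (h : (a, b) ∈ siegelDom) {τ : ℂ} (hτ : 0 < τ.im) :
    Complex.exp (logSiegel a b τ) =
      e (τ * (a ^ 2 - a + 1 / 6) / 2) * theta τ (a * τ + b) := by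
  have hq := norm_e_lt_one hτ
  have h2 := siegelDom_norm_lt h hτ
  have h3 : Complex.exp (Real.pi * Complex.I * τ * (a ^ 2 - a + 1 / 6)) =
      e (τ * (a ^ 2 - a + 1 / 6) / 2) := by
    rw [e]; ring_nf
  rw [logSiegel, Complex.exp_add, Complex.exp_add, h3,
    exp_logQ hq (siegelDom_norm_le h hτ) (siegelDom_ne_one h hτ),
    exp_logQ hq h2.le (ne_one_of_norm_lt h2), mul_assoc, theta]
  ring_nf

lemma logSiegel_add_int (a b : ℝ) (n : ℤ) (τ : ℂ) : logSiegel a (b + n) τ = logSiegel a b τ := by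
  have h1 : e (a * τ + ((b + n : ℝ) : ℂ)) = e (a * τ + b) := by
    rw [← e_add_intCast (a * τ + b) n]; push_cast; ring_nf
  have h2 : e ((1 - a) * τ - ((b + n : ℝ) : ℂ)) = e ((1 - a) * τ - b) := by
    rw [← e_add_intCast ((1 - a) * τ - b) (-n)]; push_cast; ring_nf
  rw [logSiegel, logSiegel, h1, h2]

lemma sum_logSiegel_snd {a b : ℝ} (h : (a, b) ∈ siegelDom) {τ : ℂ} (hτ : 0 < τ.im) {N : ℕ}
    (hN : 0 < N) : ∑ t ∈ Finset.range N, logSiegel a ((b + t) / N) (τ / N) = logSiegel a b τ := by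
  have hNc : (N : ℂ) ≠ 0 := by exact_mod_cast hN.ne'
  have hτN : 0 < (τ / N).im := by
    rw [Complex.div_natCast_im]; exact div_pos hτ (by exact_mod_cast hN)
  have hq := norm_e_lt_one hτN
  have hqN : e (τ / N) ^ N = e τ := by rw [← e_natCast_mul, mul_div_cancel₀ _ hNc]
  simp only [logSiegel]
  rw [Finset.sum_add_distrib, Finset.sum_add_distrib]
  congr 1
  · congr 1
    · rw [Finset.sum_const, Finset.card_range, nsmul_eq_mul]
      field_simp
    · have hwN : e ((a * τ + b) / N) ^ N = e (a * τ + b) := by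
        rw [← e_natCast_mul, mul_div_cancel₀ _ hNc]
      have hw : ‖e ((a * τ + b) / N)‖ ≤ 1 := by
        rw [← pow_le_one_iff_of_nonneg (norm_nonneg _) hN.ne', ← norm_pow, hwN]
        exact siegelDom_norm_le h hτ
      have := sum_logQ_e_mul hq hN hw (by rw [hwN]; exact siegelDom_ne_one h hτ)
      rw [hwN, hqN] at this
      rw [← this]
      refine Finset.sum_congr rfl fun t _ => ?_
      rw [← e_add]
      congr 2
      push_cast
      field_simp
      ring
  -- In this factor t enters with a minus sign. Reversing the sum by t ↦ N - 1 - t makes the sign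
  -- positive and shifts the base point by 1/N, which the N-th power does not see.
  · have hwN : e (((1 - a) * τ - b) / N + 1 / N) ^ N = e ((1 - a) * τ - b) := by
      rw [← e_natCast_mul, ← add_div, mul_div_cancel₀ _ hNc, e_add, e_one, mul_one]
    have hlt := siegelDom_norm_lt h hτ
    have hw : ‖e (((1 - a) * τ - b) / N + 1 / N)‖ ≤ 1 := by
      rw [← pow_le_one_iff_of_nonneg (norm_nonneg _) hN.ne', ← norm_pow, hwN]
      exact hlt.le
    have := sum_logQ_e_mul hq hN hw (by rw [hwN]; exact ne_one_of_norm_lt hlt)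
    rw [hwN, hqN] at this
    rw [← this, ← Finset.sum_range_reflect]
    refine Finset.sum_congr rfl fun t ht => ?_
    have ht' := Finset.mem_range.mp ht
    rw [← e_add]
    have hcast : ((N - 1 - t : ℕ) : ℂ) = N - 1 - t := by
      rw [Nat.cast_sub (by omega), Nat.cast_sub (by omega), Nat.cast_one]
    rw [← e_add_intCast ((1 - a) * (τ / N) - _) 1]
    congr 2
    push_cast
    rw [hcast]
    field_simp
    ring

/-- The linear terms add up by the distribution relation of the Bernoulli polynomial B_2, checked
through the sums of s and s². The logarithms add up by sorting exponents modulo N, reversed in the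
second product. -/
lemma sum_logSiegel_fst (a b : ℝ) {τ : ℂ} (hτ : 0 < τ.im) {N : ℕ}
    (hN : 0 < N) : ∑ s ∈ Finset.range N, logSiegel ((a + s) / N) b (N * τ) = logSiegel a b τ := by
  have hNc : (N : ℂ) ≠ 0 := by exact_mod_cast hN.ne'
  have hq := norm_e_lt_one hτ
  have hgauss : ∀ N : ℕ, ∑ s ∈ Finset.range N, (s : ℂ) = N * (N - 1) / 2 := fun N => by
    induction N with
    | zero => simp
    | succ n ih => rw [Finset.sum_range_succ, ih]; push_cast; ring
  have hgauss2 : ∀ N : ℕ, ∑ s ∈ Finset.range N, (s : ℂ) ^ 2 = N * (N - 1) * (2 * N - 1) / 6 :=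
    fun N => by
    induction N with
    | zero => simp
    | succ n ih => rw [Finset.sum_range_succ, ih]; push_cast; ring
  simp only [logSiegel]
  rw [Finset.sum_add_distrib, Finset.sum_add_distrib]
  congr 1
  · congr 1
    · have hterm : ∀ s : ℕ, (Real.pi : ℂ) * Complex.I * (N * τ) *
          ((((a + s) / N : ℝ) : ℂ) ^ 2 - (((a + s) / N : ℝ) : ℂ) + 1 / 6) =
          Real.pi * Complex.I * τ / N * ((s : ℂ) ^ 2 + (2 * a - N) * s + (a ^ 2 - a * N + N ^ 2 / 6)) :=
        fun s => by
          push_cast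
          field_simp
          ring
      simp only [hterm]
      rw [← Finset.mul_sum, Finset.sum_add_distrib, Finset.sum_add_distrib, ← Finset.mul_sum, hgauss,
        hgauss2, Finset.sum_const, Finset.card_range, nsmul_eq_mul]
      field_simp
      ring
    · rw [← sum_logQ_pow_mul hq hN]
      refine Finset.sum_congr rfl fun s _ => ?_
      rw [e_natCast_mul, ← e_natCast_mul s, ← e_add]
      congr 2
      push_cast
      field_simp
      ring
  · rw [← sum_logQ_pow_mul hq hN, ← Finset.sum_range_reflect]
    refine Finset.sum_congr rfl fun s hs => ?_
    have hs' := Finset.mem_range.mp hs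
    have hcast : ((N - 1 - s : ℕ) : ℂ) = N - 1 - s := by
      rw [Nat.cast_sub (by omega), Nat.cast_sub (by omega), Nat.cast_one]
    rw [e_natCast_mul, ← e_natCast_mul s, ← e_add]
    congr 2
    push_cast
    rw [hcast]
    field_simp
    ring

lemma continuousOn_logSiegel {τ : ℂ} (hτ : 0 < τ.im) :
    ContinuousOn (fun x : ℝ × ℝ => logSiegel x.1 x.2 τ) siegelDom := by
  have hq := norm_e_lt_one hτ
  have hL := continuousOn_logQ hq
  refine (ContinuousOn.add (by fun_prop) (hL.comp ?_ ?_)).add (hL.comp ?_ ?_)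
  · exact (continuous_e.comp (by fun_prop)).continuousOn
  · exact fun x hx => ⟨siegelDom_norm_le hx hτ, siegelDom_ne_one hx hτ⟩
  · exact (continuous_e.comp (by fun_prop)).continuousOn
  · exact fun x hx => ⟨(siegelDom_norm_lt hx hτ).le, ne_one_of_norm_lt (siegelDom_norm_lt hx hτ)⟩

lemma mem_siegelDom_of_pos {a : ℝ} (h0 : 0 < a) (h1 : a < 1) (b : ℝ) : (a, b) ∈ siegelDom :=
  ⟨h0.le, h1, fun h => absurd h h0.ne'⟩

lemma mem_siegelDom_of_mem_Ioo {a b : ℝ} (h0 : 0 ≤ a) (h1 : a < 1) (hb : b ∈ Set.Ioo (0 : ℝ) 1) :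
    (a, b) ∈ siegelDom :=
  ⟨h0, h1, fun _ n hn => by
    simp only at hn
    have h2 := hb.1
    have h3 := hb.2
    rw [hn] at h2 h3
    have h4 : 0 < n := by exact_mod_cast h2
    have h5 : n < 1 := by exact_mod_cast h3
    omega⟩

lemma im_neg_one_div {τ : ℂ} (hτ : 0 < τ.im) : 0 < (-1 / τ).im := by
  have hτ0 : τ ≠ 0 := fun h => by simp [h] at hτ
  rw [neg_div, one_div, Complex.neg_im, Complex.inv_im, neg_div, neg_neg]
  exact div_pos hτ (Complex.normSq_pos.mpr hτ0)

/-- By `theta_inversion` the exponential of the difference F of the two sides does not depend on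
(a,b). F is continuous on the connected rectangle [0,1) × (0,1), hence constant. -/
lemma logSiegel_inversion_const {τ : ℂ} (hτ : 0 < τ.im) : ∃ κ : ℂ, ∀ a ∈ Set.Ico (0 : ℝ) 1,
    ∀ b ∈ Set.Ioo (0 : ℝ) 1, logSiegel b (-a) (-1 / τ) - logSiegel a b τ =
      2 * Real.pi * Complex.I * (a * b - a / 2 - b / 2) + κ := by
  have hτ0 : τ ≠ 0 := fun h => by simp [h] at hτ
  have hτ' := im_neg_one_div hτ
  obtain ⟨k, hk⟩ := theta_inversion hτ
  let D : Set (ℝ × ℝ) := Set.Ico 0 1 ×ˢ Set.Ioo 0 1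
  have hD : IsPreconnected D := (isPreconnected_Ico).prod isPreconnected_Ioo
  have hmem : ∀ x ∈ D, x ∈ siegelDom := fun x hx => mem_siegelDom_of_mem_Ioo hx.1.1 hx.1.2 hx.2
  have hmem' : ∀ x ∈ D, (x.2, -x.1) ∈ siegelDom := fun x hx => mem_siegelDom_of_pos hx.2.1 hx.2.2 _
  let F : ℝ × ℝ → ℂ := fun x => logSiegel x.2 (-x.1) (-1 / τ) - logSiegel x.1 x.2 τ -
    2 * Real.pi * Complex.I * (x.1 * x.2 - x.1 / 2 - x.2 / 2)
  have hF : ContinuousOn F D := by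
    refine ContinuousOn.sub (ContinuousOn.sub ?_ ?_) (by fun_prop)
    · exact (continuousOn_logSiegel hτ').comp (f := fun x : ℝ × ℝ => (x.2, -x.1)) (by fun_prop) hmem'
    · exact (continuousOn_logSiegel hτ).mono hmem
  have hexp : ∀ x ∈ D, Complex.exp (F x) = k * e (-(1 / 12 / τ) - τ / 12) := by
    rintro ⟨a, b⟩ hx
    have him : (a * τ + b : ℂ).im = a * τ.im := by simp
    have hne : theta τ (a * τ + b) ≠ 0 := by
      refine theta_ne_zero ?_ ?_ (siegelDom_ne_one (hmem _ hx) hτ)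
      · rw [him]; exact mul_nonneg hx.1.1 hτ.le
      · rw [him]; exact mul_lt_of_lt_one_left hτ hx.1.2
    have h1 := hk (a * τ + b)
    simp only [F]
    rw [Complex.exp_sub, Complex.exp_sub, exp_logSiegel (hmem' _ hx) hτ', exp_logSiegel (hmem _ hx) hτ]
    have harg : (b : ℂ) * (-1 / τ) + ((-a : ℝ) : ℂ) = -(a * τ + b) / τ := by
      push_cast; field_simp; ring
    simp only [harg]
    have he : Complex.exp (2 * Real.pi * Complex.I * (a * b - a / 2 - b / 2)) =
        e (a * b - a / 2 - b / 2) := rfl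
    rw [he, div_div, div_eq_iff (mul_ne_zero (mul_ne_zero (e_ne_zero _) hne) (e_ne_zero _))]
    have hexpo : e (-1 / τ * ((b : ℂ) ^ 2 - b + 1 / 6) / 2) =
        e (-(1 / 12 / τ) - τ / 12) * e (τ * ((a : ℂ) ^ 2 - a + 1 / 6) / 2) *
        e (a * b - a / 2 - b / 2) *
        e (-((a * τ + b) ^ 2 / (2 * τ)) + (1 / (2 * τ) + 1 / 2) * (a * τ + b)) := by
      rw [← e_add, ← e_add, ← e_add]
      congr 1
      field_simp
      ring
    rw [hexpo, mul_assoc _ (e (-((a * τ + b) ^ 2 / (2 * τ)) + _)), h1]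
    ring
  refine ⟨F (0, 1 / 2), fun a ha b hb => ?_⟩
  have h2 := eq_of_exp_eq_const hD hF hexp (x := (a, b)) (y := (0, 1 / 2)) ⟨ha, hb⟩
    ⟨⟨le_refl _, zero_lt_one⟩, by norm_num, by norm_num⟩
  rw [← h2]
  simp only [F]
  ring

/-- The distribution relation for N = 2 expresses both logarithms at (1/2, 1/2) through the four
points with coordinates 1/4 and 3/4. Comparing constants gives κ - πi/2 = 4κ - 2πi, hence κ = πi/2.
-/
lemma logSiegel_inversion {τ : ℂ} (hτ : 0 < τ.im) {a b : ℝ} (ha : a ∈ Set.Ico (0 : ℝ) 1)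
    (hb : b ∈ Set.Ioo (0 : ℝ) 1) : logSiegel b (-a) (-1 / τ) - logSiegel a b τ =
      2 * Real.pi * Complex.I * ((a - 1 / 2) * (b - 1 / 2)) := by
  have hτ0 : τ ≠ 0 := fun h => by simp [h] at hτ
  have hτ' := im_neg_one_div hτ
  obtain ⟨κ, hκ⟩ := logSiegel_inversion_const hτ
  have hrel : ∀ {a b : ℝ}, (a, b) ∈ siegelDom → ∀ {τ : ℂ}, 0 < τ.im → logSiegel a b τ =
      ∑ s ∈ Finset.range 2, ∑ t ∈ Finset.range 2, logSiegel ((a + s) / 2) ((b + t) / 2) τ := by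
    intro a b hab τ hτ
    have h2 : 0 < (((2 : ℕ) : ℂ) * τ).im := by simpa using hτ
    have h3 := sum_logSiegel_fst a b hτ two_pos
    rw [← h3]
    refine Finset.sum_congr rfl fun s hs => ?_
    have hs' : (s : ℝ) ≤ 1 := by
      have := Finset.mem_range.mp hs
      exact_mod_cast Nat.lt_succ_iff.mp this
    have hd : ((a + s) / (2 : ℕ), b) ∈ siegelDom := by
      have ha0 : 0 ≤ a := hab.1
      have ha1 : a < 1 := hab.2.1
      refine ⟨by positivity, ?_, fun h => hab.2.2 ?_⟩
      · change (a + s) / (2 : ℕ) < 1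
        push_cast
        linarith
      · have h4 : a + s = 0 := by simpa using h
        have h5 : (0 : ℝ) ≤ s := by positivity
        change a = 0
        linarith
    rw [← sum_logSiegel_snd hd h2 two_pos]
    refine Finset.sum_congr rfl fun t _ => ?_
    rw [Nat.cast_ofNat, Nat.cast_ofNat, mul_div_cancel_left₀ _ two_ne_zero]
  have hh : (1 / 2 : ℝ) ∈ Set.Ioo (0 : ℝ) 1 := by norm_num
  have e1 := hrel (mem_siegelDom_of_pos hh.1 hh.2 (1 / 2)) hτ
  have e2 := hrel (mem_siegelDom_of_pos hh.1 hh.2 (-(1 / 2))) hτ'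
  have e0 := hκ (1 / 2) ⟨by norm_num, by norm_num⟩ (1 / 2) hh
  have q1 := hκ (1 / 4) ⟨by norm_num, by norm_num⟩ (1 / 4) ⟨by norm_num, by norm_num⟩
  have q2 := hκ (1 / 4) ⟨by norm_num, by norm_num⟩ (3 / 4) ⟨by norm_num, by norm_num⟩
  have q3 := hκ (3 / 4) ⟨by norm_num, by norm_num⟩ (1 / 4) ⟨by norm_num, by norm_num⟩
  have q4 := hκ (3 / 4) ⟨by norm_num, by norm_num⟩ (3 / 4) ⟨by norm_num, by norm_num⟩
  -- The inversion formula yields the second parameter -3/4 where the distribution relation yields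
  -- 1/4; these agree modulo 1.
  have p1 := logSiegel_add_int (1 / 4) (-(3 / 4)) 1 (-1 / τ)
  have p2 := logSiegel_add_int (3 / 4) (-(3 / 4)) 1 (-1 / τ)
  simp only [Finset.sum_range_succ, Finset.sum_range_zero, Nat.cast_zero, Nat.cast_one] at e1 e2
  norm_num at e1 e2 e0 q1 q2 q3 q4 p1 p2
  have hκv : κ = Real.pi * Complex.I / 2 := by
    linear_combination (1 / 3 : ℂ) * (e0 - e2 + e1 - q1 - q2 - q3 - q4 - p1 - p2)
  rw [hκ a ha b hb, hκv]
  ring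

/-- The exponentials agree on the connected interval (0,1), and at a = 1/2 both sides are 0. It
serves the boundary case of the inversion formula, where one parameter is an integer. -/
lemma log_one_sub_e_sub {a : ℝ} (ha : a ∈ Set.Ioo (0 : ℝ) 1) :
    Complex.log (1 - e a) - Complex.log (1 - e (-a)) = 2 * Real.pi * Complex.I * (a - 1 / 2) := by
  have hne : ∀ x ∈ Set.Ioo (0 : ℝ) 1, e x ≠ 1 ∧ e (-x) ≠ 1 := by
    intro x hx
    have h := (mem_siegelDom_of_mem_Ioo le_rfl one_pos hx).2.2 rfl
    constructor
    · rw [Ne, e_eq_one_iff]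
      rintro ⟨n, hn⟩
      exact h n (by exact_mod_cast hn)
    · rw [Ne, e_eq_one_iff]
      rintro ⟨n, hn⟩
      refine h (-n) ?_
      have : (x : ℂ) = -n := by rw [← hn, neg_neg]
      exact_mod_cast this
  have hslit : ∀ x ∈ Set.Ioo (0 : ℝ) 1, 1 - e x ∈ Complex.slitPlane := fun x hx =>
    one_sub_mem_slitPlane (norm_e_ofReal x).le (hne x hx).1
  have hslit' : ∀ x ∈ Set.Ioo (0 : ℝ) 1, 1 - e (-x) ∈ Complex.slitPlane := fun x hx =>
    one_sub_mem_slitPlane (by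
      have := (norm_e_ofReal (-x)).le
      rwa [Complex.ofReal_neg] at this) (hne x hx).2
  have key := eq_of_exp_eq_const (s := Set.Ioo (0 : ℝ) 1) isPreconnected_Ioo
    (f := fun x : ℝ => Complex.log (1 - e x) - Complex.log (1 - e (-x)) -
      2 * Real.pi * Complex.I * (x - 1 / 2)) (k := 1) ?_ ?_ ha
      (show (1 / 2 : ℝ) ∈ Set.Ioo (0 : ℝ) 1 by norm_num)
  · have h2 : e (((1 / 2 : ℝ) : ℂ)) = -1 := by
      rw [← e_half]; push_cast; rfl
    have h3 : e (-((1 / 2 : ℝ) : ℂ)) = -1 := by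
      rw [e_neg, h2]; norm_num
    simp only [h2, h3] at key
    push_cast at key
    rw [sub_self, sub_self, mul_zero, sub_zero] at key
    exact sub_eq_zero.mp key
  · refine ContinuousOn.sub (ContinuousOn.sub ?_ ?_) (by fun_prop)
    · exact ContinuousOn.clog (continuousOn_const.sub (continuous_e.comp (by fun_prop)).continuousOn)
        hslit
    · exact ContinuousOn.clog (continuousOn_const.sub (continuous_e.comp (by fun_prop)).continuousOn)
        hslit'
  · intro x hx
    have h2 : Complex.exp (2 * Real.pi * Complex.I * (x - 1 / 2)) = e (x - 1 / 2) := rfl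
    rw [Complex.exp_sub, Complex.exp_sub, Complex.exp_log (Complex.slitPlane_ne_zero (hslit x hx)),
      Complex.exp_log (Complex.slitPlane_ne_zero (hslit' x hx)), h2, e_sub, e_half, div_div,
      div_eq_one_iff_eq]
    · rw [e_neg]
      have := e_ne_zero x
      field_simp
      ring
    · refine mul_ne_zero (Complex.slitPlane_ne_zero (hslit' x hx)) ?_
      rw [div_neg, div_one]
      exact neg_ne_zero.mpr (e_ne_zero _)


/-! ### Distribution relations on `ℚ/ℤ` -/

/-- `φ` is a function on `ℚ/ℤ`. -/
def IsPer {A : Type} (φ : ℚ → A) : Prop := ∀ (x : ℚ) (n : ℤ), φ (x + n) = φ x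

lemma isPer_of_fract {A : Type} (φ : ℚ → A) : IsPer fun x => φ (Int.fract x) := fun x n => by
  simp only [Int.fract_add_intCast]

lemma perB_isPer (r : ℕ) : IsPer (perB r) := fun x n => by simp only [perB, Int.fract_add_intCast]

lemma dirac_isPer : IsPer dirac := fun x n => by simp only [dirac, Int.fract_add_intCast]

lemma B1_isPer : IsPer B1 := fun x n => by simp only [B1, perB_isPer 1 x n, dirac_isPer x n]

lemma sum_div_add_one {A : Type} [AddCommMonoid A] {φ : ℚ → A} (hφ : IsPer φ) {N : ℕ}
    (hN : 0 < N) (x : ℚ) : ∑ s ∈ Finset.range N, φ ((x + 1 + s) / N) =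
      ∑ s ∈ Finset.range N, φ ((x + s) / N) := by
  obtain ⟨M, rfl⟩ : ∃ M, N = M + 1 := ⟨N - 1, by omega⟩
  rw [Finset.sum_range_succ, Finset.sum_range_succ' fun s : ℕ => φ ((x + s) / (M + 1 : ℕ))]
  congr 1
  · refine Finset.sum_congr rfl fun s _ => ?_
    push_cast
    ring_nf
  · rw [← hφ ((x + (0 : ℕ)) / (M + 1 : ℕ)) 1]
    congr 1
    push_cast
    field_simp
    ring

lemma sum_div_add_int {A : Type} [AddCommMonoid A] {φ : ℚ → A} (hφ : IsPer φ) {N : ℕ}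
    (hN : 0 < N) (x : ℚ) (m : ℤ) : ∑ s ∈ Finset.range N, φ ((x + m + s) / N) =
      ∑ s ∈ Finset.range N, φ ((x + s) / N) := by
  induction m using Int.induction_on with
  | zero => simp
  | succ m ih =>
    rw [← ih, ← sum_div_add_one hφ hN (x + (m : ℤ))]
    refine Finset.sum_congr rfl fun s _ => ?_
    congr 2
    push_cast
    ring
  | pred m ih =>
    rw [← ih, ← sum_div_add_one hφ hN (x + (-(m : ℤ) - 1 : ℤ))]
    refine Finset.sum_congr rfl fun s _ => ?_
    congr 2
    push_cast
    ring

lemma sum_div_fract {A : Type} [AddCommMonoid A] {φ : ℚ → A} (hφ : IsPer φ) {N : ℕ}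
    (hN : 0 < N) (x : ℚ) : ∑ s ∈ Finset.range N, φ ((x + s) / N) =
      ∑ s ∈ Finset.range N, φ ((Int.fract x + s) / N) := by
  rw [← sum_div_add_int hφ hN (Int.fract x) ⌊x⌋, Int.fract_add_floor]

lemma fract_fract_add_div (x : ℚ) {N s : ℕ} (hs : s < N) :
    Int.fract ((Int.fract x + s) / N) = (Int.fract x + s) / N := by
  have hN : (0 : ℚ) < N := by exact_mod_cast (Nat.zero_le s).trans_lt hs
  have h1 := Int.fract_nonneg x
  have h2 := Int.fract_lt_one x
  have h3 : (s : ℚ) + 1 ≤ N := by exact_mod_cast hs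
  rw [Int.fract_eq_self]
  exact ⟨by positivity, by rw [div_lt_one hN]; linarith⟩

lemma sum_range_cast (N : ℕ) : ∑ s ∈ Finset.range N, (s : ℚ) = N * (N - 1) / 2 := by
  induction N with
  | zero => simp
  | succ n ih => rw [Finset.sum_range_succ, ih]; push_cast; ring

lemma sum_range_cast_sq (N : ℕ) :
    ∑ s ∈ Finset.range N, (s : ℚ) ^ 2 = N * (N - 1) * (2 * N - 1) / 6 := by
  induction N with
  | zero => simp
  | succ n ih => rw [Finset.sum_range_succ, ih]; push_cast; ring

lemma perB_zero (x : ℚ) : perB 0 x = 1 := by simp [perB]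

lemma perB_one (x : ℚ) : perB 1 x = if Int.fract x = 0 then 0 else Int.fract x - 1 / 2 := by
  by_cases h : Int.fract x = 0
  · simp [perB, h]
  · rw [perB, if_neg (by simpa using h), if_neg h, Polynomial.bernoulli_one]
    simp

lemma perB_two (x : ℚ) : perB 2 x = Int.fract x ^ 2 - Int.fract x + 1 / 6 := by
  rw [perB, if_neg (by norm_num)]
  simp [Polynomial.bernoulli, Finset.sum_range_succ, bernoulli_one, bernoulli_two]
  ring

lemma B1_eq (x : ℚ) : B1 x = Int.fract x - 1 / 2 := by
  rw [B1, perB_one, dirac]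
  split_ifs with h
  · simp [h]
  · ring

lemma perB_one_eq (x : ℚ) : perB 1 x = B1 x + dirac x / 2 := by rw [B1]; ring

lemma sum_perB_two {N : ℕ} (hN : 0 < N) (x : ℚ) :
    ∑ s ∈ Finset.range N, perB 2 ((x + s) / N) = (N : ℚ)⁻¹ * perB 2 x := by
  have hNq : (N : ℚ) ≠ 0 := by exact_mod_cast hN.ne'
  rw [sum_div_fract (perB_isPer 2) hN]
  have h : ∀ s ∈ Finset.range N, perB 2 ((Int.fract x + s) / N) =
      ((N : ℚ)⁻¹) ^ 2 * ((s : ℚ) ^ 2 + (2 * Int.fract x - N) * s +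
        (Int.fract x ^ 2 - Int.fract x * N + N ^ 2 / 6)) := fun s hs => by
    rw [perB_two, fract_fract_add_div x (Finset.mem_range.mp hs)]
    field_simp
    ring
  rw [Finset.sum_congr rfl h, ← Finset.mul_sum, Finset.sum_add_distrib, Finset.sum_add_distrib,
    ← Finset.mul_sum, sum_range_cast, sum_range_cast_sq, Finset.sum_const, Finset.card_range,
    nsmul_eq_mul, perB_two]
  field_simp
  ring

lemma sum_B1 {N : ℕ} (hN : 0 < N) (x : ℚ) :
    ∑ s ∈ Finset.range N, B1 ((x + s) / N) = B1 x := by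
  have hNq : (N : ℚ) ≠ 0 := by exact_mod_cast hN.ne'
  rw [sum_div_fract B1_isPer hN]
  have h : ∀ s ∈ Finset.range N, B1 ((Int.fract x + s) / N) =
      (N : ℚ)⁻¹ * (s + (Int.fract x - N / 2)) := fun s hs => by
    rw [B1_eq, fract_fract_add_div x (Finset.mem_range.mp hs)]
    field_simp
    ring
  rw [Finset.sum_congr rfl h, ← Finset.mul_sum, Finset.sum_add_distrib, sum_range_cast,
    Finset.sum_const, Finset.card_range, nsmul_eq_mul, B1_eq]
  field_simp
  ring

lemma sum_dirac {N : ℕ} (hN : 0 < N) (x : ℚ) :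
    ∑ s ∈ Finset.range N, dirac ((x + s) / N) = dirac x := by
  have hNq : (0 : ℚ) < N := by exact_mod_cast hN
  have h0 := Int.fract_nonneg x
  rw [sum_div_fract dirac_isPer hN, Finset.sum_eq_single 0]
  · rw [dirac, fract_fract_add_div x hN, dirac]
    refine if_congr ?_ rfl rfl
    rw [div_eq_zero_iff, or_iff_left hNq.ne']
    simp
  · intro s hs hs0
    have h1 : (0 : ℚ) < s := by exact_mod_cast Nat.pos_of_ne_zero hs0
    rw [dirac, fract_fract_add_div x (Finset.mem_range.mp hs), if_neg]
    positivity
  · exact fun h => absurd (Finset.mem_range.mpr hN) h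

lemma sum_perB_one {N : ℕ} (hN : 0 < N) (x : ℚ) :
    ∑ s ∈ Finset.range N, perB 1 ((x + s) / N) = perB 1 x := by
  simp only [perB_one_eq]
  rw [Finset.sum_add_distrib, sum_B1 hN, ← Finset.sum_div, sum_dirac hN]

lemma sum_range_mul_of_coprime {A : Type} [AddCommMonoid A] {c N : ℕ} (hN : 0 < N)
    (hc : N.Coprime c) {ψ : ℕ → A} (hψ : ∀ s, ψ (s % N) = ψ s) :
    ∑ s ∈ Finset.range N, ψ (c * s) = ∑ s ∈ Finset.range N, ψ s := by
  have hmaps : Set.MapsTo (fun s => c * s % N) (Finset.range N : Set ℕ) (Finset.range N : Set ℕ) :=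
    fun s _ => by simpa using Nat.mod_lt _ hN
  have hinj : Set.InjOn (fun s => c * s % N) (Finset.range N : Set ℕ) := fun s hs t ht hst => by
    have h1 : s ≡ t [MOD N] := Nat.ModEq.cancel_left_of_coprime hc hst
    have hs' : s < N := by simpa using hs
    have ht' : t < N := by simpa using ht
    rwa [Nat.ModEq, Nat.mod_eq_of_lt hs', Nat.mod_eq_of_lt ht'] at h1
  refine Finset.sum_nbij (fun s => c * s % N) hmaps hinj
    (Finset.surjOn_of_injOn_of_card_le _ hmaps hinj le_rfl) fun s _ => (hψ _).symm

/-- Multiplication by c permutes the residues modulo N, which reduces to the relation of B_1 itself.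
This is where the restriction to N prime to c enters. -/
lemma sum_B1_mul {c N : ℕ} (hN : 0 < N) (hc : N.Coprime c) (x : ℚ) :
    ∑ s ∈ Finset.range N, B1 ((x + s) / N * c) = B1 (x * c) := by
  have hNq : (N : ℚ) ≠ 0 := by exact_mod_cast hN.ne'
  have hψ : ∀ s : ℕ, B1 ((x * c + (s % N : ℕ)) / N) = B1 ((x * c + s) / N) := fun s => by
    rw [← B1_isPer ((x * c + (s % N : ℕ)) / N) (s / N : ℕ)]
    congr 1
    have h : ((s % N : ℕ) : ℚ) + N * (s / N : ℕ) = s := by exact_mod_cast Nat.mod_add_div s N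
    rw [← h, Int.cast_natCast]
    field_simp
    ring
  rw [← sum_B1 hN (x * c), ← sum_range_mul_of_coprime (ψ := fun s => B1 ((x * c + s) / N)) hN hc hψ]
  refine Finset.sum_congr rfl fun s _ => ?_
  congr 1
  push_cast
  ring

lemma sum_grid {A : Type} [AddCommMonoid A] (N : ℕ) (g : ℕ → ℕ → A) :
    ∑ s ∈ grid N, g (s 0) (s 1) = ∑ s ∈ Finset.range N, ∑ t ∈ Finset.range N, g s t := by
  rw [← Finset.sum_product']
  refine Finset.sum_nbij' (fun s => (s 0, s 1)) (fun x => ![x.1, x.2]) ?_ ?_ ?_ ?_ ?_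
  · intro s hs
    simpa using mem_grid.mp hs
  · rintro ⟨s, t⟩ hx
    rw [mem_grid, Fin.forall_fin_two]
    simpa using hx
  · intro s _
    funext k
    fin_cases k <;> rfl
  · intro x _
    rfl
  · intro s _
    rfl

lemma divVec_self (N : ℕ) (v : V) (s : Fin 2 → ℕ) :
    (fun k => (v k + s k) / N) = divVec N N v (s 0) (s 1) := by
  funext k
  fin_cases k <;> rfl

/-- The weights of the factors need only be inverse to each other. For 𝔹_2 ⊗ 𝔹_0 they are 1/N and N;
otherwise both are 1. -/
lemma isDistRel_tensor {c : ℕ} {σ₁ σ₂ : ℚ → ℚ} (α : ℕ → ℚ) (hα : ∀ N, 0 < N → α N ≠ 0)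
    (h₁ : ∀ N : ℕ, 0 < N → N.Coprime c → ∀ x, ∑ s ∈ Finset.range N, σ₁ ((x + s) / N) = (α N)⁻¹ * σ₁ x)
    (h₂ : ∀ N : ℕ, 0 < N → N.Coprime c → ∀ x, ∑ s ∈ Finset.range N, σ₂ ((x + s) / N) = α N * σ₂ x) :
    IsDistRel c fun v => σ₁ (v 0) * σ₂ (v 1) := by
  intro N hN hc v _ _
  rw [sum_grid N fun s t => σ₁ ((v 0 + s) / N) * σ₂ ((v 1 + t) / N), ← Finset.sum_mul_sum,
    h₁ N hN hc, h₂ N hN hc, mul_mul_mul_comm, inv_mul_cancel₀ (hα N hN), one_mul]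

lemma IsPer.cosetFun {A : Type} [Mul A] {σ₁ σ₂ : ℚ → A} (h₁ : IsPer σ₁) (h₂ : IsPer σ₂) :
    IsCosetFun fun v : V => σ₁ (v 0) * σ₂ (v 1) := fun v w => by
  simp only [Pi.add_apply, h₁ (v 0), h₂ (v 1)]

lemma isDistRel_B2B0 (c : ℕ) : IsDistRel c fun v => perB 2 (v 0) * perB 0 (v 1) :=
  isDistRel_tensor (fun N => N) (fun N hN => by exact_mod_cast hN.ne')
    (fun N hN _ x => sum_perB_two hN x) fun N _ _ x => by simp [perB_zero]

lemma isDistRel_B1B1 (c : ℕ) : IsDistRel c fun v => perB 1 (v 0) * perB 1 (v 1) :=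
  isDistRel_tensor (fun _ => 1) (fun _ _ => one_ne_zero)
    (fun N hN _ x => by rw [sum_perB_one hN, inv_one, one_mul])
    fun N hN _ x => by rw [sum_perB_one hN, one_mul]

lemma isDistRel_diracB1 (c : ℕ) : IsDistRel c fun v => dirac (v 0) * perB 1 (v 1) :=
  isDistRel_tensor (fun _ => 1) (fun _ _ => one_ne_zero)
    (fun N hN _ x => by rw [sum_dirac hN, inv_one, one_mul])
    fun N hN _ x => by rw [sum_perB_one hN, one_mul]

lemma sum_piC_fst {c N : ℕ} (hN : 0 < N) (hc : N.Coprime c) (x : ℚ) :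
    ∑ s ∈ Finset.range N, (c * B1 ((x + s) / N) - B1 ((x + s) / N * c)) =
      c * B1 x - B1 (x * c) := by
  rw [Finset.sum_sub_distrib, ← Finset.mul_sum, sum_B1 hN, sum_B1_mul hN hc]

/-- The values of `π_c` on cosets. -/
def piCval (c : ℕ) (v : V) : ℚ := B1 (v 1 * c) * (c * B1 (v 0) - B1 (v 0 * c))

lemma isPer_B1_mul (c : ℕ) : IsPer fun x => B1 (x * c) := fun x n => by
  change B1 ((x + n) * c) = B1 (x * c)
  rw [← B1_isPer (x * c) (n * c)]
  push_cast
  ring_nf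

lemma piCval_cosetFun (c : ℕ) : IsCosetFun (piCval c) := fun v w => by
  simp only [piCval, Pi.add_apply, isPer_B1_mul c (v 0), isPer_B1_mul c (v 1), B1_isPer (v 0)]

lemma sum_piCval {c i j : ℕ} (hi0 : 0 < i) (hi : i.Coprime c) (hj0 : 0 < j) (hj : j.Coprime c)
    (v : V) : ∑ s ∈ Finset.range j, ∑ t ∈ Finset.range i, piCval c (divVec i j v s t) =
      piCval c v := by
  have h : ∀ s t : ℕ, piCval c (divVec i j v s t) =
      (c * B1 ((v 0 + s) / j) - B1 ((v 0 + s) / j * c)) * B1 ((v 1 + t) / i * c) := fun s t => by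
    rw [mul_comm]; rfl
  simp only [h]
  rw [← Finset.sum_mul_sum, sum_piC_fst hj0 hj, sum_B1_mul hi0 hi, piCval, mul_comm]

lemma isDistRel_piCval (c : ℕ) : IsDistRel c (piCval c) := by
  intro N hN hc v _ _
  simp only [divVec_self]
  rw [sum_grid N fun s t => piCval c (divVec N N v s t), sum_piCval hN hc hN hc]

/-! ### The logarithms of Siegel functions on cosets -/

/-- The logarithm of the Siegel function attached to the coset of `v`. -/
def cosetLog (v : V) (τ : ℂ) : ℂ := logSiegel (Int.fract (v 0) : ℚ) (v 1) τ

lemma cosetLog_add_int (v : V) (w : Fin 2 → ℤ) (τ : ℂ) :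
    cosetLog (v + fun i => (w i : ℚ)) τ = cosetLog v τ := by
  simp only [cosetLog, Pi.add_apply, Int.fract_add_intCast, Rat.cast_add, Rat.cast_intCast]
  exact logSiegel_add_int _ _ _ _

lemma not_isInt_mem_siegelDom {v : V} (hv : ¬ IsInt v) :
    ((((Int.fract (v 0) : ℚ) : ℝ)), ((v 1 : ℚ) : ℝ)) ∈ siegelDom := by
  refine ⟨Rat.cast_nonneg.mpr (Int.fract_nonneg (v 0)), ?_, fun h n hn => hv ?_⟩
  · have h : ((Int.fract (v 0) : ℚ) : ℝ) < (1 : ℚ) := Rat.cast_lt.mpr (Int.fract_lt_one (v 0))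
    rwa [Rat.cast_one] at h
  · have h' : ((Int.fract (v 0) : ℚ) : ℝ) = 0 := h
    have h0 : Int.fract (v 0) = 0 := Rat.cast_eq_zero.mp h'
    have h1 : v 1 = n := by
      have : ((v 1 : ℚ) : ℝ) = n := hn
      exact_mod_cast this
    refine ⟨![⌊v 0⌋, n], funext fun k => ?_⟩
    fin_cases k
    · have := Int.fract_add_floor (v 0)
      rw [h0, zero_add] at this
      simp [this]
    · simpa using h1

/-- The relations in the two coordinates are kept independent, and jτ/i is the image of τ under the
inverse of diag(i,j). For i = j this is the distribution relation; in general it is invariance under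
diagonal matrices. -/
lemma sum_cosetLog {i j : ℕ} (hi0 : 0 < i) (hj0 : 0 < j) {v : V} (hv : ¬ IsInt v) {τ : ℂ}
    (hτ : 0 < τ.im) : ∑ s ∈ Finset.range j, ∑ t ∈ Finset.range i,
      cosetLog (divVec i j v s t) (j * τ / i) = cosetLog v τ := by
  have : NeZero i := ⟨hi0.ne'⟩
  have : NeZero j := ⟨hj0.ne'⟩
  have hjτ : 0 < (j * τ : ℂ).im := by
    have h1 : (j * τ : ℂ).im = j * τ.im := by simp
    rw [h1]
    exact mul_pos (by exact_mod_cast hj0) hτ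
  have h1 : ∀ s : ℕ, ∑ t ∈ Finset.range i, cosetLog (divVec i j v s t) (j * τ / i) =
      logSiegel (Int.fract ((v 0 + s) / j) : ℚ) (v 1) (j * τ) := fun s => by
    have hI : ¬ IsInt (![(v 0 + s) / j, v 1] : V) := fun ⟨w, hw⟩ => by
      refine hv ⟨![w 0 * j - s, w 1], funext fun k => ?_⟩
      have hjq : (j : ℚ) ≠ 0 := by exact_mod_cast hj0.ne'
      fin_cases k
      · have h : (v 0 + s) / j = w 0 := congrFun hw 0
        rw [div_eq_iff hjq] at h
        simp [← h]
      · have h : v 1 = w 1 := congrFun hw 1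
        simp [h]
    have h2 : (((Int.fract ((v 0 + s) / j) : ℚ) : ℝ), ((v 1 : ℚ) : ℝ)) ∈ siegelDom :=
      not_isInt_mem_siegelDom hI
    rw [← sum_logSiegel_snd h2 hjτ hi0]
    refine Finset.sum_congr rfl fun t _ => ?_
    simp only [cosetLog, divVec, Matrix.cons_val_zero, Matrix.cons_val_one]
    push_cast [-Rat.cast_fract]
    rfl
  rw [Finset.sum_congr rfl fun s _ => h1 s]
  have hper : IsPer fun x : ℚ => logSiegel (Int.fract x : ℚ) (v 1) (j * τ) :=
    isPer_of_fract fun x : ℚ => logSiegel x (v 1) (j * τ)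
  rw [sum_div_fract hper hj0, cosetLog, ← sum_logSiegel_fst _ _ hτ hj0]
  refine Finset.sum_congr rfl fun s hs => ?_
  rw [fract_fract_add_div _ (Finset.mem_range.mp hs)]
  push_cast [-Rat.cast_fract]
  rfl

/-- The arguments of all exponentials change by integers, so only the term πiτ𝔹_2 moves. -/
lemma cosetLog_T (v : V) (τ : ℂ) :
    cosetLog ![v 0, v 0 + v 1] (τ - 1) = cosetLog v τ - Real.pi * Complex.I * (perB 2 (v 0) : ℚ) := by
  have hfr : ((v 0 : ℚ) : ℂ) = (Int.fract (v 0) : ℚ) + ⌊v 0⌋ := by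
    rw [← Rat.cast_intCast, ← Rat.cast_add, Int.fract_add_floor]
  simp only [cosetLog, logSiegel, Matrix.cons_val_zero, Matrix.cons_val_one, perB_two]
  have h1 : e (τ - 1) = e τ := by
    rw [← e_add_intCast τ (-1)]; push_cast; ring_nf
  have h2 : e ((((Int.fract (v 0) : ℚ) : ℝ) : ℂ) * (τ - 1) + (((v 0 + v 1 : ℚ) : ℝ) : ℂ)) =
      e ((((Int.fract (v 0) : ℚ) : ℝ) : ℂ) * τ + ((v 1 : ℚ) : ℝ)) := by
    rw [← e_add_intCast ((((Int.fract (v 0) : ℚ) : ℝ) : ℂ) * τ + _) ⌊v 0⌋]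
    congr 1
    push_cast [-Rat.cast_fract]
    rw [hfr]
    ring
  have h3 : e ((1 - (((Int.fract (v 0) : ℚ) : ℝ) : ℂ)) * (τ - 1) - (((v 0 + v 1 : ℚ) : ℝ) : ℂ)) =
      e ((1 - (((Int.fract (v 0) : ℚ) : ℝ) : ℂ)) * τ - ((v 1 : ℚ) : ℝ)) := by
    rw [← e_add_intCast (_ * τ - _) (-⌊v 0⌋ - 1)]
    congr 1
    push_cast [-Rat.cast_fract]
    rw [hfr]
    ring
  rw [h1, h2, h3]
  push_cast [-Rat.cast_fract]
  ring

lemma cosetLog_of_fract_zero {v : V} (hv : Int.fract (v 0) = 0) {τ : ℂ} (hτ : 0 < τ.im) :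
    cosetLog v τ = Real.pi * Complex.I * τ / 6 + Complex.log (1 - e (v 1)) +
      logQ (e τ) (e (τ + v 1)) + logQ (e τ) (e (τ - v 1)) := by
  rw [cosetLog, logSiegel, hv, logQ_eq_add (norm_e_lt_one hτ), ← e_add]
  push_cast [-Rat.cast_fract]
  simp only [zero_mul, zero_add, sub_zero, one_mul]
  ring

/-- For non-integral v₁ this is the inversion formula, the Dirac term correcting the convention
𝔹_1(0) = 0. For integral v₁ the formula is applied at -1/τ with first parameter 0, and the sign of
the other parameter is changed by `log_one_sub_e_sub`. -/
lemma cosetLog_S {v : V} (hv : ¬ IsInt v) {τ : ℂ} (hτ : 0 < τ.im) :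
    cosetLog ![v 1, -v 0] (-1 / τ) - cosetLog v τ = 2 * Real.pi * Complex.I *
      ((perB 1 (v 0) * perB 1 (v 1) +
        1 / 2 * (dirac (v 1) * perB 1 (-v 0) - dirac (v 0) * perB 1 (v 1)) : ℚ) : ℂ) := by
  have hτ0 : τ ≠ 0 := fun h => by simp [h] at hτ
  have hτ' := im_neg_one_div hτ
  have hfrneg : ∀ b : ℝ, logSiegel b (-(v 0 : ℚ) : ℝ) (-1 / τ) =
      logSiegel b (-((Int.fract (v 0) : ℚ) : ℝ)) (-1 / τ) := fun b => by
    rw [← logSiegel_add_int b (-((Int.fract (v 0) : ℚ) : ℝ)) (-⌊v 0⌋)]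
    congr 1
    have : ((v 0 : ℚ) : ℝ) = (Int.fract (v 0) : ℚ) + ⌊v 0⌋ := by
      rw [← Rat.cast_intCast, ← Rat.cast_add, Int.fract_add_floor]
    rw [this]
    push_cast [-Rat.cast_fract]
    ring
  have hfr1 : ∀ b τ, logSiegel b ((v 1 : ℚ) : ℝ) τ = logSiegel b ((Int.fract (v 1) : ℚ) : ℝ) τ :=
    fun b τ => by
      rw [← logSiegel_add_int b ((Int.fract (v 1) : ℚ) : ℝ) ⌊v 1⌋]
      congr 1
      rw [← Rat.cast_intCast, ← Rat.cast_add, Int.fract_add_floor]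
  have ha0 : (0 : ℝ) ≤ (Int.fract (v 0) : ℚ) := by exact_mod_cast Int.fract_nonneg (v 0)
  have ha1 : ((Int.fract (v 0) : ℚ) : ℝ) < 1 := by exact_mod_cast (Rat.cast_lt (K := ℝ)).mpr (Int.fract_lt_one (v 0))
  have hL : cosetLog ![v 1, -v 0] (-1 / τ) =
      logSiegel (Int.fract (v 1) : ℚ) (-((Int.fract (v 0) : ℚ) : ℝ)) (-1 / τ) := by
    rw [← hfrneg, cosetLog]
    push_cast [-Rat.cast_fract]
    rfl
  have hR : cosetLog v τ = logSiegel (Int.fract (v 0) : ℚ) (Int.fract (v 1) : ℚ) τ := by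
    rw [← hfr1, cosetLog]
  rw [hL, hR]
  by_cases hb : Int.fract (v 1) = 0
  · have ha : Int.fract (v 0) ≠ 0 := fun ha => by
      have h := (not_isInt_mem_siegelDom hv).2.2
      refine h (by rw [ha]; norm_num) ⌊v 1⌋ ?_
      have h2 := Int.fract_add_floor (v 1)
      rw [hb, zero_add] at h2
      change ((v 1 : ℚ) : ℝ) = _
      rw [← h2]
      simp
    have ha' : (0 : ℝ) < (Int.fract (v 0) : ℚ) := by
      exact_mod_cast lt_of_le_of_ne (Int.fract_nonneg (v 0)) (Ne.symm ha)
    have hneg : Int.fract (-v 0) = 1 - Int.fract (v 0) := Int.fract_neg ha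
    have hneg0 : Int.fract (-v 0) ≠ 0 := by
      rw [hneg]
      have := Int.fract_lt_one (v 0)
      linarith
    have key := logSiegel_inversion hτ' (a := 0) ⟨le_rfl, one_pos⟩ ⟨ha', ha1⟩
    have hinv : -1 / (-1 / τ) = τ := by field_simp
    rw [hinv, neg_zero] at key
    have hlog := log_one_sub_e_sub ⟨ha', ha1⟩
    have hq' := norm_e_lt_one hτ'
    have hdiff : logSiegel 0 (-((Int.fract (v 0) : ℚ) : ℝ)) (-1 / τ) -
        logSiegel 0 ((Int.fract (v 0) : ℚ) : ℝ) (-1 / τ) =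
        -(2 * Real.pi * Complex.I * ((((Int.fract (v 0) : ℚ) : ℝ) : ℂ) - 1 / 2)) := by
      rw [← hlog, logSiegel, logSiegel, logQ_eq_add hq' (e (((0 : ℝ) : ℂ) * _ + _)),
        logQ_eq_add hq' (e (((0 : ℝ) : ℂ) * _ + _)), ← e_add, ← e_add]
      push_cast [-Rat.cast_fract]
      simp only [zero_mul, zero_add, sub_zero, one_mul, sub_neg_eq_add, ← sub_eq_add_neg]
      ring_nf
    rw [hb, perB_one (v 0), perB_one (v 1), perB_one (-v 0), if_neg ha, if_pos hb, if_neg hneg0, hneg,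
      dirac, if_pos hb, dirac, if_neg ha]
    push_cast [-Rat.cast_fract] at key hdiff ⊢
    linear_combination hdiff - key
  · have hb' : (0 : ℝ) < (Int.fract (v 1) : ℚ) := by
      exact_mod_cast lt_of_le_of_ne (Int.fract_nonneg (v 1)) (Ne.symm hb)
    have hb1 : ((Int.fract (v 1) : ℚ) : ℝ) < 1 := by exact_mod_cast (Rat.cast_lt (K := ℝ)).mpr (Int.fract_lt_one (v 1))
    rw [logSiegel_inversion hτ ⟨ha0, ha1⟩ ⟨hb', hb1⟩, perB_one (v 1), if_neg hb, dirac, if_neg hb,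
      zero_mul, zero_sub, perB_one, dirac]
    by_cases ha : Int.fract (v 0) = 0
    · rw [if_pos ha, if_pos ha, ha]
      push_cast [-Rat.cast_fract]
      ring
    · rw [if_neg ha, if_neg ha]
      push_cast [-Rat.cast_fract]
      ring

/-! ### Holomorphic functions decaying at the cusp -/

lemma mem_OH_of_differentiableOn {F : ℂ → ℂ} (hF : DifferentiableOn ℂ F {z | 0 < z.im}) :
    (fun τ : ℍ => F τ) ∈ OH := by
  change MDifferentiable 𝓘(ℂ) 𝓘(ℂ) _
  rw [UpperHalfPlane.mdifferentiable_iff]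
  refine hF.congr fun z hz => ?_
  simp [ofComplex_apply_of_im_pos hz]

lemma differentiableOn_of_mem_OH (h : OH) :
    DifferentiableOn ℂ (h.1 ∘ ofComplex) {z | 0 < z.im} :=
  UpperHalfPlane.mdifferentiable_iff.mp h.2

lemma isOpen_im_pos : IsOpen {z : ℂ | 0 < z.im} := isOpen_lt continuous_const Complex.continuous_im

/-- The holomorphic functions which decay exponentially at `i∞`. -/
def decaying : AddSubgroup OH where
  carrier := {h | ∀ y₀ > 0, ∃ C : ℝ, ∃ κ > 0, ∀ τ : ℍ, y₀ ≤ τ.im →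
    ‖h.1 τ‖ ≤ C * Real.exp (-κ * τ.im)}
  zero_mem' := fun y₀ _ => ⟨0, 1, one_pos, fun τ _ => by simp⟩
  neg_mem' := fun {h} hh y₀ hy => by
    obtain ⟨C, κ, hκ, hC⟩ := hh y₀ hy
    refine ⟨C, κ, hκ, fun τ hτ => ?_⟩
    have : ‖(-h).1 τ‖ = ‖h.1 τ‖ := norm_neg (h.1 τ)
    rw [this]
    exact hC τ hτ
  add_mem' := fun {h k} hh hk y₀ hy => by
    obtain ⟨C, κ, hκ, hC⟩ := hh y₀ hy
    obtain ⟨D, μ, hμ, hD⟩ := hk y₀ hy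
    refine ⟨|C| + |D|, min κ μ, lt_min hκ hμ, fun τ hτ => ?_⟩
    have hle : ∀ (B ν : ℝ), min κ μ ≤ ν → B * Real.exp (-ν * τ.im) ≤
        |B| * Real.exp (-(min κ μ) * τ.im) := fun B ν hν => by
      refine mul_le_mul (le_abs_self B) (Real.exp_le_exp.mpr ?_) (Real.exp_pos _).le (abs_nonneg _)
      have := mul_le_mul_of_nonneg_right hν τ.im_pos.le
      linarith
    calc ‖(h + k).1 τ‖ ≤ ‖h.1 τ‖ + ‖k.1 τ‖ := norm_add_le _ _
      _ ≤ _ := add_le_add ((hC τ hτ).trans (hle C κ (min_le_left _ _)))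
        ((hD τ hτ).trans (hle D μ (min_le_right _ _)))
      _ = _ := by ring

/-- The logarithmic derivative of e^h is h', and h tends to 0 at i∞, so the fundamental theorem of
calculus returns h with no constant. -/
lemma integral_logDeriv_exp {h : OH} (hh : h ∈ decaying) (τ : ℍ) :
    -∫ t in Set.Ioi (0 : ℝ), logDeriv (fun z : ℂ => Complex.exp (h.1 (ofComplex z)))
      (τ + t * Complex.I) * Complex.I = h.1 τ := by
  set H : ℂ → ℂ := h.1 ∘ ofComplex with hH
  have hd : DifferentiableOn ℂ H {z | 0 < z.im} := differentiableOn_of_mem_OH h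
  have hpos := τ.im_pos
  have him : ∀ t : ℝ, 0 ≤ t → 0 < (τ + t * Complex.I : ℂ).im := fun t ht => by
    have : (τ + t * Complex.I : ℂ).im = τ.im + t := by simp
    rw [this]; linarith
  have hlog : ∀ z : ℂ, 0 < z.im →
      logDeriv (fun z : ℂ => Complex.exp (h.1 (ofComplex z))) z = deriv H z := fun z hz => by
    have h1 : HasDerivAt H (deriv H z) z :=
      (hd.differentiableAt (isOpen_im_pos.mem_nhds hz)).hasDerivAt
    have h2 : HasDerivAt (fun z => Complex.exp (h.1 (ofComplex z)))
      (Complex.exp (h.1 (ofComplex z)) * deriv H z) z := h1.cexp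
    rw [logDeriv_apply, h2.deriv, mul_div_cancel_left₀ _ (Complex.exp_ne_zero _)]
  have hline : ∀ t : ℝ, HasDerivAt (fun t : ℝ => (τ + t * Complex.I : ℂ)) Complex.I t := fun t => by
    simpa using ((Complex.ofRealCLM.hasDerivAt (x := t)).mul_const Complex.I).const_add (τ : ℂ)
  have hg : ∀ t : ℝ, 0 ≤ t → HasDerivAt (fun t : ℝ => H (τ + t * Complex.I))
      (deriv H (τ + t * Complex.I) * Complex.I) t := fun t ht =>
    ((hd.differentiableAt (isOpen_im_pos.mem_nhds (him t ht))).hasDerivAt).comp_of_eq t (hline t) rfl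
  -- Half the height leaves room for discs of radius Im(τ)/2 about every point of the half line.
  -- Cauchy's estimate on them bounds the derivative by a decaying exponential, whence
  -- integrability.
  obtain ⟨C, κ, hκ, hC⟩ := hh (τ.im / 2) (by positivity)
  have hbound : ∀ z : ℂ, τ.im / 2 ≤ z.im → ‖H z‖ ≤ C * Real.exp (-κ * z.im) := fun z hz => by
    have hz0 : 0 < z.im := lt_of_lt_of_le (by positivity) hz
    have h1 := hC ⟨z, hz0⟩ hz
    rw [hH, Function.comp_apply, ofComplex_apply_of_im_pos hz0]
    exact h1
  have hC0 : 0 ≤ C := by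
    have h1 := (norm_nonneg _).trans (hbound τ (by linarith [show (τ : ℂ).im = τ.im from rfl]))
    exact nonneg_of_mul_nonneg_left h1 (Real.exp_pos _)
  have hderiv : ∀ t : ℝ, 0 ≤ t → ‖deriv H (τ + t * Complex.I) * Complex.I‖ ≤
      (C * Real.exp (-κ * (τ.im / 2)) / (τ.im / 2)) * Real.exp (-κ * t) := fun t ht => by
    have hsub : Metric.closedBall (τ + t * Complex.I : ℂ) (τ.im / 2) ⊆
        {z | τ.im / 2 + t ≤ z.im} := fun z hz => by
      have h1 := (Complex.abs_im_le_norm (z - (τ + t * Complex.I))).trans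
        (mem_closedBall_iff_norm.mp hz)
      have h2 : (z - (τ + t * Complex.I)).im = z.im - τ.im - t := by simp; ring
      rw [h2] at h1
      have := (abs_le.mp h1).1
      change _ ≤ z.im
      linarith
    have hdc : DiffContOnCl ℂ H (Metric.ball (τ + t * Complex.I : ℂ) (τ.im / 2)) := by
      refine DifferentiableOn.diffContOnCl_ball (U := {z | 0 < z.im}) hd fun z hz => ?_
      have h1 : τ.im / 2 + t ≤ z.im := hsub hz
      change 0 < z.im
      linarith
    have := Complex.norm_deriv_le_of_forall_mem_sphere_norm_le (by positivity : 0 < τ.im / 2) hdc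
      (C := C * Real.exp (-κ * (τ.im / 2 + t))) fun z hz => by
        have h1 : τ.im / 2 + t ≤ z.im := hsub (Metric.sphere_subset_closedBall hz)
        refine (hbound z (by linarith)).trans (mul_le_mul_of_nonneg_left ?_ hC0)
        have := mul_le_mul_of_nonneg_left h1 hκ.le
        exact Real.exp_le_exp.mpr (by linarith)
    rw [norm_mul, Complex.norm_I, mul_one]
    refine this.trans (le_of_eq ?_)
    rw [mul_add, Real.exp_add]
    ring
  have hcont : ContinuousOn (fun t : ℝ => deriv H (τ + t * Complex.I) * Complex.I) (Set.Ici 0) := by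
    refine ContinuousOn.mul (((hd.deriv isOpen_im_pos).continuousOn).comp ?_ fun t ht => him t ht)
      continuousOn_const
    fun_prop
  have hint : MeasureTheory.IntegrableOn
      (fun t : ℝ => deriv H (τ + t * Complex.I) * Complex.I) (Set.Ioi 0) := by
    refine MeasureTheory.Integrable.mono' ((exp_neg_integrableOn_Ioi 0 hκ).const_mul
      (C * Real.exp (-κ * (τ.im / 2)) / (τ.im / 2)))
      ((hcont.mono Set.Ioi_subset_Ici_self).aestronglyMeasurable measurableSet_Ioi) ?_
    filter_upwards [MeasureTheory.ae_restrict_mem measurableSet_Ioi] with t ht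
    exact hderiv t (le_of_lt ht)
  have hlim : Tendsto (fun t : ℝ => H (τ + t * Complex.I)) atTop (nhds 0) := by
    have h1 : Tendsto (fun t : ℝ => C * Real.exp (-κ * (τ.im + t))) atTop (nhds 0) := by
      have h2 : Tendsto (fun t : ℝ => -κ * (τ.im + t)) atTop atBot :=
        (tendsto_atTop_add_const_left atTop τ.im tendsto_id).const_mul_atTop_of_neg (neg_lt_zero.mpr hκ)
      simpa using (Real.tendsto_exp_atBot.comp h2).const_mul C
    refine squeeze_zero_norm' ?_ h1
    filter_upwards [eventually_ge_atTop 0] with t ht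
    have h3 : (τ + t * Complex.I : ℂ).im = τ.im + t := by simp
    have h2 := hbound (τ + t * Complex.I) (by rw [h3]; linarith)
    rwa [h3] at h2
  have key := MeasureTheory.integral_Ioi_of_hasDerivAt_of_tendsto (hg 0 le_rfl).continuousAt.continuousWithinAt
    (fun t ht => hg t (le_of_lt ht)) hint hlim
  rw [MeasureTheory.setIntegral_congr_fun measurableSet_Ioi
    (g := fun t : ℝ => deriv H (τ + t * Complex.I) * Complex.I) fun t ht => by
      simp only [hlog _ (him t (le_of_lt ht))], key]
  simp [hH]

/-! ### The logarithm of the theta unit -/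

lemma e_pow_mul_e (n : ℕ) (α b τ : ℂ) : e τ ^ n * e (α * τ + b) = e ((n + α) * τ + b) := by
  rw [← e_natCast_mul, ← e_add]
  ring_nf

lemma norm_e_tail (n : ℕ) (α b : ℝ) (τ : ℂ) : ‖e τ ^ n * e (α * τ + b)‖ =
    Real.exp (-(2 * Real.pi * τ.im)) ^ n * Real.exp (-(2 * Real.pi * (α * τ.im))) := by
  rw [norm_mul, norm_pow, norm_e, norm_e]
  simp

/-- The bound is geometric in n and keeps the exponential in Im τ. The first gives holomorphy of the
sum by the M-test, the second its decay at i∞. -/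
lemma norm_log_tail_le {α : ℝ} (hα : 0 < α) (b : ℝ) {y₀ : ℝ} (hy : 0 < y₀) (n : ℕ) {τ : ℂ}
    (hτ : y₀ ≤ τ.im) : ‖Complex.log (1 - e τ ^ n * e (α * τ + b))‖ ≤
      (1 - Real.exp (-(2 * Real.pi * (α * y₀))))⁻¹ *
        (Real.exp (-(2 * Real.pi * y₀)) ^ n * Real.exp (-(2 * Real.pi * (α * τ.im)))) := by
  have hπ := Real.pi_pos
  have hr : Real.exp (-(2 * Real.pi * (α * y₀))) < 1 := by
    rw [Real.exp_lt_one_iff]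
    have : 0 < 2 * Real.pi * (α * y₀) := by positivity
    linarith
  have h1 : Real.exp (-(2 * Real.pi * τ.im)) ≤ Real.exp (-(2 * Real.pi * y₀)) := by
    gcongr
  have h2 : Real.exp (-(2 * Real.pi * (α * τ.im))) ≤ Real.exp (-(2 * Real.pi * (α * y₀))) := by
    gcongr
  have h3 : Real.exp (-(2 * Real.pi * τ.im)) ^ n ≤ 1 := by
    refine pow_le_one₀ (Real.exp_pos _).le (Real.exp_le_one_iff.mpr ?_)
    have : 0 < 2 * Real.pi * τ.im := by have := hy.trans_le hτ; positivity
    linarith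
  refine (norm_log_one_sub_le hr ?_).trans ?_
  · rw [norm_e_tail]
    exact (mul_le_of_le_one_left (Real.exp_pos _).le h3).trans h2
  · rw [norm_e_tail]
    have h4 : 0 ≤ (1 - Real.exp (-(2 * Real.pi * (α * y₀))))⁻¹ := inv_nonneg.mpr (by linarith)
    gcongr

lemma exp_neg_two_pi_lt_one {y₀ : ℝ} (hy : 0 < y₀) : Real.exp (-(2 * Real.pi * y₀)) < 1 := by
  rw [Real.exp_lt_one_iff]
  have : 0 < 2 * Real.pi * y₀ := by have := Real.pi_pos; positivity
  linarith

lemma differentiableOn_tail {α : ℝ} (hα : 0 < α) (b : ℝ) :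
    DifferentiableOn ℂ (fun τ => logQ (e τ) (e (α * τ + b))) {z | 0 < z.im} := by
  intro τ hτ
  have hy : 0 < τ.im / 2 := half_pos hτ
  have hopen : IsOpen {z : ℂ | τ.im / 2 < z.im} := isOpen_lt continuous_const Complex.continuous_im
  have hd : DifferentiableOn ℂ (fun τ => logQ (e τ) (e (α * τ + b))) {z | τ.im / 2 < z.im} := by
    refine Complex.differentiableOn_tsum_of_summable_norm (u := fun n =>
      (1 - Real.exp (-(2 * Real.pi * (α * (τ.im / 2)))))⁻¹ *
        (Real.exp (-(2 * Real.pi * (τ.im / 2))) ^ n * 1)) ?_ ?_ hopen ?_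
    · refine Summable.mul_left _ (Summable.mul_right _ ?_)
      exact summable_geometric_of_lt_one (Real.exp_pos _).le (exp_neg_two_pi_lt_one hy)
    · intro n z hz
      have hz' : 0 < z.im := hy.trans hz
      have h1 : ‖e z ^ n * e (α * z + b)‖ < 1 := by
        rw [norm_e_tail]
        refine mul_lt_one_of_nonneg_of_lt_one_right ?_ (Real.exp_pos _).le
          (exp_neg_two_pi_lt_one (mul_pos hα hz'))
        exact pow_le_one₀ (Real.exp_pos _).le (exp_neg_two_pi_lt_one hz').le
      refine DifferentiableAt.differentiableWithinAt (DifferentiableAt.clog ?_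
        (one_sub_mem_slitPlane h1.le (ne_one_of_norm_lt h1)))
      have := differentiable_e
      fun_prop
    · intro n z hz
      have hz' : 0 < z.im := hy.trans hz
      refine (norm_log_tail_le hα b hy n (le_of_lt hz)).trans ?_
      have h4 : 0 ≤ (1 - Real.exp (-(2 * Real.pi * (α * (τ.im / 2)))))⁻¹ :=
        inv_nonneg.mpr (by linarith [exp_neg_two_pi_lt_one (mul_pos hα hy)])
      have h5 := (exp_neg_two_pi_lt_one (mul_pos hα hz')).le
      gcongr
  exact (hd.differentiableAt (hopen.mem_nhds (by change τ.im / 2 < τ.im; linarith [show 0 < τ.im from hτ]))).differentiableWithinAt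

/-- The holomorphic function `τ ↦ ∑ₙ log(1 - e((n + α)τ + b))`. -/
def tail {α : ℝ} (hα : 0 < α) (b : ℝ) : OH :=
  ⟨fun τ => logQ (e τ) (e (α * τ + b)), mem_OH_of_differentiableOn (differentiableOn_tail hα b)⟩

lemma tail_mem_decaying {α : ℝ} (hα : 0 < α) (b : ℝ) : tail hα b ∈ decaying := by
  intro y₀ hy
  have hπ := Real.pi_pos
  have hgeo := hasSum_geometric_of_lt_one (Real.exp_pos (-(2 * Real.pi * y₀))).le
    (exp_neg_two_pi_lt_one hy)
  refine ⟨(1 - Real.exp (-(2 * Real.pi * (α * y₀))))⁻¹ * (1 - Real.exp (-(2 * Real.pi * y₀)))⁻¹,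
    2 * Real.pi * α, by positivity, fun τ hτ => ?_⟩
  have h1 := (hgeo.mul_right (Real.exp (-(2 * Real.pi * (α * τ.im))))).mul_left
    (1 - Real.exp (-(2 * Real.pi * (α * y₀))))⁻¹
  have h2 : Real.exp (-(2 * Real.pi * α) * τ.im) = Real.exp (-(2 * Real.pi * (α * τ.im))) := by
    ring_nf
  rw [h2, mul_assoc]
  exact tsum_of_norm_bounded h1 fun n => norm_log_tail_le hα b hy n hτ

/-- If α ∈ (0,1] represents x modulo 1, then the positive elements of x + ℤ are exactly the numbers
α + n with n ≥ 0. -/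
lemma tprod_arith {α x : ℚ} (h0 : 0 < α) (h1 : α ≤ 1) (hx : ∃ k : ℤ, x = α + k) (φ : ℚ → ℂ) :
    ∏' y : {y : ℚ // 0 < y ∧ ∃ k : ℤ, y = x + k}, φ y.1 = ∏' n : ℕ, φ (α + n) := by
  obtain ⟨k, rfl⟩ := hx
  let F : ℕ → {y : ℚ // 0 < y ∧ ∃ l : ℤ, y = α + k + l} := fun n =>
    ⟨α + n, by positivity, n - k, by push_cast; ring_nf⟩
  have hF : Function.Bijective F := by
    refine ⟨fun m n h => ?_, ?_⟩
    · have h' : α + (m : ℚ) = α + n := congrArg Subtype.val h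
      exact_mod_cast add_left_cancel h'
    · rintro ⟨y, hy, l, rfl⟩
      have h2 : (-1 : ℚ) < ((k + l : ℤ) : ℚ) := by push_cast; linarith
      have h3 : 0 ≤ k + l := by
        have : (-1 : ℤ) < k + l := by exact_mod_cast h2
        omega
      obtain ⟨n, hn⟩ := Int.eq_ofNat_of_zero_le h3
      refine ⟨n, Subtype.ext ?_⟩
      have h4 : ((k + l : ℤ) : ℚ) = (n : ℤ) := by rw [hn]
      push_cast at h4
      change α + (n : ℚ) = α + k + l
      rw [← h4]; ring
  exact ((Equiv.ofBijective F hF).tprod_eq (fun y => φ y.1)).symm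

/-- The representative in `(0, 1]` of a class in `ℚ/ℤ`. -/
def fractPos (x : ℚ) : ℚ := if Int.fract x = 0 then 1 else Int.fract x

lemma fractPos_pos (x : ℚ) : 0 < fractPos x := by
  unfold fractPos
  split_ifs with h
  · exact one_pos
  · exact lt_of_le_of_ne (Int.fract_nonneg x) (Ne.symm h)

lemma fractPos_le_one (x : ℚ) : fractPos x ≤ 1 := by
  unfold fractPos
  split_ifs with h
  · exact le_rfl
  · exact (Int.fract_lt_one x).le

lemma eq_fractPos_add (x : ℚ) : ∃ k : ℤ, x = fractPos x + k := by
  have h1 := Int.fract_add_floor x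
  unfold fractPos
  split_ifs with h
  · refine ⟨⌊x⌋ - 1, ?_⟩
    rw [h] at h1
    push_cast
    linarith
  · exact ⟨⌊x⌋, h1.symm⟩

lemma fractPos_cast_pos (x : ℚ) : (0 : ℝ) < fractPos x := by exact_mod_cast fractPos_pos x

lemma one_sub_fract_cast_pos (x : ℚ) : (0 : ℝ) < (1 - Int.fract x : ℚ) :=
  Rat.cast_pos.mpr (by linarith [Int.fract_lt_one x])

/-- The logarithm of the value at the coset of `v` of the theta-unit distribution. -/
def thetaLog (v : V) : OH :=
  tail (fractPos_cast_pos (v 0)) (v 1) + tail (one_sub_fract_cast_pos (v 0)) (-(v 1 : ℝ))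

lemma thetaLog_mem_decaying (v : V) : thetaLog v ∈ decaying :=
  add_mem (tail_mem_decaying _ _) (tail_mem_decaying _ _)

lemma exp_tail {α : ℝ} (hα : 0 < α) (b : ℝ) (τ : ℍ) :
    Complex.exp ((tail hα b).1 τ) = ∏' n : ℕ, (1 - e ((n + α) * τ + b)) := by
  have h1 : ‖e (α * τ + b)‖ < 1 := norm_e_lt_one (by
    have : (α * τ + b : ℂ).im = α * τ.im := by simp
    rw [this]
    exact mul_pos hα τ.im_pos)
  change Complex.exp (logQ (e τ) (e (α * τ + b))) = _
  rw [exp_logQ (norm_e_lt_one τ.im_pos) h1.le (ne_one_of_norm_lt h1), prodQ]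
  simp only [e_pow_mul_e]

lemma exp_thetaLog (v : V) (τ : ℍ) : Complex.exp ((thetaLog v).1 τ) = thetaUnit τ v := by
  have h0 : (thetaLog v).1 τ = (tail (fractPos_cast_pos (v 0)) (v 1)).1 τ +
    (tail (one_sub_fract_cast_pos (v 0)) (-(v 1 : ℝ))).1 τ := rfl
  rw [h0, Complex.exp_add, exp_tail, exp_tail, thetaUnit]
  congr 1
  · rw [tprod_arith (fractPos_pos _) (fractPos_le_one _) (eq_fractPos_add _)
      fun y => 1 - e (y * τ + v 1)]
    refine tprod_congr fun n => ?_
    push_cast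
    ring_nf
  -- After y ↦ -y the second product runs over the positive elements of -v₀ + ℤ, of which 1 - ⟨v₀⟩
  -- is the least.
  · have hneg : ∃ k : ℤ, -v 0 = (1 - Int.fract (v 0)) + k := by
      refine ⟨-1 - ⌊v 0⌋, ?_⟩
      have := Int.fract_add_floor (v 0)
      push_cast
      linarith
    have h1 := tprod_arith (by linarith [Int.fract_lt_one (v 0)])
      (by linarith [Int.fract_nonneg (v 0)]) hneg fun y => 1 - e (y * τ - v 1)
    let N : {y : ℚ // y < 0 ∧ ∃ k : ℤ, y = v 0 + k} ≃ {y : ℚ // 0 < y ∧ ∃ k : ℤ, y = -v 0 + k} :=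
      (Equiv.neg ℚ).subtypeEquiv fun y => by
        refine and_congr (by simp) ⟨fun ⟨k, hk⟩ => ⟨-k, ?_⟩, fun ⟨k, hk⟩ => ⟨-k, ?_⟩⟩
        · rw [Equiv.neg_apply, hk]; push_cast; ring
        · rw [Equiv.neg_apply] at hk
          rw [← neg_neg y, hk]; push_cast; ring
    have h2 : ∏' y : {y : ℚ // y < 0 ∧ ∃ k : ℤ, y = v 0 + k}, (1 - e (-y.1 * τ - v 1)) =
        ∏' y : {y : ℚ // 0 < y ∧ ∃ k : ℤ, y = -v 0 + k}, (1 - e (y.1 * τ - v 1)) := by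
      rw [← N.tprod_eq]
      refine tprod_congr fun y => ?_
      have : (N y).1 = -y.1 := rfl
      rw [this]
      push_cast
      rfl
    rw [h2, h1]
    refine tprod_congr fun n => ?_
    push_cast [-Rat.cast_fract]
    ring_nf

/-- The product defining u omits y = 0. For integral v₀ the omitted factor is constant in τ and
gives the Clog term; otherwise nothing is omitted. The three summands correspond to three terms of
Ẽ. -/
lemma cosetLog_eq_thetaLog (v : V) (τ : ℍ) : cosetLog v τ =
    Real.pi * Complex.I * τ * (perB 2 (v 0) : ℚ) + (dirac (v 0) : ℂ) * clog (v 1) +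
      (thetaLog v).1 τ := by
  have h0 : (thetaLog v).1 τ = logQ (e τ) (e (((fractPos (v 0) : ℚ) : ℝ) * τ + ((v 1 : ℚ) : ℝ))) +
    logQ (e τ) (e (((1 - Int.fract (v 0) : ℚ) : ℝ) * τ + (-(v 1 : ℝ) : ℝ))) := rfl
  rw [h0, perB_two, dirac, fractPos]
  by_cases h : Int.fract (v 0) = 0
  · rw [cosetLog_of_fract_zero h τ.im_pos, if_pos h, if_pos h, h, clog]
    push_cast
    simp only [one_mul, sub_eq_add_neg]
    ring_nf
  · rw [if_neg h, if_neg h, cosetLog, logSiegel]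
    push_cast [-Rat.cast_fract]
    simp only [zero_mul, sub_eq_add_neg]
    ring

/-- The logarithm of the Siegel function of a coset, as a holomorphic function. -/
def cosetLogO (v : V) : OH :=
  ⟨fun τ => cosetLog v τ, by
    simp only [cosetLog_eq_thetaLog]
    refine OH.add_mem (mem_OH_of_differentiableOn (F := fun τ => Real.pi * Complex.I * τ *
      (perB 2 (v 0) : ℚ) + (dirac (v 0) : ℂ) * clog (v 1)) ?_) (thetaLog v).2
    fun_prop⟩

/-! ### The distribution `Ẽ` -/

/-- The constant functions in `𝒪_ℋ`. -/
def constOH : ℂ →+* OH where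
  toFun z := ⟨fun _ => z, mdifferentiable_const⟩
  map_one' := rfl
  map_mul' _ _ := rfl
  map_zero' := rfl
  map_add' _ _ := rfl

/-- Evaluation at `τ`. -/
def evalOH (τ : ℍ) : OH →+ ℂ where
  toFun h := h.1 τ
  map_zero' := rfl
  map_add' _ _ := rfl

lemma OH_ext {h k : OH} (hk : ∀ τ, h.1 τ = k.1 τ) : h = k := Subtype.ext (funext hk)

lemma cosetDist_add_three {c : ℕ} {A : Type} [AddCommGroup A] (σ₁ σ₂ σ₃ : V → A) (f : Test' (primesOf c)) :
    cosetDist (fun v => σ₁ v + σ₂ v + σ₃ v) f =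
      cosetDist σ₁ f + cosetDist σ₂ f + cosetDist σ₃ f := by
  rw [cosetDist_fun_add (fun v => σ₁ v + σ₂ v), cosetDist_fun_add]

lemma cosetDist_mem {c : ℕ} {A : Type} [AddCommGroup A] {K : AddSubgroup A} {σ : V → A} (h : ∀ v, σ v ∈ K)
    (f : Test' (primesOf c)) : cosetDist σ f ∈ K := by
  obtain ⟨n, hn0, -, hf⟩ := exists_level f.2.1
  rw [cosetDist_eq_sum_period _ hn0 hf]
  exact sum_mem fun i _ => zsmul_mem (h _) _

/-- `f ↦ f ∣ g` as a homomorphism. -/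
def slashHom {S : Set Nat.Primes} (g : GL (Fin 2) ℚ) : Test' S →+ Test' S :=
  AddMonoidHom.mk' (fun f => slash f g) fun f f' => slash_add f f' g

/-- `μ ↦ μ_c`. -/
def smoothHom (c : ℕ) [NeZero c] {S : Set Nat.Primes} {A : Type} [AddCommGroup A] (μ : Dist S A) :
    Dist S A := ((c : ℤ) ^ 2) • μ - μ.comp (slashHom (scalarD c))

lemma smoothHom_apply (c : ℕ) [NeZero c] {S : Set Nat.Primes} {A : Type} [AddCommGroup A]
    (μ : Dist S A) (f : Test' S) :
    smoothHom c μ f = ((c : ℤ) ^ 2) • μ f - μ (slash f (scalarD c)) := rfl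

lemma cosetLogO_cosetFun : IsCosetFun cosetLogO := fun v w =>
  OH_ext fun τ => cosetLog_add_int v w τ

lemma isDistRel_cosetLogO (c : ℕ) : IsDistRel c cosetLogO := by
  intro N hN _ v _ hv
  refine OH_ext fun τ => ?_
  have h1 : (∑ s ∈ grid N, cosetLogO fun k => (v k + s k) / N).1 τ =
      ∑ s ∈ grid N, cosetLog (fun k => (v k + s k) / N) τ := map_sum (evalOH τ) _ _
  have hNτ : (N * τ / N : ℂ) = τ := mul_div_cancel_left₀ _ (by exact_mod_cast hN.ne')
  have h2 := sum_cosetLog hN hN hv τ.im_pos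
  rw [hNτ] at h2
  rw [h1]
  simp only [divVec_self]
  rw [sum_grid N fun s t => cosetLog (divVec N N v s t) τ, h2]
  rfl

/-- The distribution given by the logarithms of Siegel functions. -/
def siegelDist (c : ℕ) : Dist (primesOf c) OH := cosetHom cosetLogO (isDistRel_cosetLogO c)

/-- `𝔹_2 ⊗ 𝔹_0`. -/
def distB2 (c : ℕ) : Dist (primesOf c) ℚ := cosetHom _ (isDistRel_B2B0 c)

/-- `𝔹_1 ⊗ 𝔹_1`. -/
def distBB (c : ℕ) : Dist (primesOf c) ℚ := cosetHom _ (isDistRel_B1B1 c)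

/-- `δ₀ ⊗ 𝔹_1`. -/
def distDB (c : ℕ) : Dist (primesOf c) ℚ := cosetHom _ (isDistRel_diracB1 c)

/-- `π_c`. -/
def distPi (c : ℕ) : Dist (primesOf c) ℚ := cosetHom _ (isDistRel_piCval c)

section Distribution

variable (c : ℕ)

lemma siegelDist_apply (f : Test' (primesOf c)) (τ : ℍ) :
    (siegelDist c f).1 τ = Real.pi * Complex.I * τ * (distB2 c f : ℚ) +
      cosetDist (fun v => (dirac (v 0) : ℂ) * clog (v 1)) f + (cosetDist thetaLog f).1 τ := by
  have h1 : (siegelDist c f).1 τ = cosetDist (fun v => cosetLog v τ) f :=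
    map_cosetDist (evalOH τ) cosetLogO f
  have h2 : (cosetDist thetaLog f).1 τ = cosetDist (fun v => (thetaLog v).1 τ) f :=
    map_cosetDist (evalOH τ) thetaLog f
  have h3 : Real.pi * Complex.I * τ * ((distB2 c f : ℚ) : ℂ) =
      cosetDist (fun v => Real.pi * Complex.I * τ * (perB 2 (v 0) : ℚ)) f := by
    have := map_cosetDist ((AddMonoidHom.mulLeft (Real.pi * Complex.I * τ : ℂ)).comp
      (Rat.castHom ℂ).toAddMonoidHom) (fun v => perB 2 (v 0) * perB 0 (v 1)) f
    simp only [perB_zero, mul_one] at this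
    refine Eq.trans ?_ this
    simp only [distB2, perB_zero, mul_one]
    rfl
  rw [h1, h2, h3, ← cosetDist_add_three]
  simp only [cosetLog_eq_thetaLog]

variable [NeZero c]

/-- `Ψ`. -/
def distPsi : Dist (primesOf c) ℚ :=
  distPi c + (AddMonoidHom.mulLeft (1 / 2 : ℚ)).comp (smoothHom c (distDB c))

/-- The distribution `Ẽ`. -/
def distE : Dist (primesOf c) OH :=
  ((constOH.toAddMonoidHom.comp (Rat.castHom ℂ).toAddMonoidHom).comp (distPi c)) +
    (AddMonoidHom.mulLeft (constOH (1 / (2 * Real.pi * Complex.I)))).comp (smoothHom c (siegelDist c))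

lemma distE_apply (f : Test' (primesOf c)) : distE c f = constOH (distPi c f : ℚ) +
    constOH (1 / (2 * Real.pi * Complex.I)) * smoothHom c (siegelDist c) f := rfl

lemma uC_eq (f : Test' (primesOf c)) (τ : ℍ) : uC c f τ =
    Complex.exp ((smooth c (cosetDist thetaLog) f : OH).1 τ) := by
  have h1 : ∀ f : Test' (primesOf c), cosetDistMul (thetaUnit τ) f =
      Complex.exp ((cosetDist thetaLog f).1 τ) := fun f => by
    have h2 : (cosetDist thetaLog f).1 τ = cosetDist (fun v => (thetaLog v).1 τ) f :=
      map_cosetDist (evalOH τ) thetaLog f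
    rw [h2, ← cosetDistMul_exp]
    simp only [exp_thetaLog]
  have h3 : (smooth c (cosetDist thetaLog) f : OH).1 τ = (c : ℂ) ^ 2 * (cosetDist thetaLog f).1 τ -
      (cosetDist thetaLog (slash f (scalarD c))).1 τ := by
    have : (smooth c (cosetDist thetaLog) f : OH).1 τ = evalOH τ (smooth c (cosetDist thetaLog) f) := rfl
    rw [this, smooth, map_sub, map_zsmul, zsmul_eq_mul]
    push_cast
    rfl
  rw [uC, h1, h1, h3, Complex.exp_sub, ← Complex.exp_nat_mul]
  push_cast
  rfl

lemma dlogIntegral_eq (f : Test' (primesOf c)) (τ : ℍ) :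
    dlogIntegral c f τ = (smooth c (cosetDist thetaLog) f : OH).1 τ := by
  have h : (smooth c (cosetDist thetaLog) f : OH) ∈ decaying := by
    rw [smooth]
    exact sub_mem (zsmul_mem (cosetDist_mem thetaLog_mem_decaying f) _)
      (cosetDist_mem thetaLog_mem_decaying _)
  rw [← integral_logDeriv_exp h τ, dlogIntegral]
  simp only [uC_eq]

lemma distE_apply_eq (f : Test' (primesOf c)) (τ : ℍ) :
    (distE c f).1 τ = (distPi c f : ℚ) + 1 / (2 * Real.pi * Complex.I) *
      ((c : ℂ) ^ 2 * (siegelDist c f).1 τ - (siegelDist c (slash f (scalarD c))).1 τ) := by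
  have h2 : (smoothHom c (siegelDist c) f).1 τ = (c : ℂ) ^ 2 * (siegelDist c f).1 τ -
      (siegelDist c (slash f (scalarD c))).1 τ := by
    have : (smoothHom c (siegelDist c) f).1 τ = evalOH τ (smoothHom c (siegelDist c) f) := rfl
    rw [this, smoothHom_apply, map_sub, map_zsmul, zsmul_eq_mul]
    push_cast
    rfl
  rw [← h2]
  rfl

/-- Combines the splitting of `cosetLog` with the fact that the integral from i∞ is the smoothed
decaying logarithm itself. -/
lemma distE_eq_Etilde (f : Test' (primesOf c)) (τ : ℍ) : (distE c f).1 τ = Etilde c f τ := by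
  have h3 : (smooth c (cosetDist thetaLog) f : OH).1 τ = (c : ℂ) ^ 2 * (cosetDist thetaLog f).1 τ -
      (cosetDist thetaLog (slash f (scalarD c))).1 τ := by
    have : (smooth c (cosetDist thetaLog) f : OH).1 τ = evalOH τ (smooth c (cosetDist thetaLog) f) := rfl
    rw [this, smooth, map_sub, map_zsmul, zsmul_eq_mul]
    push_cast
    rfl
  have h4 : (B2B0 c f : ℂ) = (c : ℂ) ^ 2 * (distB2 c f : ℚ) - (distB2 c (slash f (scalarD c)) : ℚ) := by
    have : B2B0 c f = (c : ℚ) ^ 2 * distB2 c f - distB2 c (slash f (scalarD c)) := by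
      rw [B2B0, smooth, zsmul_eq_mul]
      push_cast
      rfl
    rw [this]
    push_cast
    rfl
  have h5 : diracClog c f = (c : ℂ) ^ 2 * cosetDist (fun v => (dirac (v 0) : ℂ) * clog (v 1)) f -
      cosetDist (fun v => (dirac (v 0) : ℂ) * clog (v 1)) (slash f (scalarD c)) := by
    rw [diracClog, smooth, zsmul_eq_mul]
    push_cast
    rfl
  have h6 : piC c f = distPi c f := rfl
  rw [Etilde, dlogIntegral_eq, distE_apply_eq, h3, h4, h5, h6, siegelDist_apply, siegelDist_apply]
  have hπ : (Real.pi : ℂ) ≠ 0 := by exact_mod_cast Real.pi_ne_zero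
  have hI := Complex.I_ne_zero
  field_simp
  ring

end Distribution

/-! ### The action on cosets -/

lemma toGLQ_ofSL (S : Set Nat.Primes) (g : SL(2, ℤ)) (i j : Fin 2) :
    (toGLQ S (ofSL S g)) i j = (g i j : ℚ) := by
  simp [toGLQ, ofSL]

lemma norm_locMat_ofSL (S : Set Nat.Primes) (g : SL(2, ℤ)) (p : ℕ) [Fact p.Prime] (i j : Fin 2) :
    ‖locMat p (toGLQ S (ofSL S g)) i j‖ ≤ 1 := by
  have : locMat p (toGLQ S (ofSL S g)) i j = ((g i j : ℤ) : ℚ_[p]) := by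
    simp [locMat, toGLQ_ofSL]
  rw [this]
  exact Padic.norm_int_le_one _

lemma vecMul_two (v : V) (M : Matrix (Fin 2) (Fin 2) ℚ) (k : Fin 2) :
    Matrix.vecMul v M k = v 0 * M 0 k + v 1 * M 1 k := by
  simp [Matrix.vecMul, dotProduct, Fin.sum_univ_two]

lemma T_mem {c : ℕ} {v : V} (hS : ∀ i, v i ∈ ZS (primesOf c)) (i : Fin 2) :
    (![v 0, v 0 + v 1] : V) i ∈ ZS (primesOf c) := by
  fin_cases i
  · exact hS 0
  · exact (ZS _).add_mem (hS 0) (hS 1)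

lemma T_not_isInt {v : V} (hv : ¬ IsInt v) : ¬ IsInt ![v 0, v 0 + v 1] := fun ⟨w, hw⟩ => by
  have h0 : v 0 = w 0 := congrFun hw 0
  have h1 : v 0 + v 1 = w 1 := congrFun hw 1
  refine hv ⟨![w 0, w 1 - w 0], funext fun k => ?_⟩
  fin_cases k
  · exact h0
  · change v 1 = ((w 1 - w 0 : ℤ) : ℚ)
    push_cast
    linarith

lemma S_mem {c : ℕ} {v : V} (hS : ∀ i, v i ∈ ZS (primesOf c)) (i : Fin 2) :
    (![v 1, -v 0] : V) i ∈ ZS (primesOf c) := by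
  fin_cases i
  · exact hS 1
  · exact (ZS _).neg_mem (hS 0)

lemma S_not_isInt {v : V} (hv : ¬ IsInt v) : ¬ IsInt ![v 1, -v 0] := fun ⟨w, hw⟩ => by
  have h0 : v 1 = w 0 := congrFun hw 0
  have h1 : -v 0 = w 1 := congrFun hw 1
  refine hv ⟨![-w 1, w 0], funext fun k => ?_⟩
  fin_cases k
  · change v 0 = ((-w 1 : ℤ) : ℚ)
    push_cast
    linarith
  · exact h0

lemma slash_T {c : ℕ} {v : V} (hS : ∀ i, v i ∈ ZS (primesOf c)) (hv : ¬ IsInt v) (n : ℕ)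
    [NeZero n] :
    slash (slash (cosetTest (primesOf c) v hS hv) (scalarD n)) (toGLQ _ (matT (primesOf c))) =
      slash (cosetTest (primesOf c) ![v 0, v 0 + v 1] (T_mem hS) (T_not_isInt hv)) (scalarD n) := by
  have h : slash (cosetTest (primesOf c) v hS hv) (toGLQ _ (matT (primesOf c))) =
      cosetTest (primesOf c) ![v 0, v 0 + v 1] (T_mem hS) (T_not_isInt hv) := by
    refine slash_cosetTest (fun p => norm_locMat_ofSL _ _ _) (fun p => ?_) ?_ hS hv _ _
    · rw [← map_inv, ← map_inv]
      exact norm_locMat_ofSL _ _ _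
    · funext k
      rw [vecMul_two, toGLQ_ofSL, toGLQ_ofSL]
      fin_cases k <;> simp [ModularGroup.T]
  rw [slash_scalarD_comm, h]

lemma slash_S {c : ℕ} {v : V} (hS : ∀ i, v i ∈ ZS (primesOf c)) (hv : ¬ IsInt v) (n : ℕ)
    [NeZero n] :
    slash (slash (cosetTest (primesOf c) v hS hv) (scalarD n)) (toGLQ _ (matS (primesOf c))) =
      slash (cosetTest (primesOf c) ![v 1, -v 0] (S_mem hS) (S_not_isInt hv)) (scalarD n) := by
  have h : slash (cosetTest (primesOf c) v hS hv) (toGLQ _ (matS (primesOf c))) =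
      cosetTest (primesOf c) ![v 1, -v 0] (S_mem hS) (S_not_isInt hv) := by
    refine slash_cosetTest (fun p => norm_locMat_ofSL _ _ _) (fun p => ?_) ?_ hS hv _ _
    · rw [← map_inv, ← map_inv]
      exact norm_locMat_ofSL _ _ _
    · funext k
      rw [vecMul_two, toGLQ_ofSL, toGLQ_ofSL]
      fin_cases k <;> simp [ModularGroup.S]
  rw [slash_scalarD_comm, h]

lemma norm_natCast_off {c : ℕ} (p : Off (primesOf c)) : ‖(c : Qp p)‖ = 1 :=
  Padic.norm_natCast_eq_one_iff.mpr ((Nat.Prime.coprime_iff_not_dvd p.1.2).mpr p.2)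

/-- At primes dividing c the vector is integral by assumption, and at all other primes c is a unit.
Smoothing therefore never meets the trivial coset. -/
lemma isInt_of_mul {c : ℕ} {v : V} (hS : ∀ i, v i ∈ ZS (primesOf c))
    (h : IsInt ((c : ℚ) • v)) : IsInt v := by
  obtain ⟨w, hw⟩ := h
  have hi : ∀ i, ∃ m : ℤ, v i = m := fun i => by
    refine exists_int_of_norm_le_one _ fun p => ?_
    by_cases hp : p ∈ primesOf c
    · exact hS i p hp
    · have h1 : (c : ℚ) * v i = w i := congrFun hw i
      have h2 : ((c : ℚ_[(p : ℕ)])) * ((v i : ℚ) : ℚ_[(p : ℕ)]) = (w i : ℤ) := by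
        exact_mod_cast congrArg (fun x : ℚ => (x : ℚ_[(p : ℕ)])) h1
      have h3 := Padic.norm_int_le_one (p := (p : ℕ)) (w i)
      rw [← h2, norm_mul, norm_natCast_off ⟨p, hp⟩, one_mul] at h3
      exact h3
  choose m hm using hi
  exact ⟨m, funext hm⟩

lemma c_mem {c : ℕ} {v : V} (hS : ∀ i, v i ∈ ZS (primesOf c)) (i : Fin 2) :
    ((c : ℚ) • v) i ∈ ZS (primesOf c) := (ZS _).mul_mem (natCast_mem _ c) (hS i)

lemma scalar_apply_ite (u : ℚˣ) (i j : Fin 2) :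
    Matrix.GeneralLinearGroup.scalar (Fin 2) u i j = if i = j then (u : ℚ) else 0 := by
  simp [Matrix.diagonal_apply]

lemma inv_scalarD_apply (n : ℕ) [NeZero n] (i j : Fin 2) :
    (scalarD n)⁻¹ i j = if i = j then (n : ℚ)⁻¹ else 0 := by
  have h : (scalarD n)⁻¹ = Matrix.GeneralLinearGroup.scalar (Fin 2)
      (Units.mk0 (n : ℚ) (Nat.cast_ne_zero.mpr (NeZero.ne n)))⁻¹ := by
    rw [map_inv]; rfl
  rw [h, scalar_apply_ite]
  rfl

lemma slash_c {c : ℕ} [NeZero c] {v : V} (hS : ∀ i, v i ∈ ZS (primesOf c)) (hv : ¬ IsInt v) (n : ℕ)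
    [NeZero n] :
    slash (slash (cosetTest (primesOf c) v hS hv) (scalarD n)) (scalarD c) =
      slash (cosetTest (primesOf c) ((c : ℚ) • v) (c_mem hS) fun h => hv (isInt_of_mul hS h))
        (scalarD n) := by
  have h : slash (cosetTest (primesOf c) v hS hv) (scalarD c) =
      cosetTest (primesOf c) ((c : ℚ) • v) (c_mem hS) fun h => hv (isInt_of_mul hS h) := by
    refine slash_cosetTest (fun p i j => ?_) (fun p i j => ?_) ?_ hS hv _ _
    · change ‖(((scalarD c) i j : ℚ) : Qp p)‖ ≤ 1
      rw [scalarD_apply]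
      split_ifs
      · rw [Rat.cast_natCast]
        exact (norm_natCast_off p).le
      · simp
    · change ‖((((scalarD c)⁻¹ : GL (Fin 2) ℚ) i j : ℚ) : Qp p)‖ ≤ 1
      rw [inv_scalarD_apply]
      split_ifs
      · rw [Rat.cast_inv, Rat.cast_natCast, norm_inv, norm_natCast_off, inv_one]
      · simp
    · funext k
      rw [vecMul_two, scalarD_apply, scalarD_apply]
      fin_cases k <;> simp [mul_comm]
  rw [slash_scalarD_comm, h]

/-! ### The action of the generators on `Ẽ` -/

lemma coe_toGLR_smul (S : Set Nat.Primes) (γ : GS S) (τ : ℍ) : ((toGLR S γ • τ : ℍ) : ℂ) =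
    (((toGLQ S γ) 0 0 : ℚ) * τ + ((toGLQ S γ) 0 1 : ℚ)) /
      (((toGLQ S γ) 1 0 : ℚ) * τ + ((toGLQ S γ) 1 1 : ℚ)) := by
  rw [coe_smul_of_det_pos (toGLR_det_pos S γ)]
  simp [num, denom, toGLR]

lemma toGLR_smul_inv_smul (S : Set Nat.Primes) (γ : GS S) (τ : ℍ) :
    toGLR S γ • toGLR S γ⁻¹ • τ = τ := by
  rw [← mul_smul, ← map_mul, mul_inv_cancel, map_one, one_smul]

lemma coe_T_inv_smul (S : Set Nat.Primes) (τ : ℍ) :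
    ((toGLR S (matT S)⁻¹ • τ : ℍ) : ℂ) = τ - 1 := by
  have h := congrArg UpperHalfPlane.coe (toGLR_smul_inv_smul S (matT S) τ)
  rw [coe_toGLR_smul, matT, toGLQ_ofSL, toGLQ_ofSL, toGLQ_ofSL, toGLQ_ofSL] at h
  simp only [ModularGroup.T] at h
  simp at h
  rw [← h]
  ring_nf
  rfl

lemma coe_S_inv_smul (S : Set Nat.Primes) (τ : ℍ) :
    ((toGLR S (matS S)⁻¹ • τ : ℍ) : ℂ) = -1 / τ := by
  have h := congrArg UpperHalfPlane.coe (toGLR_smul_inv_smul S (matS S) τ)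
  rw [coe_toGLR_smul, matS, toGLQ_ofSL, toGLQ_ofSL, toGLQ_ofSL, toGLQ_ofSL] at h
  simp only [ModularGroup.S] at h
  simp at h
  have h0 := ne_zero (toGLR S (ofSL S ModularGroup.S)⁻¹ • τ)
  change ((toGLR S (ofSL S ModularGroup.S)⁻¹ • τ : ℍ) : ℂ) = _
  rw [← h]
  simp [ModularGroup.S]

lemma coe_diag_inv_smul {S : Set Nat.Primes} {γ : GS S} {i j : ℕ} [NeZero i] [NeZero j]
    (h01 : (toGLQ S γ) 0 1 = 0) (h10 : (toGLQ S γ) 1 0 = 0) (h00 : (toGLQ S γ) 0 0 = i)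
    (h11 : (toGLQ S γ) 1 1 = j) (τ : ℍ) : ((toGLR S γ⁻¹ • τ : ℍ) : ℂ) = j * τ / i := by
  have h := congrArg UpperHalfPlane.coe (toGLR_smul_inv_smul S γ τ)
  rw [coe_toGLR_smul, h00, h01, h10, h11] at h
  have hi : (i : ℂ) ≠ 0 := by exact_mod_cast NeZero.ne i
  have hj : (j : ℂ) ≠ 0 := by exact_mod_cast NeZero.ne j
  simp only [Rat.cast_natCast, Rat.cast_zero, add_zero, zero_mul, zero_add] at h
  rw [← h]
  field_simp

lemma repO_apply {S : Set Nat.Primes} (γ : GS S) (μ : Dist S OH) (f : Test' S) (τ : ℍ) :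
    (repO S γ μ f).1 τ = (μ (slash f (toGLQ S γ))).1 (toGLR S γ⁻¹ • τ) := rfl

lemma cosetHom_gen {c : ℕ} {A : Type} [AddCommGroup A] {σ : V → A} (hσ : IsDistRel c σ)
    (hp : IsCosetFun σ) {v : V} (hS : ∀ i, v i ∈ ZS (primesOf c)) (hv : ¬ IsInt v) {n : ℕ} [NeZero n]
    (hn : n.Coprime c) :
    cosetHom σ hσ (slash (cosetTest (primesOf c) v hS hv) (scalarD n)) = σ v :=
  cosetDist_gen hp v hS hv n hn

lemma smoothHom_gen {c : ℕ} [NeZero c] {A : Type} [AddCommGroup A] {σ : V → A}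
    (hσ : IsDistRel c σ) (hp : IsCosetFun σ) {v : V} (hS : ∀ i, v i ∈ ZS (primesOf c))
    (hv : ¬ IsInt v) {n : ℕ} [NeZero n] (hn : n.Coprime c) :
    smoothHom c (cosetHom σ hσ) (slash (cosetTest (primesOf c) v hS hv) (scalarD n)) =
      ((c : ℤ) ^ 2) • σ v - σ ((c : ℚ) • v) := by
  rw [smoothHom_apply, slash_c hS hv, cosetHom_gen hσ hp hS hv hn]
  exact congrArg _ (cosetHom_gen hσ hp (c_mem hS) (fun h => hv (isInt_of_mul hS h)) hn)

lemma dist_isInt {c : ℕ} {μ : Dist (primesOf c) ℚ}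
    (h : ∀ v hS hv n, ∀ _ : NeZero n, n.Coprime c →
      ∃ m : ℤ, μ (slash (cosetTest (primesOf c) v hS hv) (scalarD n)) = m) (f : Test' (primesOf c)) :
    ∃ m : ℤ, μ f = m := by
  have h1 : AddSubgroup.closure (gens c) ≤ (Int.castAddHom ℚ).range.comap μ := by
    rw [AddSubgroup.closure_le]
    rintro _ ⟨v, hS, hv, n, _, hn, rfl⟩
    obtain ⟨m, hm⟩ := h v hS hv n _ hn
    exact ⟨m, hm.symm⟩
  rw [closure_gens] at h1
  obtain ⟨m, hm⟩ := h1 (AddSubgroup.mem_top f)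
  exact ⟨m, hm.symm⟩

lemma evalOH_apply (τ : ℍ) (h : OH) : h.1 τ = evalOH τ h := rfl

section Generators

variable {c : ℕ} [NeZero c] {v : V} (hS : ∀ i, v i ∈ ZS (primesOf c)) (hv : ¬ IsInt v) {n : ℕ}
  [NeZero n] (hn : n.Coprime c)

include hn

lemma distE_gen (τ : ℍ) :
    (distE c (slash (cosetTest (primesOf c) v hS hv) (scalarD n))).1 τ = (piCval c v : ℚ) +
      1 / (2 * Real.pi * Complex.I) * ((c : ℂ) ^ 2 * cosetLog v τ - cosetLog ((c : ℚ) • v) τ) := by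
  rw [distE_apply, siegelDist, smoothHom_gen (isDistRel_cosetLogO c) cosetLogO_cosetFun hS hv hn,
    distPi, cosetHom_gen _ (piCval_cosetFun c) hS hv hn, zsmul_eq_mul]
  change (piCval c v : ℂ) + 1 / (2 * Real.pi * Complex.I) * _ = _
  congr 2
  rw [evalOH_apply, map_sub]
  congr 1
  rw [← zsmul_eq_mul, map_zsmul, zsmul_eq_mul]
  push_cast
  rfl

lemma distPsi_gen :
    distPsi c (slash (cosetTest (primesOf c) v hS hv) (scalarD n)) = piCval c v +
      1 / 2 * ((c : ℚ) ^ 2 * (dirac (v 0) * perB 1 (v 1)) -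
        dirac (c * v 0) * perB 1 (c * v 1)) := by
  have h := smoothHom_gen (isDistRel_diracB1 c) (dirac_isPer.cosetFun (perB_isPer 1)) hS hv hn
  have h1 : distPsi c (slash (cosetTest (primesOf c) v hS hv) (scalarD n)) =
      distPi c (slash (cosetTest (primesOf c) v hS hv) (scalarD n)) + 1 / 2 *
        smoothHom c (distDB c) (slash (cosetTest (primesOf c) v hS hv) (scalarD n)) := rfl
  rw [h1, distPi, cosetHom_gen _ (piCval_cosetFun c) hS hv hn, distDB, h, zsmul_eq_mul]
  push_cast
  rfl

lemma B2B0_gen : B2B0 c (slash (cosetTest (primesOf c) v hS hv) (scalarD n)) =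
    (c : ℚ) ^ 2 * perB 2 (v 0) - perB 2 (c * v 0) := by
  have h := smoothHom_gen (isDistRel_B2B0 c) ((perB_isPer 2).cosetFun (perB_isPer 0)) hS hv hn
  simp only [perB_zero, mul_one] at h
  refine Eq.trans ?_ (h.trans ?_)
  · simp only [B2B0, perB_zero, mul_one]
    rfl
  · rw [zsmul_eq_mul]
    push_cast
    rfl

lemma B1B1_gen : B1B1 c (slash (cosetTest (primesOf c) v hS hv) (scalarD n)) =
    (c : ℚ) ^ 2 * (perB 1 (v 0) * perB 1 (v 1)) - perB 1 (c * v 0) * perB 1 (c * v 1) := by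
  have h := smoothHom_gen (isDistRel_B1B1 c) ((perB_isPer 1).cosetFun (perB_isPer 1)) hS hv hn
  refine Eq.trans rfl (h.trans ?_)
  rw [zsmul_eq_mul]
  push_cast
  rfl

end Generators

/-- The distribution `f ↦ -½ (𝔹_2 ⊗ 𝔹_0)_c(f ∣ T) + Ψ(f ∣ T - f)`. -/
def distT (c : ℕ) [NeZero c] : Dist (primesOf c) ℚ :=
  (AddMonoidHom.mulLeft (-(1 / 2) : ℚ)).comp
    ((smoothHom c (distB2 c)).comp (slashHom (toGLQ _ (matT (primesOf c))))) +
  (distPsi c).comp (slashHom (toGLQ _ (matT (primesOf c))) - AddMonoidHom.id _)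

lemma distT_apply (c : ℕ) [NeZero c] (f : Test' (primesOf c)) : distT c f =
    -(1 / 2) * B2B0 c (slash f (toGLQ _ (matT (primesOf c)))) +
      Psi c (slash f (toGLQ _ (matT (primesOf c))) - f) := rfl

/-- The distribution `f ↦ (𝔹_1 ⊗ 𝔹_1)_c(f) + Ψ(f ∣ S - f)`. -/
def distS (c : ℕ) [NeZero c] : Dist (primesOf c) ℚ :=
  smoothHom c (distBB c) +
  (distPsi c).comp (slashHom (toGLQ _ (matS (primesOf c))) - AddMonoidHom.id _)

lemma distS_apply (c : ℕ) [NeZero c] (f : Test' (primesOf c)) : distS c f =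
    B1B1 c f + Psi c (slash f (toGLQ _ (matS (primesOf c))) - f) := rfl

/-! ### Integrality of the coboundary at S and T -/

lemma exists_int_mul_B1 {c : ℕ} (hc : ∃ m, c = 2 * m + 1) (x : ℚ) :
    ∃ k : ℤ, c * B1 x - B1 (x * c) = k := by
  obtain ⟨m, rfl⟩ := hc
  refine ⟨⌊x * (2 * m + 1 : ℕ)⌋ - (2 * m + 1) * ⌊x⌋ - m, ?_⟩
  rw [B1_eq, B1_eq, Int.fract, Int.fract]
  push_cast
  ring

lemma dirac_neg (x : ℚ) : dirac (-x) = dirac x := by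
  simp only [dirac, Int.fract_neg_eq_zero]

lemma B1_neg (x : ℚ) : B1 (-x) = -B1 x - dirac x := by
  rw [B1_eq, B1_eq, dirac]
  split_ifs with h
  · rw [Int.fract_neg_eq_zero.mpr h, h]; norm_num
  · rw [Int.fract_neg h]; ring

lemma perB_one_neg (x : ℚ) : perB 1 (-x) = -perB 1 x := by
  rw [perB_one_eq, perB_one_eq, B1_neg, dirac_neg]; ring

lemma dirac_eq (x : ℚ) : dirac x = 0 ∨ dirac x = 1 := by
  unfold dirac; split_ifs <;> simp

lemma dirac_mul_dirac {v : V} (hv : ¬ IsInt v) : dirac (v 0) * dirac (v 1) = 0 := by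
  by_contra h
  have h0 : Int.fract (v 0) = 0 := by
    by_contra h0; rw [dirac, if_neg h0, zero_mul] at h; exact h rfl
  have h1 : Int.fract (v 1) = 0 := by
    by_contra h1; rw [mul_comm, dirac, if_neg h1, zero_mul] at h; exact h rfl
  refine hv ⟨fun k => ⌊v k⌋, funext fun k => ?_⟩
  fin_cases k
  · have := Int.fract_add_floor (v 0)
    rw [h0, zero_add] at this
    exact this.symm
  · have := Int.fract_add_floor (v 1)
    rw [h1, zero_add] at this
    exact this.symm

section Values

variable {c : ℕ} [NeZero c] {v : V} (hS : ∀ i, v i ∈ ZS (primesOf c)) (hv : ¬ IsInt v) {n : ℕ}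
  [NeZero n] (hn : n.Coprime c)

include hn

/-- The δ₀ ⊗ 𝔹_1 part of Ψ cancels: it sees only integral v₀, and then v₀ + v₁ and v₁ agree modulo
1. -/
lemma distT_gen : distT c (slash (cosetTest (primesOf c) v hS hv) (scalarD n)) =
    -(1 / 2) * ((c : ℚ) ^ 2 * perB 2 (v 0) - perB 2 (c * v 0)) +
      (piCval c ![v 0, v 0 + v 1] - piCval c v) := by
  have hΨ : Psi c (slash (slash (cosetTest (primesOf c) v hS hv) (scalarD n))
        (toGLQ _ (matT (primesOf c))) - slash (cosetTest (primesOf c) v hS hv) (scalarD n)) =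
      distPsi c (slash (slash (cosetTest (primesOf c) v hS hv) (scalarD n))
        (toGLQ _ (matT (primesOf c))) - slash (cosetTest (primesOf c) v hS hv) (scalarD n)) := rfl
  have hper : ∀ x y : ℚ, dirac x * perB 1 (x + y) = dirac x * perB 1 y := fun x y => by
    by_cases h : Int.fract x = 0
    · have h1 := Int.fract_add_floor x
      rw [h, zero_add] at h1
      rw [← h1, add_comm, perB_isPer]
    · rw [dirac, if_neg h, zero_mul, zero_mul]
  rw [distT_apply, hΨ, map_sub, slash_T hS hv, B2B0_gen _ _ hn, distPsi_gen _ _ hn, distPsi_gen _ _ hn]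
  simp only [Matrix.cons_val_zero, Matrix.cons_val_one, mul_add, hper]
  ring

/-- The second summand is arranged as c² times the right side of `cosetLog_S` at v, minus the same
at cv; the Dirac terms there are what Ψ adds to π_c. -/
lemma distS_gen_eq : distS c (slash (cosetTest (primesOf c) v hS hv) (scalarD n)) =
    (piCval c ![v 1, -v 0] - piCval c v) +
      ((c : ℚ) ^ 2 * (perB 1 (v 0) * perB 1 (v 1) +
        1 / 2 * (dirac (v 1) * perB 1 (-v 0) - dirac (v 0) * perB 1 (v 1))) -
      (perB 1 (c * v 0) * perB 1 (c * v 1) +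
        1 / 2 * (dirac (c * v 1) * perB 1 (-(c * v 0)) - dirac (c * v 0) * perB 1 (c * v 1)))) := by
  have hΨ : Psi c (slash (slash (cosetTest (primesOf c) v hS hv) (scalarD n))
        (toGLQ _ (matS (primesOf c))) - slash (cosetTest (primesOf c) v hS hv) (scalarD n)) =
      distPsi c (slash (slash (cosetTest (primesOf c) v hS hv) (scalarD n))
        (toGLQ _ (matS (primesOf c))) - slash (cosetTest (primesOf c) v hS hv) (scalarD n)) := rfl
  rw [distS_apply, hΨ, map_sub, slash_S hS hv, B1B1_gen _ _ hn, distPsi_gen _ _ hn, distPsi_gen _ _ hn]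
  simp only [Matrix.cons_val_zero, Matrix.cons_val_one, mul_neg]
  ring

/-- Writing 𝔹_1 = B_1 + δ₀/2 makes everything factor, up to multiples of δ₀(v₀)δ₀(v₁) and of its
analogue at cv. These vanish since neither v nor cv is integral. The factored form shows integrality
for odd c. -/
lemma distS_gen : distS c (slash (cosetTest (primesOf c) v hS hv) (scalarD n)) =
    (c * B1 (v 1) - B1 (v 1 * c)) * (c * B1 (v 0) - B1 (v 0 * c) - dirac (v 0 * c)) := by
  have h1 := dirac_mul_dirac hv
  have h2 : dirac (v 0 * c) * dirac (v 1 * c) = 0 := by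
    have := dirac_mul_dirac fun h => hv (isInt_of_mul (c := c) hS h)
    simpa only [Pi.smul_apply, smul_eq_mul, mul_comm (c : ℚ)] using this
  rw [distS_gen_eq hS hv hn]
  simp only [piCval, Matrix.cons_val_zero, Matrix.cons_val_one, neg_mul, perB_one_neg, B1_neg,
    mul_comm (c : ℚ) (v _)]
  simp only [perB_one_eq]
  linear_combination (-(c : ℚ) ^ 2 / 4) * h1 + h2 / 4

lemma distS_gen_isInt (hodd : ∃ m, c = 2 * m + 1) :
    ∃ m : ℤ, distS c (slash (cosetTest (primesOf c) v hS hv) (scalarD n)) = m := by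
  obtain ⟨k, hk⟩ := exists_int_mul_B1 hodd (v 0)
  obtain ⟨l, hl⟩ := exists_int_mul_B1 hodd (v 1)
  rw [distS_gen hS hv hn, hk, hl]
  rcases dirac_eq (v 0 * c) with h | h <;> rw [h]
  · exact ⟨l * k, by push_cast; ring⟩
  · exact ⟨l * (k - 1), by push_cast; ring⟩

/-- With x = ⟨v₀⟩ and M the integer part of cx, the 𝔹_2 terms contribute -(c²-1)/12 + M(M+1)/2 -
cx(M - (c-1)/2). The non-integral last term cancels against π_c. -/
lemma distT_gen_isInt (hodd : ∃ m, c = 2 * m + 1) (h12 : (12 : ℤ) ∣ (c : ℤ) ^ 2 - 1) :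
    ∃ m : ℤ, distT c (slash (cosetTest (primesOf c) v hS hv) (scalarD n)) = m := by
  obtain ⟨k, hk⟩ := exists_int_mul_B1 hodd (v 0)
  obtain ⟨r, hr⟩ := h12
  have hr' : (c : ℚ) ^ 2 - 1 = 12 * r := by exact_mod_cast hr
  set M : ℤ := ⌊v 0 * c⌋ - c * ⌊v 0⌋ with hM
  obtain ⟨A, hA⟩ : ∃ A : ℤ, B1 ((v 0 + v 1) * c) - B1 (v 1 * c) = c * Int.fract (v 0) + A := by
    refine ⟨c * ⌊v 0⌋ - ⌊(v 0 + v 1) * c⌋ + ⌊v 1 * c⌋, ?_⟩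
    rw [B1_eq, B1_eq, Int.fract, Int.fract, Int.fract]
    push_cast
    ring
  have hfr : Int.fract (v 0 * c) = c * Int.fract (v 0) - M := by
    rw [Int.fract, Int.fract, hM]
    push_cast
    ring
  have hkM : (k : ℚ) = M - (c - 1) / 2 := by
    rw [← hk, B1_eq, B1_eq, hfr]
    ring
  obtain ⟨s, hs⟩ : ∃ s : ℤ, M * (M + 1) = 2 * s := by
    obtain ⟨s, hs⟩ := Int.even_mul_succ_self M
    exact ⟨s, by rw [hs]; ring⟩
  have hs' : (M : ℚ) * (M + 1) = 2 * s := by exact_mod_cast hs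
  -- Here r = (c² - 1)/12, s = M(M + 1)/2, k is the smoothed value of B_1 at v₀, and A is the
  -- integral part of the change of B_1(c·) between v₁ and v₀ + v₁.
  refine ⟨-r + s + A * k, ?_⟩
  have hpi : piCval c ![v 0, v 0 + v 1] - piCval c v = (c * Int.fract (v 0) + A) * k := by
    rw [← hA, ← hk]
    simp only [piCval, Matrix.cons_val_zero, Matrix.cons_val_one]
    ring
  rw [distT_gen hS hv hn, hpi, perB_two, perB_two, mul_comm (c : ℚ) (v 0), hfr]
  push_cast
  linear_combination (-1 / 12 : ℚ) * hr' + (1 / 2 : ℚ) * hs' + (c * Int.fract (v 0)) * hkM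

end Values

/-! ### The coboundary of `Ẽ` on the generators of `G_S` -/

lemma repO_matT (c : ℕ) [NeZero c] : repO (primesOf c) (matT (primesOf c)) (distE c) =
    distE c + (constOH.toAddMonoidHom.comp (Rat.castHom ℂ).toAddMonoidHom).comp (distT c) := by
  refine dist_ext fun v hS hv n _ hn => OH_ext fun τ => ?_
  have h1 : (distE c (slash (cosetTest (primesOf c) v hS hv) (scalarD n)) +
      constOH (distT c (slash (cosetTest (primesOf c) v hS hv) (scalarD n)) : ℚ)).1 τ =
      (distE c (slash (cosetTest (primesOf c) v hS hv) (scalarD n))).1 τ +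
        ((distT c (slash (cosetTest (primesOf c) v hS hv) (scalarD n)) : ℚ) : ℂ) := rfl
  refine Eq.trans ?_ h1.symm
  have hcv : (c : ℚ) • (![v 0, v 0 + v 1] : V) =
      ![((c : ℚ) • v) 0, ((c : ℚ) • v) 0 + ((c : ℚ) • v) 1] := by
    funext k
    fin_cases k <;> simp [mul_add]
  rw [repO_apply, slash_T hS hv, distE_gen _ _ hn, distE_gen hS hv hn, distT_gen hS hv hn,
    coe_T_inv_smul, hcv, cosetLog_T, cosetLog_T]
  simp only [Pi.smul_apply, smul_eq_mul]
  push_cast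
  have hπ : (Real.pi : ℂ) ≠ 0 := by exact_mod_cast Real.pi_ne_zero
  have hI := Complex.I_ne_zero
  field_simp
  ring

lemma repO_matS (c : ℕ) [NeZero c] : repO (primesOf c) (matS (primesOf c)) (distE c) =
    distE c + (constOH.toAddMonoidHom.comp (Rat.castHom ℂ).toAddMonoidHom).comp (distS c) := by
  refine dist_ext fun v hS hv n _ hn => OH_ext fun τ => ?_
  have h1 : (distE c (slash (cosetTest (primesOf c) v hS hv) (scalarD n)) +
      constOH (distS c (slash (cosetTest (primesOf c) v hS hv) (scalarD n)) : ℚ)).1 τ =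
      (distE c (slash (cosetTest (primesOf c) v hS hv) (scalarD n))).1 τ +
        ((distS c (slash (cosetTest (primesOf c) v hS hv) (scalarD n)) : ℚ) : ℂ) := rfl
  refine Eq.trans ?_ h1.symm
  have hcv : (c : ℚ) • (![v 1, -v 0] : V) = ![((c : ℚ) • v) 1, -((c : ℚ) • v) 0] := by
    funext k
    fin_cases k <;> simp
  have hcI : ¬ IsInt ((c : ℚ) • v) := fun h => hv (isInt_of_mul hS h)
  rw [repO_apply, slash_S hS hv, distE_gen _ _ hn, distE_gen hS hv hn, distS_gen_eq hS hv hn, coe_S_inv_smul, hcv,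
    sub_eq_iff_eq_add.mp (cosetLog_S hv τ.im_pos), sub_eq_iff_eq_add.mp (cosetLog_S hcI τ.im_pos)]
  simp only [Pi.smul_apply, smul_eq_mul]
  push_cast
  have hπ : (Real.pi : ℂ) ≠ 0 := by exact_mod_cast Real.pi_ne_zero
  have hI := Complex.I_ne_zero
  field_simp
  ring

lemma scalarD_mul (m n : ℕ) [NeZero m] [NeZero n] : scalarD m * scalarD n = scalarD (m * n) := by
  rw [scalarD, scalarD, scalarD, ← map_mul]
  congr 1
  exact Units.ext (Nat.cast_mul m n).symm

lemma cosetHom_slash_diag {c i j : ℕ} [NeZero i] [NeZero j] (hi : i.Coprime c) (hj : j.Coprime c)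
    {g : GL (Fin 2) ℚ} (h01 : g 0 1 = 0) (h10 : g 1 0 = 0) (h00 : g 0 0 = i) (h11 : g 1 1 = j)
    {A : Type} [AddCommGroup A] {σ : V → A} (hσ : IsDistRel c σ) (hp : IsCosetFun σ) {v : V}
    (hS : ∀ k, v k ∈ ZS (primesOf c)) (hv : ¬ IsInt v) {n : ℕ} [NeZero n] (hn : n.Coprime c) :
    cosetHom σ hσ (slash (slash (cosetTest (primesOf c) v hS hv) (scalarD n)) g) =
      ∑ s ∈ Finset.range j, ∑ t ∈ Finset.range i, σ (divVec i j v s t) := by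
  rw [slash_scalarD_comm, slash_cosetTest_diag hi hj h01 h10 h00 h11]
  change cosetHom σ hσ (slashHom (scalarD n) _) = _
  rw [map_sum, map_sum]
  refine Finset.sum_congr rfl fun s _ => ?_
  rw [map_sum, map_sum]
  refine Finset.sum_congr rfl fun t _ => ?_
  change cosetHom σ hσ (slash (slash _ _) _) = _
  rw [← slash_mul, scalarD_mul]
  exact cosetHom_gen hσ hp _ _ ((hi.mul_left hj).mul_left hn)

section Diagonal

variable {c : ℕ} {γ : GS (primesOf c)} {i j : ℕ} [NeZero i] [NeZero j] (hi : i.Coprime c)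
  (hj : j.Coprime c) (h01 : (toGLQ _ γ) 0 1 = 0) (h10 : (toGLQ _ γ) 1 0 = 0)
  (h00 : (toGLQ _ γ) 0 0 = i) (h11 : (toGLQ _ γ) 1 1 = j)

include hi hj h01 h10 h00 h11

/-- The matrix splits a coset into ij scaled cosets and moves τ to jτ/i, so invariance is exactly
`sum_cosetLog`. -/
lemma repO_siegelDist_diag : repO _ γ (siegelDist c) = siegelDist c := by
  refine dist_ext fun v hS hv n _ hn => OH_ext fun τ => ?_
  rw [repO_apply, siegelDist, cosetHom_slash_diag hi hj h01 h10 h00 h11 _ cosetLogO_cosetFun hS hv hn,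
    cosetHom_gen _ cosetLogO_cosetFun hS hv hn, evalOH_apply, map_sum]
  simp only [map_sum]
  refine Eq.trans (Finset.sum_congr rfl fun s _ => Finset.sum_congr rfl fun t _ => ?_)
    (sum_cosetLog (NeZero.pos i) (NeZero.pos j) hv τ.im_pos)
  rw [← coe_diag_inv_smul h01 h10 h00 h11]
  rfl

lemma distPi_diag (f : Test' (primesOf c)) : distPi c (slash f (toGLQ _ γ)) = distPi c f := by
  have h : (distPi c).comp (slashHom (toGLQ _ γ)) = distPi c := by
    refine dist_ext fun v hS hv n _ hn => ?_
    refine (cosetHom_slash_diag hi hj h01 h10 h00 h11 (isDistRel_piCval c) (piCval_cosetFun c)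
      hS hv hn).trans ?_
    rw [sum_piCval (NeZero.pos i) hi (NeZero.pos j) hj]
    exact (cosetHom_gen _ (piCval_cosetFun c) hS hv hn).symm
  exact DFunLike.congr_fun h f

lemma repO_distE_diag [NeZero c] : repO _ γ (distE c) = distE c := by
  refine AddMonoidHom.ext fun f => OH_ext fun τ => ?_
  rw [repO_apply, distE_apply_eq, distE_apply_eq, distPi_diag hi hj h01 h10 h00 h11,
    ← slash_scalarD_comm, ← repO_apply, ← repO_apply, repO_siegelDist_diag hi hj h01 h10 h00 h11]

end Diagonal

/-! ### Kato–Siegel units -/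

lemma Theta_eq (u : ℂ) (τ : ℍ) : Theta u τ = -e (τ / 12 - u / 2) * theta τ u := by
  have hq := norm_e_lt_one τ.im_pos
  have hprod : ∏' n : ℕ, ((1 - e ((n + 1) * τ + u)) * (1 - e ((n + 1) * τ - u))) =
      prodQ (e τ) (e τ * e u) * prodQ (e τ) (e (τ - u)) := by
    rw [prodQ, prodQ, ← (multipliable_prodQ hq _).tprod_mul (multipliable_prodQ hq _)]
    refine tprod_congr fun n => ?_
    rw [← e_natCast_mul, ← e_add, ← e_add, ← e_add]
    ring_nf
  rw [Theta, hprod, theta, prodQ_eq_mul hq (e u)]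
  have h1 : e (u / 2) - e (-u / 2) = -e (-u / 2) * (1 - e u) := by
    have : e (u / 2) = e (-u / 2) * e u := by rw [← e_add]; ring_nf
    rw [this]; ring
  have h2 : e (τ / 12 - u / 2) = e (τ / 12) * e (-u / 2) := by rw [← e_add]; ring_nf
  rw [h1, h2]
  ring

lemma Theta_add_tau (u : ℂ) (τ : ℍ) : Theta (u + τ) τ = -e (-u - τ / 2) * Theta u τ := by
  rw [Theta_eq, Theta_eq, (theta_isThetaLike τ.im_pos).add_tau]
  have h : e (τ / 12 - (u + τ) / 2) * e (-u) = e (-u - τ / 2) * e (τ / 12 - u / 2) := by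
    rw [← e_add, ← e_add]; ring_nf
  linear_combination theta τ u * h

/-- The Gaussian factor absorbs the dependence of the quasi-period factor on τ; what remains depends
only on b. -/
lemma e_mul_Theta_add_one (x b : ℂ) (τ : ℍ) : e (τ * (x + 1) ^ 2 / 2) * Theta ((x + 1) * τ + b) τ =
    e (1 / 2 - b) * (e (τ * x ^ 2 / 2) * Theta (x * τ + b) τ) := by
  have h : (x + 1) * τ + b = (x * τ + b) + τ := by ring
  have h1 : e (τ * (x + 1) ^ 2 / 2) * e (-(x * τ + b) - τ / 2) = e (-b) * e (τ * x ^ 2 / 2) := by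
    rw [← e_add, ← e_add]; ring_nf
  have h2 : e (1 / 2 - b) = -e (-b) := by
    rw [sub_eq_add_neg, e_add, e_half]; ring
  rw [h, Theta_add_tau, h2]
  linear_combination -Theta (x * τ + b) τ * h1

lemma e_mul_Theta_add_int (x b : ℂ) (τ : ℍ) (m : ℤ) :
    e (τ * (x + m) ^ 2 / 2) * Theta ((x + m) * τ + b) τ =
      e (m * (1 / 2 - b)) * (e (τ * x ^ 2 / 2) * Theta (x * τ + b) τ) := by
  induction m using Int.induction_on with
  | zero => simp [e_zero]
  | succ m ih =>
    have h := e_mul_Theta_add_one (x + (m : ℤ)) b τ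
    rw [ih] at h
    have h2 : e (((m : ℤ) + 1 : ℤ) * (1 / 2 - b)) = e (1 / 2 - b) * e (((m : ℤ) : ℂ) * (1 / 2 - b)) := by
      rw [← e_add]; push_cast; ring_nf
    rw [h2]
    push_cast at h ⊢
    rw [← add_assoc, h]
    ring
  | pred m ih =>
    have h := e_mul_Theta_add_one (x + (-(m : ℤ) - 1 : ℤ)) b τ
    have h3 : x + ((-(m : ℤ) - 1 : ℤ) : ℂ) + 1 = x + ((-(m : ℤ) : ℤ) : ℂ) := by push_cast; ring
    rw [h3, ih] at h
    have h2 : e (((-(m : ℤ) : ℤ) : ℂ) * (1 / 2 - b)) =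
        e (1 / 2 - b) * e (((-(m : ℤ) - 1 : ℤ) : ℂ) * (1 / 2 - b)) := by
      rw [← e_add]; push_cast; ring_nf
    rw [h2, mul_assoc] at h
    exact (mul_left_cancel₀ (e_ne_zero _) h).symm

/-- The Siegel function uses the reduced parameter ⟨v₀⟩ and the Kato–Siegel unit the unreduced v₀.
The root of unity incurred by the shift is kept explicitly, to be matched with π_c. -/
lemma exp_cosetLog {v : V} (hv : ¬ IsInt v) (τ : ℍ) : Complex.exp (cosetLog v τ) =
    e (1 / 2 + (v 1 : ℚ) / 2 + ⌊v 0⌋ / 2 + ⌊v 0⌋ * (v 1 : ℚ) + τ * ((v 0 : ℚ) : ℂ) ^ 2 / 2) *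
      Theta ((v 0 : ℚ) * τ + (v 1 : ℚ)) τ := by
  have h1 := exp_logSiegel (not_isInt_mem_siegelDom hv) τ.im_pos
  have hfl : ((v 0 : ℚ) : ℂ) = ((Int.fract (v 0) : ℚ) : ℂ) + (⌊v 0⌋ : ℤ) := by
    rw [← Rat.cast_intCast, ← Rat.cast_add, Int.fract_add_floor]
  have h2 := e_mul_Theta_add_int ((Int.fract (v 0) : ℚ) : ℂ) ((v 1 : ℚ) : ℂ) τ ⌊v 0⌋
  rw [← hfl] at h2
  have h3 := Theta_eq (((Int.fract (v 0) : ℚ) : ℂ) * τ + ((v 1 : ℚ) : ℂ)) τ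
  rw [h3] at h2
  have h4 : Complex.exp (cosetLog v τ) =
      e (τ * (((Int.fract (v 0) : ℚ) : ℂ) ^ 2 - ((Int.fract (v 0) : ℚ) : ℂ) + 1 / 6) / 2) *
        theta τ (((Int.fract (v 0) : ℚ) : ℂ) * τ + (v 1 : ℚ)) := by
    refine h1.trans ?_
    simp only [Complex.ofReal_ratCast]
  generalize ((Int.fract (v 0) : ℚ)) = a at *
  have h5 : e (1 / 2 + (v 1 : ℚ) / 2 + ⌊v 0⌋ / 2 + ⌊v 0⌋ * (v 1 : ℚ) + τ * ((v 0 : ℚ) : ℂ) ^ 2 / 2) =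
      e (1 / 2) * e ((v 1 : ℚ) / 2 + ⌊v 0⌋ / 2 + ⌊v 0⌋ * (v 1 : ℚ)) *
        e (τ * ((v 0 : ℚ) : ℂ) ^ 2 / 2) := by
    rw [← e_add, ← e_add]; ring_nf
  rw [h4, h5, mul_assoc, h2, e_half]
  have h6 : e (τ * ((a : ℂ) ^ 2 - a + 1 / 6) / 2) =
      e ((v 1 : ℚ) / 2 + ⌊v 0⌋ / 2 + ⌊v 0⌋ * (v 1 : ℚ)) * e (⌊v 0⌋ * (1 / 2 - (v 1 : ℚ))) *
        e (τ * (a : ℂ) ^ 2 / 2) * e (τ / 12 - (a * τ + (v 1 : ℚ)) / 2) := by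
    rw [← e_add, ← e_add, ← e_add, ← e_add_intCast _ ⌊v 0⌋]
    congr 1
    ring
  rw [h6]
  ring

lemma e_natCast_half (h : ℕ) : e ((h : ℂ) / 2) = (-1) ^ h := by
  have : (h : ℂ) / 2 = h * (1 / 2) := by ring
  rw [this, e_natCast_mul, e_half]

lemma e_mul_div (P A A' X Y : ℂ) :
    e P * (e A * X / (e A' * Y)) = e (P + (A - A')) * X / Y := by
  rw [e_add, e_sub]; ring

/-- In the smoothed quotient the Gaussian factors cancel, because c²v₀² = (cv₀)². The remaining root
of unity times e(π_c) equals (-1)^((c-1)/2). -/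
lemma exp_distE_cosetTest {c : ℕ} [NeZero c] (hodd : ∃ m, c = 2 * m + 1) {v : V}
    (hS : ∀ i, v i ∈ ZS (primesOf c)) (hv : ¬ IsInt v) (τ : ℍ) :
    Complex.exp (2 * Real.pi * Complex.I * (distE c (cosetTest (primesOf c) v hS hv)).1 τ) =
      katoSiegelUnit c v τ := by
  have hE := distE_gen hS hv (n := 1) (Nat.coprime_one_left c) τ
  rw [slash_scalarD_one] at hE
  have hcI : ¬ IsInt ((c : ℚ) • v) := fun h => hv (isInt_of_mul hS h)
  have hπ : (Real.pi : ℂ) ≠ 0 := by exact_mod_cast Real.pi_ne_zero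
  have hI := Complex.I_ne_zero
  have h1 : Complex.exp (2 * Real.pi * Complex.I *
      (distE c (cosetTest (primesOf c) v hS hv)).1 τ) = e (piCval c v : ℚ) *
        (Complex.exp (cosetLog v τ) ^ (c ^ 2) / Complex.exp (cosetLog ((c : ℚ) • v) τ)) := by
    rw [hE, e, ← Complex.exp_nat_mul, ← Complex.exp_sub, ← Complex.exp_add]
    congr 1
    push_cast
    field_simp
  rw [h1, exp_cosetLog hv, exp_cosetLog hcI, mul_pow, ← e_natCast_mul]
  simp only [Pi.smul_apply, smul_eq_mul]
  have h2 : (((c : ℚ) * v 0 : ℚ) : ℂ) * τ + (((c : ℚ) * v 1 : ℚ) : ℂ) =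
      c * (((v 0 : ℚ) : ℂ) * τ + ((v 1 : ℚ) : ℂ)) := by push_cast; ring
  rw [katoSiegelUnit, h2]
  obtain ⟨m, rfl⟩ := hodd
  have hm : (2 * m + 1 - 1) / 2 = m := by omega
  rw [hm, ← e_natCast_half, e_mul_div]
  congr 2
  have hpi : piCval (2 * m + 1 : ℕ) v = (v 1 * (2 * m + 1 : ℕ) - ⌊v 1 * (2 * m + 1 : ℕ)⌋ - 1 / 2) *
      (⌊v 0 * (2 * m + 1 : ℕ)⌋ - (2 * m + 1 : ℕ) * ⌊v 0⌋ - m) := by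
    rw [piCval, B1_eq, B1_eq, B1_eq, Int.fract, Int.fract, Int.fract]
    push_cast
    ring
  rw [mul_comm ((2 * m + 1 : ℕ) : ℚ) (v 0), mul_comm ((2 * m + 1 : ℕ) : ℚ) (v 1), hpi]
  generalize ⌊v 0 * (2 * m + 1 : ℕ)⌋ = M
  generalize ⌊v 1 * (2 * m + 1 : ℕ)⌋ = N
  generalize ⌊v 0⌋ = k
  -- The total exponent differs from m/2 by this integer, where c = 2m + 1 and k, M, N are the
  -- floors of v₀, cv₀ and cv₁.
  rw [← e_add_intCast ((m : ℂ) / 2) (2 * m * (m + 1) + (2 * m + 1) * (m + 1) * k - M -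
    (M - (2 * m + 1) * k - m) * N)]
  congr 1
  push_cast
  ring

/-! ### Generators of `G_S` -/

lemma toGLQ_injective (S : Set Nat.Primes) : Function.Injective (toGLQ S) := by
  intro γ γ' h
  refine Subtype.ext (Units.ext (Matrix.ext fun i j => Subtype.ext ?_))
  exact congrArg (fun g : GL (Fin 2) ℚ => g i j) h

lemma GS_ext {S : Set Nat.Primes} {γ γ' : GS S} (h : ∀ i j, (toGLQ S γ) i j = (toGLQ S γ') i j) :
    γ = γ' :=
  toGLQ_injective S (Units.ext (Matrix.ext h))

lemma toGLQ_mul_apply {S : Set Nat.Primes} (γ γ' : GS S) (i j : Fin 2) : (toGLQ S (γ * γ')) i j =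
    (toGLQ S γ) i 0 * (toGLQ S γ') 0 j + (toGLQ S γ) i 1 * (toGLQ S γ') 1 j := by
  rw [map_mul]
  simp [Matrix.mul_apply, Fin.sum_univ_two]

lemma toGLQ_mem {S : Set Nat.Primes} (γ : GS S) (i j : Fin 2) : (toGLQ S γ) i j ∈ ZS S :=
  ((γ : GL (Fin 2) (ZS S)) i j).2

lemma toGLQ_det_pos {S : Set Nat.Primes} (γ : GS S) : 0 < (toGLQ S γ) 0 0 * (toGLQ S γ) 1 1 -
    (toGLQ S γ) 0 1 * (toGLQ S γ) 1 0 := by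
  have h : (0 : ZS S) < (γ : GL (Fin 2) (ZS S)).det.val := γ.2
  rw [Matrix.GeneralLinearGroup.val_det_apply, Matrix.det_fin_two] at h
  exact h

lemma den_coprime {c : ℕ} {x : ℚ} (hx : x ∈ ZS (primesOf c)) : x.den.Coprime c := by
  rw [Nat.coprime_iff_gcd_eq_one]
  by_contra h
  obtain ⟨p, hp, hpd⟩ := Nat.exists_prime_and_dvd h
  have h1 := hx ⟨p, hp⟩ (hpd.trans (Nat.gcd_dvd_right _ _))
  have : Fact p.Prime := ⟨hp⟩
  rw [Padic.norm_rat_le_one_iff_padicValuation_le_one, Rat.padicValuation_le_one_iff] at h1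
  exact h1 (hpd.trans (Nat.gcd_dvd_left _ _))

/-- A natural number prime to `c` as a unit of `ℤ_S`. -/
def natUnit {c : ℕ} (n : ℕ) [NeZero n] (hn : n.Coprime c) : (ZS (primesOf c))ˣ where
  val := ⟨n, natCast_mem _ n⟩
  inv := ⟨(n : ℚ)⁻¹, inv_natCast_mem_ZS hn⟩
  val_inv := Subtype.ext (mul_inv_cancel₀ (Nat.cast_ne_zero.mpr (NeZero.ne n)))
  inv_val := Subtype.ext (inv_mul_cancel₀ (Nat.cast_ne_zero.mpr (NeZero.ne n)))

/-- The diagonal matrix with entries `i`, `j`. -/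
def natDiag {c : ℕ} (i j : ℕ) [NeZero i] [NeZero j] (hi : i.Coprime c) (hj : j.Coprime c) :
    GS (primesOf c) :=
  ⟨{ val := Matrix.diagonal ![natUnit i hi, natUnit j hj]
     inv := Matrix.diagonal ![((natUnit i hi)⁻¹ : (ZS (primesOf c))ˣ), ((natUnit j hj)⁻¹ : (ZS (primesOf c))ˣ)]
     val_inv := by
      ext a b
      fin_cases a <;> fin_cases b <;> simp [Matrix.mul_apply, Fin.sum_univ_two]
     inv_val := by
      ext a b
      fin_cases a <;> fin_cases b <;> simp [Matrix.mul_apply, Fin.sum_univ_two] }, by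
    change (0 : ZS (primesOf c)) < Matrix.det _
    rw [Matrix.det_fin_two]
    change (0 : ℚ) < (i : ℚ) * j - 0 * 0
    have hi0 : (0 : ℚ) < i := Nat.cast_pos.mpr (NeZero.pos i)
    have hj0 : (0 : ℚ) < j := Nat.cast_pos.mpr (NeZero.pos j)
    rw [mul_zero, sub_zero]
    positivity⟩

lemma natDiag_apply {c : ℕ} (i j : ℕ) [NeZero i] [NeZero j] (hi : i.Coprime c) (hj : j.Coprime c)
    (k l : Fin 2) : (toGLQ _ (natDiag i j hi hj)) k l =
      if k = l then ![(i : ℚ), j] k else 0 := by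
  fin_cases k <;> fin_cases l <;> rfl

lemma exists_nat_fraction {c : ℕ} {x y : ℚ} (hx : x ∈ ZS (primesOf c)) (hy : y ∈ ZS (primesOf c))
    (hxy : x * y = 1) (hpos : 0 < x) :
    ∃ m n : ℕ, m ≠ 0 ∧ n ≠ 0 ∧ m.Coprime c ∧ n.Coprime c ∧ x * n = m := by
  have h2 := den_coprime hy
  rw [eq_inv_of_mul_eq_one_right hxy, Rat.den_inv_of_ne_zero hpos.ne'] at h2
  refine ⟨x.num.natAbs, x.den, ?_, x.den_nz, h2, den_coprime hx, ?_⟩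
  · simpa using hpos.ne'
  · rw [Rat.mul_den_eq_num, Nat.cast_natAbs, abs_of_pos (Rat.num_pos.mpr hpos)]

/-- Clearing denominators on the diagonal writes γ as diag(i,j) ν diag(k,l)⁻¹ with ν unipotent and
natural entries prime to c. Invariance thus need only be known for natural diagonal entries. -/
lemma exists_natDiag_mul {c : ℕ} {γ : GS (primesOf c)} (h10 : (toGLQ _ γ) 1 0 = 0)
    (h0 : 0 < (toGLQ _ γ) 0 0) (h1 : 0 < (toGLQ _ γ) 1 1) :
    ∃ (i j k l : ℕ) (_ : NeZero i) (_ : NeZero j) (_ : NeZero k) (_ : NeZero l)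
      (hi : i.Coprime c) (hj : j.Coprime c) (hk : k.Coprime c) (hl : l.Coprime c)
      (ν : GS (primesOf c)), γ * natDiag k l hk hl = natDiag i j hi hj * ν ∧
        (toGLQ _ ν) 1 0 = 0 ∧ (toGLQ _ ν) 0 0 = 1 ∧ (toGLQ _ ν) 1 1 = 1 ∧
        i * (toGLQ _ ν) 0 1 = (toGLQ _ γ) 0 1 * l := by
  have e0 : (toGLQ _ γ) 0 0 * (toGLQ _ γ⁻¹) 0 0 = 1 := by
    have h := toGLQ_mul_apply γ⁻¹ γ 0 0
    rw [inv_mul_cancel, map_one, h10, mul_zero, add_zero, mul_comm] at h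
    simpa using h.symm
  have e1 : (toGLQ _ γ) 1 1 * (toGLQ _ γ⁻¹) 1 1 = 1 := by
    have h := toGLQ_mul_apply γ γ⁻¹ 1 1
    rw [mul_inv_cancel, map_one, h10, zero_mul, zero_add] at h
    simpa using h.symm
  obtain ⟨i, k, hi0, hk0, hi, hk, e0⟩ :=
    exists_nat_fraction (toGLQ_mem γ 0 0) (toGLQ_mem γ⁻¹ 0 0) e0 h0
  obtain ⟨j, l, hj0, hl0, hj, hl, e1⟩ :=
    exists_nat_fraction (toGLQ_mem γ 1 1) (toGLQ_mem γ⁻¹ 1 1) e1 h1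
  have : NeZero i := ⟨hi0⟩
  have : NeZero j := ⟨hj0⟩
  have : NeZero k := ⟨hk0⟩
  have : NeZero l := ⟨hl0⟩
  have hiq : (i : ℚ) ≠ 0 := Nat.cast_ne_zero.mpr hi0
  have hjq : (j : ℚ) ≠ 0 := Nat.cast_ne_zero.mpr hj0
  have h : γ * natDiag k l hk hl =
      natDiag i j hi hj * ((natDiag i j hi hj)⁻¹ * (γ * natDiag k l hk hl)) := by
    rw [mul_inv_cancel_left]
  generalize (natDiag i j hi hj)⁻¹ * (γ * natDiag k l hk hl) = ν at h
  have hent : ∀ a b, (toGLQ _ (γ * natDiag k l hk hl)) a b =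
      (toGLQ _ (natDiag i j hi hj * ν)) a b := fun a b => by rw [h]
  simp only [toGLQ_mul_apply, natDiag_apply] at hent
  refine ⟨i, j, k, l, ‹_›, ‹_›, ‹_›, ‹_›, hi, hj, hk, hl, ν, h, ?_, ?_, ?_, ?_⟩
  · simpa [h10, hj0] using hent 1 0
  · have : (toGLQ _ γ) 0 0 * k = i * (toGLQ _ ν) 0 0 := by simpa using hent 0 0
    rw [e0] at this
    exact mul_left_cancel₀ hiq (by rw [← this, mul_one])
  · have : (toGLQ _ γ) 1 1 * l = j * (toGLQ _ ν) 1 1 := by simpa [h10] using hent 1 1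
    rw [e1] at this
    exact mul_left_cancel₀ hjq (by rw [← this, mul_one])
  · have := hent 0 1
    simpa using this.symm

lemma mem_of_isPosDiagonal {c : ℕ} {P : Subgroup (GS (primesOf c))}
    (hP : ∀ i j, ∀ _ : NeZero i, ∀ _ : NeZero j, ∀ hi hj, natDiag (c := c) i j hi hj ∈ P)
    {γ : GS (primesOf c)} (hγ : IsPosDiagonal γ) : γ ∈ P := by
  obtain ⟨h01, h10, h0, h1⟩ := hγ
  obtain ⟨i, j, k, l, hi0, _, _, _, hi, hj, hk, hl, ν, h, n10, n00, n11, n01⟩ :=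
    exists_natDiag_mul h10 h0 h1
  have hν : ν = 1 := GS_ext fun a b => by
    rw [map_one]
    rw [h01, zero_mul, mul_eq_zero, or_iff_right (Nat.cast_ne_zero.mpr hi0.out)] at n01
    fin_cases a <;> fin_cases b <;> simp [n10, n00, n11, n01]
  rw [hν, mul_one] at h
  rw [eq_mul_inv_of_mul_eq h]
  exact P.mul_mem (hP _ _ _ _ _ _) (P.inv_mem (hP _ _ _ _ _ _))

lemma ofSL_mem {S : Set Nat.Primes} {P : Subgroup (GS S)} (hS : matS S ∈ P) (hT : matT S ∈ P)
    (g : SL(2, ℤ)) : ofSL S g ∈ P := by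
  have h : Subgroup.closure {ModularGroup.S, ModularGroup.T} ≤ P.comap (ofSL S) := by
    rw [Subgroup.closure_le]
    rintro g (rfl | rfl)
    · exact hS
    · exact hT
  rw [SpecialLinearGroup.SL2Z_generators] at h
  exact h (Subgroup.mem_top g)

lemma isPosDiagonal_natDiag {c : ℕ} (i j : ℕ) [NeZero i] [NeZero j] (hi : i.Coprime c)
    (hj : j.Coprime c) : IsPosDiagonal (natDiag (c := c) i j hi hj) := by
  refine ⟨rfl, rfl, ?_, ?_⟩
  · exact Nat.cast_pos.mpr (NeZero.pos i)
  · exact Nat.cast_pos.mpr (NeZero.pos j)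

/-- By Bézout, right multiplication by an element of SL_2(ℤ) carries the row (m,n) to (0,d), where d
is the greatest common divisor. -/
lemma exists_sl_bottom (m n : ℤ) (h : ¬ (m = 0 ∧ n = 0)) :
    ∃ (g : SL(2, ℤ)) (d : ℤ), 0 < d ∧ m * g 0 0 + n * g 1 0 = 0 ∧ m * g 0 1 + n * g 1 1 = d := by
  have hg : 0 < Int.gcd m n := Int.gcd_pos_iff.mpr (by tauto)
  obtain ⟨a, ha⟩ := Int.gcd_dvd_left (a := m) (b := n)
  obtain ⟨b, hb⟩ := Int.gcd_dvd_right (a := m) (b := n)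
  have hbez := Int.gcd_eq_gcd_ab m n
  have hg' : (Int.gcd m n : ℤ) ≠ 0 := by exact_mod_cast hg.ne'
  refine ⟨⟨!![b, Int.gcdA m n; -a, Int.gcdB m n], ?_⟩, Int.gcd m n, by exact_mod_cast hg, ?_, ?_⟩
  · rw [Matrix.det_fin_two_of]
    refine mul_left_cancel₀ hg' ?_
    linear_combination -Int.gcdB m n * hb - Int.gcdA m n * ha - hbez
  · change m * b + n * -a = 0
    linear_combination b * ha - a * hb
  · exact hbez.symm

/-- A unipotent matrix with upper entry m/n is the conjugate of T^m by diag(1,n), so the upper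
triangular matrices with positive diagonal are reached. A general γ becomes such after right
multiplication by an element of SL_2(ℤ), which S and T generate. -/
lemma eq_top_of_generators {c : ℕ} {P : Subgroup (GS (primesOf c))}
    (hS : matS (primesOf c) ∈ P) (hT : matT (primesOf c) ∈ P)
    (hD : ∀ γ : GS (primesOf c), IsPosDiagonal γ → γ ∈ P) (γ : GS (primesOf c)) : γ ∈ P := by
  have hunip : ∀ γ : GS (primesOf c), (toGLQ _ γ) 1 0 = 0 → (toGLQ _ γ) 0 0 = 1 →
      (toGLQ _ γ) 1 1 = 1 → γ ∈ P := by
    intro γ h10 h00 h11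
    have hn := den_coprime (toGLQ_mem γ 0 1)
    have hx := Rat.mul_den_eq_num ((toGLQ _ γ) 0 1)
    have : NeZero ((toGLQ _ γ) 0 1).den := ⟨((toGLQ _ γ) 0 1).den_nz⟩
    set n := ((toGLQ _ γ) 0 1).den with hn_def
    set m := ((toGLQ _ γ) 0 1).num with hm_def
    have hT' : ∀ a b, (toGLQ _ (ofSL (primesOf c) (ModularGroup.T ^ m))) a b =
        !![1, (m : ℚ); 0, 1] a b := fun a b => by
      rw [toGLQ_ofSL, ModularGroup.coe_T_zpow]
      fin_cases a <;> fin_cases b <;> simp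
    have h : γ * natDiag 1 n (Nat.coprime_one_left c) hn =
        natDiag 1 n (Nat.coprime_one_left c) hn * ofSL (primesOf c) (ModularGroup.T ^ m) := by
      refine GS_ext fun a b => ?_
      rw [toGLQ_mul_apply, toGLQ_mul_apply, hT', hT', natDiag_apply, natDiag_apply, natDiag_apply,
        natDiag_apply]
      fin_cases a <;> fin_cases b <;> simp [h10, h00, h11, hx]
    rw [eq_mul_inv_of_mul_eq h]
    exact P.mul_mem (P.mul_mem (hD _ (isPosDiagonal_natDiag _ _ _ _)) (ofSL_mem hS hT _))
      (P.inv_mem (hD _ (isPosDiagonal_natDiag _ _ _ _)))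
  have hupper : ∀ γ : GS (primesOf c), (toGLQ _ γ) 1 0 = 0 → 0 < (toGLQ _ γ) 1 1 → γ ∈ P := by
    intro γ h10 h11
    have hdet := toGLQ_det_pos γ
    rw [h10, mul_zero, sub_zero] at hdet
    obtain ⟨i, j, k, l, _, _, _, _, hi, hj, hk, hl, ν, h, n10, n00, n11, -⟩ :=
      exists_natDiag_mul h10 (pos_of_mul_pos_left hdet h11.le) h11
    rw [eq_mul_inv_of_mul_eq h]
    exact P.mul_mem (P.mul_mem (hD _ (isPosDiagonal_natDiag _ _ _ _)) (hunip ν n10 n00 n11))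
      (P.inv_mem (hD _ (isPosDiagonal_natDiag _ _ _ _)))
  have hdet := toGLQ_det_pos γ
  have hxN := Rat.mul_den_eq_num ((toGLQ _ γ) 1 0)
  have hyN := Rat.mul_den_eq_num ((toGLQ _ γ) 1 1)
  have hxd : ((((toGLQ _ γ) 1 0).den : ℕ) : ℚ) ≠ 0 := by exact_mod_cast ((toGLQ _ γ) 1 0).den_nz
  have hyd : ((((toGLQ _ γ) 1 1).den : ℕ) : ℚ) ≠ 0 := by exact_mod_cast ((toGLQ _ γ) 1 1).den_nz
  have hxp : (0 : ℚ) < ((toGLQ _ γ) 1 0).den := by exact_mod_cast ((toGLQ _ γ) 1 0).den_pos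
  have hyp : (0 : ℚ) < ((toGLQ _ γ) 1 1).den := by exact_mod_cast ((toGLQ _ γ) 1 1).den_pos
  -- The bottom row of γ is multiplied by the product of its denominators to make it integral. The
  -- factor is positive, so the sign of the new lower right entry can still be read off.
  obtain ⟨g, d, hd, h0, h1⟩ := exists_sl_bottom
    (((toGLQ _ γ) 1 0).num * ((toGLQ _ γ) 1 1).den) (((toGLQ _ γ) 1 1).num * ((toGLQ _ γ) 1 0).den)
    (by
      rintro ⟨hm, hn⟩
      have hm' : ((toGLQ _ γ) 1 0).num = 0 :=
        (mul_eq_zero.mp hm).resolve_right (by exact_mod_cast ((toGLQ _ γ) 1 1).den_nz)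
      have hn' : ((toGLQ _ γ) 1 1).num = 0 :=
        (mul_eq_zero.mp hn).resolve_right (by exact_mod_cast ((toGLQ _ γ) 1 0).den_nz)
      rw [Rat.num_eq_zero.mp hm', Rat.num_eq_zero.mp hn', mul_zero, mul_zero, sub_zero] at hdet
      exact lt_irrefl _ hdet)
  have h0' : (((toGLQ _ γ) 1 0).num * ((toGLQ _ γ) 1 1).den : ℚ) * (g 0 0 : ℤ) +
      (((toGLQ _ γ) 1 1).num * ((toGLQ _ γ) 1 0).den) * (g 1 0 : ℤ) = 0 := by exact_mod_cast h0
  have h1' : (((toGLQ _ γ) 1 0).num * ((toGLQ _ γ) 1 1).den : ℚ) * (g 0 1 : ℤ) +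
      (((toGLQ _ γ) 1 1).num * ((toGLQ _ γ) 1 0).den) * (g 1 1 : ℤ) = d := by exact_mod_cast h1
  have hdq : (0 : ℚ) < d := by exact_mod_cast hd
  rw [← hxN, ← hyN] at h0' h1'
  have hmem : γ * ofSL (primesOf c) g ∈ P := by
    refine hupper _ ?_ ?_
    · rw [toGLQ_mul_apply, toGLQ_ofSL, toGLQ_ofSL]
      refine mul_left_cancel₀ (mul_ne_zero hxd hyd) ?_
      rw [mul_zero, ← h0']
      ring
    · rw [toGLQ_mul_apply, toGLQ_ofSL, toGLQ_ofSL]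
      refine pos_of_mul_pos_right (b := _) (a := (((toGLQ _ γ) 1 0).den : ℚ) * ((toGLQ _ γ) 1 1).den) ?_
        (by positivity)
      refine lt_of_lt_of_eq hdq ?_
      rw [← h1']
      ring
  have := P.mul_mem hmem (P.inv_mem (ofSL_mem hS hT g))
  rwa [mul_inv_cancel_right] at this

/-! ### Homogeneous cocycles of degree one -/

lemma hd_zero_apply {G M : Type} [AddCommGroup M] (F : (Fin 1 → G) → M) (g : Fin 2 → G) :
    hd 0 F g = F (fun _ => g 1) - F (fun _ => g 0) := by
  have h0 : (fun j : Fin 1 => g (Fin.succAbove 0 j)) = fun _ => g 1 := by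
    funext j; fin_cases j; rfl
  have h1 : (fun j : Fin 1 => g (Fin.succAbove 1 j)) = fun _ => g 0 := by
    funext j; fin_cases j; rfl
  change ∑ i : Fin 2, (-1 : ℤ) ^ (i : ℕ) • F (fun j => g (i.succAbove j)) = _
  rw [Fin.sum_univ_two, h0, h1]
  simp [sub_eq_add_neg]

lemma hd_one_apply {G M : Type} [AddCommGroup M] (F : (Fin 2 → G) → M) (g : Fin 3 → G) :
    hd 1 F g = F ![g 1, g 2] - F ![g 0, g 2] + F ![g 0, g 1] := by
  have h0 : (fun j : Fin 2 => g (Fin.succAbove 0 j)) = ![g 1, g 2] := by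
    funext j; fin_cases j <;> rfl
  have h1 : (fun j : Fin 2 => g (Fin.succAbove 1 j)) = ![g 0, g 2] := by
    funext j; fin_cases j <;> rfl
  have h2 : (fun j : Fin 2 => g (Fin.succAbove 2 j)) = ![g 0, g 1] := by
    funext j; fin_cases j <;> rfl
  change ∑ i : Fin 3, (-1 : ℤ) ^ (i : ℕ) • F (fun j => g (i.succAbove j)) = _
  rw [Fin.sum_univ_three, h0, h1, h2]
  simp [sub_eq_add_neg]

section Cocycles

variable {G : Type} [Group G] {M : Type} [AddCommGroup M] {N : Type} [AddCommGroup N]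
  {ρ : G →* AddMonoid.End M} {ρ' : G →* AddMonoid.End N}

lemma apply_mul_eq (ρ : G →* AddMonoid.End M) (γ γ' : G) (m : M) : ρ (γ * γ') m = ρ γ (ρ γ' m) := by
  rw [map_mul]; rfl

lemma apply_one_eq (ρ : G →* AddMonoid.End M) (m : M) : ρ 1 m = m := by
  rw [map_one]; rfl

/-- The elements of `G` that fix `m` modulo the submodule `K`. -/
def relStabilizer (ρ : G →* AddMonoid.End M) (K : AddSubgroup M)
    (hK : ∀ γ, ∀ x ∈ K, ρ γ x ∈ K) (m : M) : Subgroup G where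
  carrier := {γ | ρ γ m - m ∈ K}
  one_mem' := by
    change ρ 1 m - m ∈ K
    rw [apply_one_eq, sub_self]
    exact zero_mem K
  mul_mem' := fun {γ γ'} h h' => by
    have h1 : ρ (γ * γ') m - m = ρ γ (ρ γ' m - m) + (ρ γ m - m) := by
      rw [apply_mul_eq, map_sub]; abel
    change ρ (γ * γ') m - m ∈ K
    rw [h1]
    exact add_mem (hK γ _ h') h
  inv_mem' := fun {γ} h => by
    have h1 : ρ γ⁻¹ m - m = -ρ γ⁻¹ (ρ γ m - m) := by
      rw [map_sub, ← apply_mul_eq, inv_mul_cancel, apply_one_eq]; abel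
    change ρ γ⁻¹ m - m ∈ K
    rw [h1]
    exact neg_mem (hK γ⁻¹ _ h)

lemma orbit_mem_cochains (ρ : G →* AddMonoid.End M) (m : M) :
    (fun γ : Fin 1 → G => ρ (γ 0) m) ∈ cochains ρ 0 := fun γ g => by
  rw [← apply_mul_eq, mul_inv_cancel_left]

/-- This is the construction of the connecting map: a coboundary in N with values in M satisfies the
cocycle conditions already in M, by injectivity. -/
lemma exists_cocycle_of_coboundary {ι : M →+ N} (hι : Function.Injective ι)
    (hρ : ∀ γ m, ι (ρ γ m) = ρ' γ (ι m)) {x : N} (hx : ∀ γ, ρ' γ x - x ∈ ι.range) :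
    ∃ z ∈ cocycles ρ 1, ∀ g, hd 0 (fun γ : Fin 1 → G => ρ' (γ 0) x) g = ι (z g) := by
  have hmem : ∀ g : Fin 2 → G, ∃ m, ι m = ρ' (g 1) x - ρ' (g 0) x := fun g => by
    have : ρ' (g 1) x - ρ' (g 0) x = (ρ' (g 1) x - x) - (ρ' (g 0) x - x) := by abel
    rw [this]
    exact sub_mem (hx _) (hx _)
  choose z hz using hmem
  refine ⟨z, ⟨fun γ g => hι ?_, funext fun g => hι ?_⟩, fun g => ?_⟩
  · rw [hρ, hz, hz, map_sub, ← apply_mul_eq, ← apply_mul_eq, mul_inv_cancel_left,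
      mul_inv_cancel_left]
  · rw [hd_one_apply, map_add, map_sub, hz, hz, hz]
    change _ = ι 0
    rw [map_zero]
    simp
  · rw [hz, hd_zero_apply]

/-- The difference of two lifts is itself a 0-cochain with values in M, whose differential is the
difference of the cocycles. The class does not depend on the lift. -/
lemma sub_mem_coboundaries1 {ι : M →+ N} (hι : Function.Injective ι)
    (hρ : ∀ γ m, ι (ρ γ m) = ρ' γ (ι m)) {x y : (Fin 1 → G) → N} (hx : x ∈ cochains ρ' 0)
    (hy : y ∈ cochains ρ' 0) (hxy : ∀ g, x g - y g ∈ ι.range) {z w : (Fin 2 → G) → M}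
    (hz : ∀ g, hd 0 x g = ι (z g)) (hw : ∀ g, hd 0 y g = ι (w g)) : z - w ∈ coboundaries1 ρ := by
  choose s hs using hxy
  refine ⟨s, fun γ g => hι ?_, funext fun g => hι ?_⟩
  · rw [hρ, hs, hs, map_sub, hx γ g, hy γ g]
  · rw [hd_zero_apply, Pi.sub_apply, map_sub, map_sub, hs, hs, ← hz, ← hw, hd_zero_apply,
      hd_zero_apply]
    abel

lemma cocycle_rel {z : (Fin 2 → G) → M} (hz : z ∈ cocycles ρ 1) (a b d : G) :
    z ![b, d] - z ![a, d] + z ![a, b] = 0 := by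
  have h : hd 1 z ![a, b, d] = 0 := congrFun hz.2 ![a, b, d]
  rw [hd_one_apply] at h
  exact h

lemma cocycle_smul {z : (Fin 2 → G) → M} (hz : z ∈ cocycles ρ 1) (γ a b : G) :
    ρ γ (z ![a, b]) = z ![γ * a, γ * b] := by
  rw [← hz.1 γ ![γ * a, γ * b]]
  congr 2
  funext j
  fin_cases j <;> simp

/-- The elements `γ` at which a cocycle vanishes. -/
def vanishing {z : (Fin 2 → G) → M} (hz : z ∈ cocycles ρ 1) : Subgroup G where
  carrier := {γ | z ![1, γ] = 0}
  one_mem' := by simpa using cocycle_rel hz 1 1 1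
  mul_mem' := fun {γ γ'} h h' => by
    have h1 := cocycle_rel hz 1 γ (γ * γ')
    have h2 := cocycle_smul hz γ 1 γ'
    have h0 : z ![1, γ] = 0 := h
    have h0' : z ![1, γ'] = 0 := h'
    rw [mul_one] at h2
    rw [← h2, h0, h0', map_zero, zero_sub, add_zero, neg_eq_zero] at h1
    exact h1
  inv_mem' := fun {γ} h => by
    have h1 := cocycle_rel hz 1 γ⁻¹ 1
    have h2 := cocycle_smul hz γ⁻¹ 1 γ
    have h3 := cocycle_rel hz 1 1 1
    have h0 : z ![1, γ] = 0 := h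
    rw [mul_one, inv_mul_cancel, h0, map_zero] at h2
    rw [sub_self, zero_add] at h3
    rw [← h2, h3, sub_zero, zero_add] at h1
    exact h1

/-- By homogeneity the value at (g₀, g₁) is a translate of the value at (1, g₀⁻¹g₁). -/
lemma cocycle_eq_zero {z : (Fin 2 → G) → M} (hz : z ∈ cocycles ρ 1) (h : ∀ γ, γ ∈ vanishing hz) :
    z = 0 := by
  funext g
  have h1 := cocycle_smul hz (g 0) 1 ((g 0)⁻¹ * g 1)
  have h2 : z ![1, (g 0)⁻¹ * g 1] = 0 := h _
  have h3 : ![g 0 * 1, g 0 * ((g 0)⁻¹ * g 1)] = g := by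
    funext j
    fin_cases j <;> simp
  rw [h2, map_zero, h3] at h1
  exact h1.symm

end Cocycles

/-! ### The Kato–Siegel distribution and the Dedekind–Rademacher cocycle -/

lemma intCast_OH_apply (m : ℤ) (τ : ℍ) : ((m : ℤ) : OH).1 τ = m := by
  rw [← map_intCast constOH m]; rfl

lemma intCast_OH_injective : Function.Injective (Int.castAddHom OH) := fun m n h => by
  have h1 : ((m : ℤ) : OH).1 I = ((n : ℤ) : OH).1 I := congrArg (fun k : OH => k.1 I) h
  rw [intCast_OH_apply, intCast_OH_apply] at h1
  exact_mod_cast h1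

/-- The inclusion of the `ℤ`-valued distributions. -/
def castDist (S : Set Nat.Primes) : Dist S ℤ →+ Dist S OH where
  toFun ν := (Int.castAddHom OH).comp ν
  map_zero' := by ext f; simp
  map_add' ν ν' := AddMonoidHom.ext fun f => Int.cast_add (ν f) (ν' f)

lemma castDist_injective (S : Set Nat.Primes) : Function.Injective (castDist S) := fun _ _ h =>
  AddMonoidHom.ext fun f => intCast_OH_injective (DFunLike.congr_fun h f)

lemma castDist_equivariant {S : Set Nat.Primes} (γ : GS S) (ν : Dist S ℤ) :
    castDist S (repZ S γ ν) = repO S γ (castDist S ν) :=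
  AddMonoidHom.ext fun f => (map_intCast (moebius S γ) (ν (slash f (toGLQ S γ)))).symm

lemma mem_range_castDist {S : Set Nat.Primes} {μ : Dist S OH} (h : ∀ f, ∃ m : ℤ, μ f = m) :
    μ ∈ (castDist S).range := by
  choose ν hν using h
  refine ⟨AddMonoidHom.mk' ν fun f g => intCast_OH_injective ?_,
    AddMonoidHom.ext fun f => (hν f).symm⟩
  change ((ν (f + g) : ℤ) : OH) = ((ν f + ν g : ℤ) : OH)
  rw [Int.cast_add, ← hν, ← hν, ← hν, map_add]

lemma expOH_apply (h : OH) (τ : ℍ) :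
    ((expOH h).toMul : OH).1 τ = Complex.exp (2 * Real.pi * Complex.I * h.1 τ) := rfl

lemma additive_units_ext {x y : Additive OHˣ}
    (h : ∀ τ, ((x.toMul : OHˣ) : OH).1 τ = ((y.toMul : OHˣ) : OH).1 τ) : x = y :=
  Additive.toMul.injective (Units.ext (OH_ext h))

lemma expOH_intCast (m : ℤ) : expOH (m : OH) = 0 := by
  refine additive_units_ext fun τ => ?_
  rw [expOH_apply, intCast_OH_apply]
  refine (e_intCast m).trans ?_
  rfl

/-- Exactness of the exponential sequence at 𝒪_ℋ: the upper half plane is connected, so the integer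
is the same at all points. -/
lemma exists_int_of_expOH_eq_zero {h : OH} (hh : expOH h = 0) : ∃ m : ℤ, h = m := by
  have h1 : ∀ τ : ℍ, Complex.exp (2 * Real.pi * Complex.I * h.1 τ) = 1 := fun τ => by
    rw [← expOH_apply, hh]; rfl
  have hcont : Continuous fun τ : ℍ => 2 * Real.pi * Complex.I * h.1 τ :=
    continuous_const.mul (MDifferentiable.continuous h.2)
  obtain ⟨m, hm⟩ := Complex.exp_eq_one_iff.mp (h1 I)
  refine ⟨m, OH_ext fun τ => ?_⟩
  have h2 := eq_of_exp_eq_const isPreconnected_univ hcont.continuousOn (fun x _ => h1 x)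
    (Set.mem_univ τ) (Set.mem_univ I)
  rw [intCast_OH_apply]
  have hπ : (2 * Real.pi * Complex.I : ℂ) ≠ 0 := Complex.two_pi_I_ne_zero
  rw [hm, mul_comm (m : ℂ)] at h2
  exact mul_left_cancel₀ hπ h2

lemma repU_expOH {S : Set Nat.Primes} (γ : GS S) (μ : Dist S OH) :
    repU S γ (expOH.comp μ) = expOH.comp (repO S γ μ) :=
  AddMonoidHom.ext fun _ => additive_units_ext fun _ => rfl

section Main

variable {c : ℕ}

lemma natDiag_mem_stabilizer [NeZero c] (i j : ℕ) [NeZero i] [NeZero j] (hi : i.Coprime c) (hj : j.Coprime c) :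
    repO _ (natDiag i j hi hj) (distE c) = distE c :=
  repO_distE_diag hi hj rfl rfl rfl rfl

lemma repO_distE_of_isPosDiagonal [NeZero c] {γ : GS (primesOf c)} (hγ : IsPosDiagonal γ) :
    repO _ γ (distE c) = distE c := by
  have h : γ ∈ relStabilizer (repO (primesOf c)) ⊥ (fun γ x hx => by
      rw [AddSubgroup.mem_bot.mp hx, map_zero]; exact zero_mem _) (distE c) := by
    refine mem_of_isPosDiagonal (fun i j _ _ hi hj => ?_) hγ
    change _ ∈ (⊥ : AddSubgroup _)
    rw [natDiag_mem_stabilizer, sub_self]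
    exact zero_mem _
  exact sub_eq_zero.mp (AddSubgroup.mem_bot.mp h)

/-- The scalar matrix n lies in G_S and acts trivially on the upper half plane. Invariance therefore
extends the prescribed values to scaled cosets, which generate; this gives uniqueness. -/
lemma IsKatoSiegel.gen {μ : Dist (primesOf c) (Additive OHˣ)} (hμ : IsKatoSiegel c μ) {v : V}
    (hS : ∀ i, v i ∈ ZS (primesOf c)) (hv : ¬ IsInt v) {n : ℕ} [NeZero n] (hn : n.Coprime c) (τ : ℍ) :
    ((μ (slash (cosetTest (primesOf c) v hS hv) (scalarD n))).toMul : OH).1 τ =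
      katoSiegelUnit c v τ := by
  have h1 : toGLQ _ (natDiag n n hn hn) = scalarD n := by
    refine Units.ext (Matrix.ext fun i j => ?_)
    refine (natDiag_apply n n hn hn i j).trans ((?_ : _ = _).trans (scalarD_apply n i j).symm)
    fin_cases i <;> simp
  have h2 := DFunLike.congr_fun (hμ.1 (natDiag n n hn hn)) (cosetTest (primesOf c) v hS hv)
  have h3 : (((repU _ (natDiag n n hn hn) μ) (cosetTest (primesOf c) v hS hv)).toMul : OH).1 τ =
      ((μ (slash (cosetTest (primesOf c) v hS hv) (toGLQ _ (natDiag n n hn hn)))).toMul : OH).1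
        (toGLR _ (natDiag n n hn hn)⁻¹ • τ) := rfl
  have h4 : toGLR _ (natDiag n n hn hn)⁻¹ • τ = τ := by
    refine UpperHalfPlane.ext ?_
    rw [coe_diag_inv_smul (i := n) (j := n) rfl rfl rfl rfl]
    exact mul_div_cancel_left₀ _ (by exact_mod_cast NeZero.ne n)
  rw [h2, h4, h1] at h3
  exact h3.symm.trans (hμ.2 v hS hv τ)

lemma IsKatoSiegel.eq {μ ν : Dist (primesOf c) (Additive OHˣ)} (hμ : IsKatoSiegel c μ)
    (hν : IsKatoSiegel c ν) : μ = ν :=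
  dist_ext fun _ hS hv _ _ hn => additive_units_ext fun τ => by
    rw [hμ.gen hS hv hn, hν.gen hS hv hn]

variable [NeZero c] (hodd : ∃ m, c = 2 * m + 1) (h12 : (12 : ℤ) ∣ (c : ℤ) ^ 2 - 1)

include hodd h12

/-- The elements moving Ẽ by a ℤ-valued distribution form a subgroup. It contains S and T by
integrality of `distS` and `distT`, and the positive diagonal matrices because they fix Ẽ. -/
lemma repO_distE_sub_mem (γ : GS (primesOf c)) :
    repO _ γ (distE c) - distE c ∈ (castDist (primesOf c)).range := by
  let P := relStabilizer (repO (primesOf c)) (castDist (primesOf c)).range (fun γ x hx => by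
      obtain ⟨ν, rfl⟩ := hx
      exact ⟨repZ _ γ ν, castDist_equivariant γ ν⟩) (distE c)
  have hcast : ∀ μ : Dist (primesOf c) ℚ, (∀ f, ∃ m : ℤ, μ f = m) →
      (constOH.toAddMonoidHom.comp (Rat.castHom ℂ).toAddMonoidHom).comp μ ∈
        (castDist (primesOf c)).range := fun μ hμ => by
    refine mem_range_castDist fun f => ?_
    obtain ⟨m, hm⟩ := hμ f
    refine ⟨m, OH_ext fun τ => ?_⟩
    rw [intCast_OH_apply]
    change ((μ f : ℚ) : ℂ) = m
    rw [hm, Rat.cast_intCast]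
  refine eq_top_of_generators (P := P) ?_ ?_ (fun γ hγ => ?_) γ
  · change repO _ _ (distE c) - distE c ∈ (castDist (primesOf c)).range
    rw [repO_matS, add_sub_cancel_left]
    exact hcast _ (dist_isInt fun v hS hv n _ hn => distS_gen_isInt hS hv hn hodd)
  · change repO _ _ (distE c) - distE c ∈ (castDist (primesOf c)).range
    rw [repO_matT, add_sub_cancel_left]
    exact hcast _ (dist_isInt fun v hS hv n _ hn => distT_gen_isInt hS hv hn hodd h12)
  · change repO _ _ (distE c) - distE c ∈ (castDist (primesOf c)).range
    rw [repO_distE_of_isPosDiagonal hγ, sub_self]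
    exact zero_mem _

lemma isKatoSiegel_exp : IsKatoSiegel c (expOH.comp (distE c)) := by
  refine ⟨fun γ => ?_, fun v hS hv τ => exp_distE_cosetTest hodd hS hv τ⟩
  obtain ⟨ν, hν⟩ := repO_distE_sub_mem hodd h12 γ
  rw [repU_expOH, ← sub_add_cancel (repO _ γ (distE c)) (distE c), ← hν]
  refine AddMonoidHom.ext fun f => ?_
  change expOH (((ν f : ℤ) : OH) + distE c f) = expOH (distE c f)
  rw [map_add, expOH_intCast, zero_add]

end Main

lemma dvd_sq_sub_one {c : ℕ} (h2 : ¬ 2 ∣ c) (h3 : ¬ 3 ∣ c) : (12 : ℤ) ∣ (c : ℤ) ^ 2 - 1 := by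
  have hr : c % 12 = 1 ∨ c % 12 = 5 ∨ c % 12 = 7 ∨ c % 12 = 11 := by omega
  have hq := Nat.div_add_mod c 12
  generalize c / 12 = q at hq
  rcases hr with h | h | h | h <;> rw [h] at hq <;> rw [← hq]
  · exact ⟨12 * q ^ 2 + 2 * q, by push_cast; ring⟩
  · exact ⟨12 * q ^ 2 + 10 * q + 2, by push_cast; ring⟩
  · exact ⟨12 * q ^ 2 + 14 * q + 4, by push_cast; ring⟩
  · exact ⟨12 * q ^ 2 + 22 * q + 10, by push_cast; ring⟩

end DedekindRademacher

end

/-! ### The main theorem -/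

theorem mainTheorem2 (c : ℕ) [NeZero c] (hc : 1 < c) (hc6 : Nat.Coprime c 6) :
    (∃! μ : Dist (primesOf c) (Additive OHˣ), IsKatoSiegel c μ) ∧
    ∃ E : Dist (primesOf c) OH,
      (∀ (f : Test' (primesOf c)) (τ : ℍ), (E f).1 τ = Etilde c f τ) ∧
      ∃ DR : cocycles (repZ (primesOf c)) 1,
        (∀ (g : Fin 2 → GS (primesOf c)) (f : Test' (primesOf c)),
          hd 0 (fun γ => repO (primesOf c) (γ 0) E) g f =
            (((DR : (Fin 2 → GS (primesOf c)) → Dist (primesOf c) ℤ) g f : ℤ) : OH)) ∧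
        (∀ μ : Dist (primesOf c) (Additive OHˣ), IsKatoSiegel c μ →
          ∀ x : H1 (repZ (primesOf c)),
            IsConnecting (primesOf c) μ x ↔ x = QuotientAddGroup.mk DR) ∧
        ∀ C : (Fin 2 → GS (primesOf c)) → Dist (primesOf c) ℤ,
          C ∈ cocycles (repZ (primesOf c)) 1 →
          (((∀ γ : GS (primesOf c), IsPosDiagonal γ → C ![1, γ] = 0) ∧
            (∀ f : Test' (primesOf c),
              ((C ![1, matT (primesOf c)] f : ℤ) : ℚ) =
                -(1 / 2) * B2B0 c (slash f (toGLQ _ (matT (primesOf c)))) +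
                  Psi c (slash f (toGLQ _ (matT (primesOf c))) - f)) ∧
            (∀ f : Test' (primesOf c),
              ((C ![1, matS (primesOf c)] f : ℤ) : ℚ) =
                B1B1 c f + Psi c (slash f (toGLQ _ (matS (primesOf c))) - f))) ↔
          C = DR) := by
  have h2 : ¬ 2 ∣ c := fun h => by
    have := Nat.dvd_gcd h (by norm_num : 2 ∣ 6)
    rw [hc6] at this
    omega
  have h3 : ¬ 3 ∣ c := fun h => by
    have := Nat.dvd_gcd h (by norm_num : 3 ∣ 6)
    rw [hc6] at this
    omega
  have hodd : ∃ m, c = 2 * m + 1 := ⟨c / 2, by omega⟩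
  have h12 : (12 : ℤ) ∣ (c : ℤ) ^ 2 - 1 := dvd_sq_sub_one h2 h3
  have hKS := isKatoSiegel_exp hodd h12
  obtain ⟨D, hD, hED⟩ := exists_cocycle_of_coboundary (castDist_injective (primesOf c))
    castDist_equivariant (repO_distE_sub_mem hodd h12)
  have hD1 : ∀ γ, castDist _ (D ![1, γ]) = repO _ γ (distE c) - distE c := fun γ => by
    rw [← hED, hd_zero_apply]
    change repO _ γ (distE c) - repO _ 1 (distE c) = _
    rw [apply_one_eq]
  refine ⟨⟨_, hKS, fun ν hν => hν.eq hKS⟩, distE c, distE_eq_Etilde c, ⟨D, hD⟩,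
    fun g f => DFunLike.congr_fun (hED g) f, fun μ hμ x => ?_, fun C hC => ?_⟩
  · rw [hμ.eq hKS]
    constructor
    -- An arbitrary lift x of μ_KS is compared with the orbit of Ẽ. Both exponentiate to the same
    -- distribution, so their difference is ℤ-valued.
    · rintro ⟨x, hx, hxμ, z, hz, rfl⟩
      have hz' : ∀ g, hd 0 x g = castDist _ (z.1 g) := fun g => AddMonoidHom.ext (hz g)
      have hsub := sub_mem_coboundaries1 (castDist_injective (primesOf c)) castDist_equivariant
        (orbit_mem_cochains (repO (primesOf c)) (distE c)) hx (fun g => ?_) hED hz'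
      · refine QuotientAddGroup.eq.mpr (AddSubgroup.mem_addSubgroupOf.mpr ?_)
        change -z.1 + D ∈ _
        rwa [neg_add_eq_sub]
      · refine mem_range_castDist fun f => exists_int_of_expOH_eq_zero ?_
        have h1 : expOH (repO _ (g 0) (distE c) f) = expOH (distE c f) := by
          have := DFunLike.congr_fun (hKS.1 (g 0)) f
          rwa [repU_expOH] at this
        have h4 : expOH (x g f) = expOH (distE c f) := hxμ g f
        change expOH (repO _ (g 0) (distE c) f - x g f) = 0
        rw [map_sub, h1, h4, sub_self]
    · rintro rfl
      refine ⟨_, orbit_mem_cochains (repO (primesOf c)) (distE c), fun g f => ?_, ⟨D, hD⟩,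
        fun g f => DFunLike.congr_fun (hED g) f, rfl⟩
      have := DFunLike.congr_fun (hKS.1 (g 0)) f
      rwa [repU_expOH] at this
  · have hDdiag : ∀ γ : GS (primesOf c), IsPosDiagonal γ → D ![1, γ] = 0 := fun γ hγ => by
      refine castDist_injective _ ?_
      rw [hD1, repO_distE_of_isPosDiagonal hγ, sub_self, map_zero]
    -- The values of D are constant functions, so evaluation at the point i turns the identity in
    -- 𝒪_ℋ into one between rational numbers.
    have hval : ∀ γ (μ : Dist (primesOf c) ℚ), repO _ γ (distE c) = distE c +
        (constOH.toAddMonoidHom.comp (Rat.castHom ℂ).toAddMonoidHom).comp μ →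
        ∀ f, ((D ![1, γ] f : ℤ) : ℚ) = μ f := fun γ μ h f => by
      have h1 := DFunLike.congr_fun (hD1 γ) f
      rw [h, add_sub_cancel_left] at h1
      have h4 : (((D ![1, γ] f : ℤ) : OH)).1 I = ((μ f : ℚ) : ℂ) :=
        congrArg (fun k : OH => k.1 I) h1
      rw [intCast_OH_apply] at h4
      exact_mod_cast h4
    have hDT := hval _ _ (repO_matT c)
    have hDS := hval _ _ (repO_matS c)
    constructor
    · rintro ⟨hCd, hCT, hCS⟩
      have hsub : C - D ∈ cocycles (repZ (primesOf c)) 1 := sub_mem hC hD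
      -- The elements at which the cocycle C - D vanishes form a subgroup, and the three prescribed
      -- properties place all the generators in it.
      refine sub_eq_zero.mp (cocycle_eq_zero hsub fun γ => eq_top_of_generators ?_ ?_ ?_ γ)
      · change C ![1, matS _] - D ![1, matS _] = 0
        refine sub_eq_zero.mpr (AddMonoidHom.ext fun f => ?_)
        exact_mod_cast (hCS f).trans ((distS_apply c f).symm.trans (hDS f).symm)
      · change C ![1, matT _] - D ![1, matT _] = 0
        refine sub_eq_zero.mpr (AddMonoidHom.ext fun f => ?_)
        exact_mod_cast (hCT f).trans ((distT_apply c f).symm.trans (hDT f).symm)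
      · intro γ hγ
        change C ![1, γ] - D ![1, γ] = 0
        rw [hCd γ hγ, hDdiag γ hγ, sub_self]
    · rintro rfl
      exact ⟨hDdiag, fun f => (hDT f).trans (distT_apply c f),
        fun f => (hDS f).trans (distS_apply c f)⟩
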